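/- Let $\mathbb K$ be a field of characteristic $0$, and let $V=V_0\oplus V_1$ (brackets $l_1,l_2,l_3$) and $W=W_0\oplus W_1$ (brackets $m_1,m_2,m_3$) be 2-term Leibniz infinity algebras over $\mathbb K$: $|l_i|=i-2$ and, for $w,x,y,z\in V_0$, $h,k\in V_1$, (a) $l_1l_2(x,h)=l_2(x,l_1h)$, $l_1l_2(h,x)=l_2(l_1h,x)$; (b) $l_2(l_1h,k)=l_2(h,l_1k)$; (c) $l_1l_3(x,y,z)=l_2(x,l_2(y,z))-l_2(y,l_2(x,z))-l_2(l_2(x,y),z)$; (d) $l_3(x,y,l_1h)=l_2(x,l_2(y,h))-l_2(y,l_2(x,h))-l_2(l_2(x,y),h)$, and the same identity with $(x,y,h)$ replaced by $(x,h,y)$ and by $(h,x,y)$ (with $l_1$ applied to $h$ on the left-hand side); (e) $l_2(l_3(w,x,y),z)+l_2(w,l_3(x,y,z))-l_2(x,l_3(w,y,z))+l_2(y,l_3(w,x,z))-l_3(l_2(w,x),y,z)+l_3(w,l_2(x,y),z)-l_3(x,l_2(w,y),z)-l_3(w,x,l_2(y,z))+l_3(w,y,l_2(x,z))-l_3(x,y,l_2(w,z))=0$.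 An infinity morphism $f=(f_1,f_2):V\to W$ consists of $f_1:V\to W$ of degree $0$ and $f_2:V_0\times V_0\to W_1$ with $m_1f_1h=f_1l_1h$; $m_2(f_1x,f_1y)+m_1f_2(x,y)=f_1l_2(x,y)$; $m_2(f_1x,f_1h)=f_1l_2(x,h)-f_2(x,l_1h)$; $m_2(f_1h,f_1x)=f_1l_2(h,x)-f_2(l_1h,x)$; $m_3(f_1x,f_1y,f_1z)-m_2(f_2(x,y),f_1z)+m_2(f_1x,f_2(y,z))-m_2(f_1y,f_2(x,z))=f_1l_3(x,y,z)+f_2(l_2(x,y),z)-f_2(x,l_2(y,z))+f_2(y,l_2(x,z))$. A 2-term $\infty$-homotopy $\theta_1:f\Rightarrow g$ is a linear map $\theta_1:V_0\to W_1$ with $g_1x-f_1x=m_1\theta_1x$, $g_1h-f_1h=\theta_1l_1h$ and $g_2(x,y)-f_2(x,y)=\theta_1l_2(x,y)-m_2(f_1x,\theta_1y)-m_2(\theta_1x,g_1y)$. Let $L=\mathrm{Hom}_{\mathbb K}(\mathrm{Zin}^c(sV),W)$ be the convolution Lie infinity algebra. Here $\mathrm{Zin}^c(sV)=\bigoplus_{n\ge1}(sV)^{\otimes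 n}$ has the comultiplication $\Delta(v_1\cdots v_p)=\sum_{k=1}^{p-1}\sum_{\sigma\in\mathrm{Sh}(k,p-k-1)}\varepsilon(\sigma)\,(v_{\sigma(1)}\cdots v_{\sigma(k)})\otimes(v_{\sigma(k+1)}\cdots v_{\sigma(p-1)}v_p)$ and the coderivation $D$ whose corestrictions $D_i$ satisfy $l_i=s^{-1}D_is^{\otimes i}$; $\mathcal L_1f=m_1f+(-1)^{|f|}fD$, and $\mathcal L_p(f_1,\dots,f_p)=m_p\circ\big(\sum_{\sigma\in S(p)}\varepsilon(\sigma)\,\mathrm{sign}(\sigma)\,f_{\sigma(1)}\otimes\cdots\otimes f_{\sigma(p)}\big)\circ\Delta^{p-1}$ for $p\ge2$ (zero for $p\ge4$). Infinity morphisms $f$ are viewed as elements of $L_{-1}$ with components $f_1s^{-1}$ and $f_2(s^{\otimes2})^{-1}$. Let $\Omega_n$ be the algebra of polynomial differential forms on $\Delta^n$ (a $k$-form has degree $-k$), let $\bar{\mathcal L}_i$ be the brackets of $L\otimes\Omega_n$ obtained by extension of scalars, with $\bar{\mathcal L}_1=\delta+d$, and let $\mathrm{MC}_n$ be the set of $\alpha\in(L\otimes\Omega_n)_{-1}$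 with $(\delta+d)\alpha+\bar R(\alpha)=0$, where $\bar R(\alpha)=\sum_{i\ge2}\frac{(-1)^{i(i-1)/2}}{i!}\bar{\mathcal L}_i(\alpha,\dots,\alpha)$. Let $\varepsilon_n^i$ be the evaluation at the vertex $e_i$ and let $h_n^i\omega=\int_{[0,1]}(\phi_n^i)^*\omega$, $\phi_n^i(u,t)=ut+(1-u)e_i$, both extended to $L\otimes\Omega_n$ with Koszul signs. For $\mu\in L_{-1}$ and $\nu\in (L\otimes\Omega_n)_{-1}$ let $\mathcal B_n^i(\mu,\nu)$ be the element at which the sequence $\alpha_0=\mu+\nu$, $\alpha_{k+1}=\alpha_0-h_n^i\bar R(\alpha_k)$ stabilizes, if it does. Let $\mathcal I(f,g)$ be the set of $\infty$-homotopies from $f$ to $g$, i.e. of $\alpha\in\mathrm{MC}_1$ with $\varepsilon_1^0\alpha=f$, $\varepsilon_1^1\alpha=g$, and for $\alpha\in\mathrm{MC}_1$ let $S_1^i\alpha=(\beta(1)-\beta(0))s:V_0\to W_1$, where $\beta=h_1^i\alpha$. An element $\alpha\in\mathcal I(f,g)$ with $S_1^i\alpha=\theta_1$ is called a lift of $\theta_1$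 along $S_1^i$. Theorem. Let $\theta_1:f\Rightarrow g$ and $\tau_1:g\Rightarrow h$ be 2-term $\infty$-homotopies between infinity morphisms $f,g,h:V\to W$. Then: 1. There are a lift $\alpha'\in\mathcal I(f,g)$ of $\theta_1$ along $S_1^1$ and a lift $\alpha''\in\mathcal I(g,h)$ of $\tau_1$ along $S_1^0$. 2. For any such lifts, there is $\beta\in(L\otimes\Omega_2)_0$ whose restrictions to the faces $01$ and $12$ are $h_1^1\alpha'$ and $h_1^0\alpha''$. For any such $\beta$, the element $\alpha=\mathcal B_2^1(g,(\delta+d)\beta)$ exists, it lies in $\mathrm{MC}_2$ and fills the horn $\Lambda^1[2]$ given by $\alpha'$ on $01$ and $\alpha''$ on $12$, its restriction to $02$ lies in $\mathcal I(f,h)$, and $S_1^0(\alpha|_{02})=\tau_1+\theta_1$. 3. Consequently the vertical composite $\tau_1\circ_1\theta_1$, defined as $S_1^0(\alpha|_{02})$ for arbitrary choices of $\alpha',\alpha'',\beta$ as above, is well defined, it is equal to $\tau_1+\theta_1$, and it is a 2-term $\infty$-homotopy $f\Rightarrow h$. -/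

import Mathlib

open scoped TensorProduct

noncomputable section

namespace LeibnizHomotopy

/-! ## 2-term Leibniz infinity algebras, infinity morphisms, 2-term infinity homotopies -/

section TwoTerm

/-- A 2-term (homological) Leibniz infinity algebra on `V = V₀ ⊕ V₁`. The binary bracket, of degree
`0`, is given by its three possibly nonzero components `l00`, `l01`, `l10`; the ternary one, of
degree `1`, by its only possibly nonzero component `V₀ × V₀ × V₀ → V₁`. -/
structure TwoTermLeibniz (K V₀ V₁ : Type*) [Field K] [AddCommGroup V₀] [Module K V₀]
    [AddCommGroup V₁] [Module K V₁] where
  l1 : V₁ →ₗ[K] V₀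
  l00 : V₀ →ₗ[K] V₀ →ₗ[K] V₀
  l01 : V₀ →ₗ[K] V₁ →ₗ[K] V₁
  l10 : V₁ →ₗ[K] V₀ →ₗ[K] V₁
  l3 : V₀ →ₗ[K] V₀ →ₗ[K] V₀ →ₗ[K] V₁
  l1_l01 : ∀ x h, l1 (l01 x h) = l00 x (l1 h)
  l1_l10 : ∀ h x, l1 (l10 h x) = l00 (l1 h) x
  l1_comm : ∀ h k, l01 (l1 h) k = l10 h (l1 k)
  l1_l3 : ∀ x y z, l1 (l3 x y z) = l00 x (l00 y z) - l00 y (l00 x z) - l00 (l00 x y) z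
  l3_l1_right : ∀ x y h, l3 x y (l1 h) = l01 x (l01 y h) - l01 y (l01 x h) - l01 (l00 x y) h
  l3_l1_mid : ∀ x h y, l3 x (l1 h) y = l01 x (l10 h y) - l10 h (l00 x y) - l10 (l01 x h) y
  l3_l1_left : ∀ h x y, l3 (l1 h) x y = l10 h (l00 x y) - l01 x (l10 h y) - l10 (l10 h x) y
  jacobi : ∀ w x y z,
    l10 (l3 w x y) z + l01 w (l3 x y z) - l01 x (l3 w y z) + l01 y (l3 w x z)
      - l3 (l00 w x) y z + l3 w (l00 x y) z - l3 x (l00 w y) z - l3 w x (l00 y z)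
      + l3 w y (l00 x z) - l3 x y (l00 w z) = 0

variable {K V₀ V₁ W₀ W₁ : Type*} [Field K]
  [AddCommGroup V₀] [Module K V₀] [AddCommGroup V₁] [Module K V₁]
  [AddCommGroup W₀] [Module K W₀] [AddCommGroup W₁] [Module K W₁]

/-- An infinity morphism `(f₁, f₂)` between 2-term Leibniz infinity algebras: `f₁` has degree `0`
(components `f0 : V₀ → W₀` and `f1 : V₁ → W₁`), `f₂` has degree `1` (component
`f2 : V₀ × V₀ → W₁`). -/
structure InftyMorphism (A : TwoTermLeibniz K V₀ V₁) (B : TwoTermLeibniz K W₀ W₁) where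
  f0 : V₀ →ₗ[K] W₀
  f1 : V₁ →ₗ[K] W₁
  f2 : V₀ →ₗ[K] V₀ →ₗ[K] W₁
  comm_l1 : ∀ h, B.l1 (f1 h) = f0 (A.l1 h)
  comm_l00 : ∀ x y, B.l00 (f0 x) (f0 y) + B.l1 (f2 x y) = f0 (A.l00 x y)
  comm_l01 : ∀ x h, B.l01 (f0 x) (f1 h) = f1 (A.l01 x h) - f2 x (A.l1 h)
  comm_l10 : ∀ h x, B.l10 (f1 h) (f0 x) = f1 (A.l10 h x) - f2 (A.l1 h) x
  comm_l3 : ∀ x y z,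
    B.l3 (f0 x) (f0 y) (f0 z) - B.l10 (f2 x y) (f0 z) + B.l01 (f0 x) (f2 y z)
        - B.l01 (f0 y) (f2 x z)
      = f1 (A.l3 x y z) + f2 (A.l00 x y) z - f2 x (A.l00 y z) + f2 y (A.l00 x z)

/-- `θ` (a linear map `V → W` of degree `1`, i.e. a linear map `V₀ → W₁`) is a 2-term infinity
homotopy from `f` to `g`. -/
structure IsTwoTermHomotopy {A : TwoTermLeibniz K V₀ V₁} {B : TwoTermLeibniz K W₀ W₁}
    (f g : InftyMorphism A B) (θ : V₀ →ₗ[K] W₁) : Prop where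
  deg_zero : ∀ x, g.f0 x - f.f0 x = B.l1 (θ x)
  deg_one : ∀ h, g.f1 h - f.f1 h = θ (A.l1 h)
  two : ∀ x y, g.f2 x y - f.f2 x y
    = θ (A.l00 x y) - B.l01 (f.f0 x) (θ y) - B.l10 (θ x) (g.f0 y)

end TwoTerm

/-! ## Koszul signs

Signs only depend on parities, and the parity of a graded module is recorded by the involution
`v ↦ (-1)^{|v|} v`. -/

section Koszul

variable {K A B C D : Type*} [Field K] [AddCommGroup A] [Module K A] [AddCommGroup B] [Module K B]
  [AddCommGroup C] [Module K C] [AddCommGroup D] [Module K D]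

/-- If `p`, `q` are the parity involutions of `A`, `B`: the map `a ⊗ b ↦ (-1)^{|a||b|} a ⊗ b`. -/
def koszulSign (p : A →ₗ[K] A) (q : B →ₗ[K] B) : A ⊗[K] B →ₗ[K] A ⊗[K] B :=
  (2⁻¹ : K) • (LinearMap.id + TensorProduct.map p LinearMap.id + TensorProduct.map LinearMap.id q
    - TensorProduct.map p q)

/-- The Koszul braiding `a ⊗ b ↦ (-1)^{|a||b|} b ⊗ a`. -/
def braid (p : A →ₗ[K] A) (q : B →ₗ[K] B) : A ⊗[K] B →ₗ[K] B ⊗[K] A :=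
  (TensorProduct.comm K A B).toLinearMap ∘ₗ koszulSign p q

/-- The middle exchange `(a ⊗ b) ⊗ (c ⊗ d) ↦ (-1)^{|b||c|} (a ⊗ c) ⊗ (b ⊗ d)`, where `q`, `r` are
the parity involutions of `B`, `C`. -/
def middleBraid (q : B →ₗ[K] B) (r : C →ₗ[K] C) :
    (A ⊗[K] B) ⊗[K] (C ⊗[K] D) →ₗ[K] (A ⊗[K] C) ⊗[K] (B ⊗[K] D) :=
  (TensorProduct.tensorTensorTensorComm K A B C D).toLinearMap ∘ₗ
    koszulSign (TensorProduct.map LinearMap.id q) (TensorProduct.map r LinearMap.id)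

/-- The parity involution of a space of linear maps: `f ↦ (-1)^{|f|} f = q ∘ f ∘ p`. -/
def homParity (p : A →ₗ[K] A) (q : B →ₗ[K] B) : (A →ₗ[K] B) →ₗ[K] (A →ₗ[K] B) :=
  LinearMap.llcomp K A B B q ∘ₗ LinearMap.lcomp K B p

/-- Tensor product of linear maps, with `(f ⊗ g)(a ⊗ b) = (-1)^{|g||a|} f(a) ⊗ g(b)`. -/
def koszulHom (pA : A →ₗ[K] A) (pB : B →ₗ[K] B) (pD : D →ₗ[K] D) :
    (A →ₗ[K] C) ⊗[K] (B →ₗ[K] D) →ₗ[K] (A ⊗[K] B →ₗ[K] C ⊗[K] D) :=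
  TensorProduct.homTensorHomMap (RingHom.id K) A B C D ∘ₗ
    koszulSign (LinearMap.lcomp K C pA) (homParity pB pD)

/-- Graded antisymmetrization `f₁ ⊗ f₂ ↦ ∑_σ ε(σ) sign(σ) f_{σ(1)} ⊗ f_{σ(2)}`. -/
def antisymm₂ (p : A →ₗ[K] A) : A ⊗[K] A →ₗ[K] A ⊗[K] A :=
  LinearMap.id - braid p p

/-- Graded antisymmetrization `∑_{σ ∈ S(3)} ε(σ) sign(σ) f_{σ(1)} ⊗ f_{σ(2)} ⊗ f_{σ(3)}`; the signed
actions of the permutations are the composites of the two adjacent braidings. -/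
def antisymm₃ (p : A →ₗ[K] A) : (A ⊗[K] A) ⊗[K] A →ₗ[K] (A ⊗[K] A) ⊗[K] A :=
  let s : (A ⊗[K] A) ⊗[K] A →ₗ[K] (A ⊗[K] A) ⊗[K] A := LinearMap.rTensor A (braid p p)
  let t : (A ⊗[K] A) ⊗[K] A →ₗ[K] (A ⊗[K] A) ⊗[K] A :=
    (TensorProduct.assoc K A A A).symm.toLinearMap ∘ₗ LinearMap.lTensor A (braid p p) ∘ₗ
      (TensorProduct.assoc K A A A).toLinearMap
  LinearMap.id - s - t + s ∘ₗ t + t ∘ₗ s - s ∘ₗ t ∘ₗ s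

end Koszul

/-! ## The quasi-free Zinbiel coalgebra of a 2-term Leibniz infinity algebra -/

section Zinbiel

section Folds

variable {K X S : Type*} [Field K] [AddCommGroup X] [Module K X] [AddCommGroup S] [Module K S]

/-- `x₁ ⋯ xₙ ↦ R x₁ (R x₂ (⋯ (R xₙ s)))`. -/
def foldLeft (R : X →ₗ[K] Module.End K S) (s : S) : TensorAlgebra K X →ₗ[K] S :=
  LinearMap.applyₗ s ∘ₗ (TensorAlgebra.lift K R).toLinearMap

/-- `x₁ ⋯ xₙ ↦ R xₙ (⋯ (R x₂ (R x₁ s)))`. -/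
def foldRight (R : X →ₗ[K] Module.End K S) (s : S) : TensorAlgebra K X →ₗ[K] S :=
  LinearMap.applyₗ s ∘ₗ (MulOpposite.opLinearEquiv K).symm.toLinearMap ∘ₗ
    (TensorAlgebra.lift K ((MulOpposite.opLinearEquiv K).toLinearMap ∘ₗ R)).toLinearMap

end Folds

variable (K V₀ V₁ : Type*) [Field K] [AddCommGroup V₀] [Module K V₀] [AddCommGroup V₁] [Module K V₁]

/-- The tensor module on the suspension `sV`, whose underlying space is `V₀ × V₁`, with `sV₀` in
degree `1` and `sV₁` in degree `2`. -/
abbrev Words := TensorAlgebra K (V₀ × V₁)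

/-- `Zin^c(sV)`, the reduced tensor module `⨁_{n ≥ 1} (sV)^{⊗ n}`, in the form `T(sV) ⊗ sV`: the
word `x₁ ⋯ xₙ` is `x₁ ⋯ xₙ₋₁ ⊗ xₙ`. -/
abbrev Zin := Words K V₀ V₁ ⊗[K] (V₀ × V₁)

/-- `v ↦ (-1)^{|v|} v` on `V = V₀ ⊕ V₁`. -/
def parity : V₀ × V₁ →ₗ[K] V₀ × V₁ := LinearMap.prodMap LinearMap.id (-LinearMap.id)

/-- `x ↦ (-1)^{|x|} x` on `sV`. -/
def sParity : V₀ × V₁ →ₗ[K] V₀ × V₁ := -parity K V₀ V₁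

/-- The parity involution of `T(sV)`. -/
def wordsParity : Words K V₀ V₁ →ₗ[K] Words K V₀ V₁ :=
  (TensorAlgebra.lift K (TensorAlgebra.ι K ∘ₗ sParity K V₀ V₁)).toLinearMap

/-- The parity involution of `Zin^c(sV)`. -/
def zinParity : Zin K V₀ V₁ →ₗ[K] Zin K V₀ V₁ :=
  TensorProduct.map (wordsParity K V₀ V₁) (sParity K V₀ V₁)

/-- Right concatenation `w ⊗ x ↦ w x`. -/
def concat : Zin K V₀ V₁ →ₗ[K] Words K V₀ V₁ :=
  LinearMap.mul' K (Words K V₀ V₁) ∘ₗ LinearMap.lTensor _ (TensorAlgebra.ι K)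

/-- The projection `T(sV) → Zin^c(sV)` that kills the empty word: `x₁ ⋯ xₙ ↦ x₁ ⋯ xₙ₋₁ ⊗ xₙ`. -/
def split : Words K V₀ V₁ →ₗ[K] Zin K V₀ V₁ :=
  LinearMap.snd K (Words K V₀ V₁) (Zin K V₀ V₁) ∘ₗ
    foldRight (S := Words K V₀ V₁ × Zin K V₀ V₁)
      (LinearMap.mk₂ K
        (fun x s => (concat K V₀ V₁ (s.1 ⊗ₜ[K] x), s.1 ⊗ₜ[K] x))
        (by intros; simp [TensorProduct.tmul_add])
        (by intros; simp)
        (by intros; simp [TensorProduct.add_tmul])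
        (by intros; simp [← TensorProduct.smul_tmul'])) (1, 0)

/-- The signed sum over all unshuffles of a word into two (possibly empty) subwords,
`x₁ ⋯ xₙ ↦ ∑_k ∑_{σ ∈ Sh(k, n - k)} ε(σ) x_{σ(1)} ⋯ x_{σ(k)} ⊗ x_{σ(k+1)} ⋯ x_{σ(n)}`. The first
letter `x` of a word goes to the front of the left subword, or to the front of the right subword
`b`, in which case it moves across the left subword `a`: `a ⊗ b ↦ (-1)^{|x||a|} a ⊗ x b`. -/
def unshuffle : Words K V₀ V₁ →ₗ[K] Words K V₀ V₁ ⊗[K] Words K V₀ V₁ :=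
  foldLeft
    (TensorProduct.homTensorHomMap (RingHom.id K) _ _ _ _ ∘ₗ
        (TensorProduct.mk K _ _).flip LinearMap.id ∘ₗ LinearMap.mul K _ ∘ₗ TensorAlgebra.ι K +
      koszulHom (wordsParity K V₀ V₁) (wordsParity K V₀ V₁) (wordsParity K V₀ V₁) ∘ₗ
        TensorProduct.mk K _ _ LinearMap.id ∘ₗ LinearMap.mul K _ ∘ₗ TensorAlgebra.ι K)
    (1 ⊗ₜ[K] 1)

/-- The comultiplication of `Zin^c(sV)`: the last letter stays at the end of the right subword, the
left subword is nonempty. -/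
def zinComul : Zin K V₀ V₁ →ₗ[K] Zin K V₀ V₁ ⊗[K] Zin K V₀ V₁ :=
  LinearMap.rTensor _ (split K V₀ V₁) ∘ₗ (TensorProduct.assoc K _ _ _).toLinearMap ∘ₗ
    LinearMap.rTensor _ (unshuffle K V₀ V₁)

/-- The projection of `Zin^c(sV)` onto `sV`. -/
def arity₁ : Zin K V₀ V₁ →ₗ[K] V₀ × V₁ :=
  (TensorProduct.lid K _).toLinearMap ∘ₗ
    LinearMap.rTensor _ (TensorAlgebra.algebraMapInv (R := K) (M := V₀ × V₁)).toLinearMap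

/-- The projection of `Zin^c(sV)` onto `(sV)^{⊗ 2}`. -/
def arity₂ : Zin K V₀ V₁ →ₗ[K] (V₀ × V₁) ⊗[K] (V₀ × V₁) :=
  LinearMap.rTensor _ (arity₁ K V₀ V₁ ∘ₗ split K V₀ V₁)

/-- The projection of `Zin^c(sV)` onto `(sV)^{⊗ 3}`. -/
def arity₃ : Zin K V₀ V₁ →ₗ[K] ((V₀ × V₁) ⊗[K] (V₀ × V₁)) ⊗[K] (V₀ × V₁) :=
  LinearMap.rTensor _ (arity₂ K V₀ V₁ ∘ₗ split K V₀ V₁)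

variable {K V₀ V₁}

namespace TwoTermLeibniz

variable (A : TwoTermLeibniz K V₀ V₁)

/-- The unary bracket on `V = V₀ ⊕ V₁`. -/
def br₁ : V₀ × V₁ →ₗ[K] V₀ × V₁ :=
  LinearMap.inl K V₀ V₁ ∘ₗ A.l1 ∘ₗ LinearMap.snd K V₀ V₁

/-- The binary bracket on `V = V₀ ⊕ V₁`. -/
def br₂ : (V₀ × V₁) ⊗[K] (V₀ × V₁) →ₗ[K] V₀ × V₁ :=
  LinearMap.inl K V₀ V₁ ∘ₗ TensorProduct.lift A.l00 ∘ₗ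
      TensorProduct.map (LinearMap.fst K V₀ V₁) (LinearMap.fst K V₀ V₁) +
    LinearMap.inr K V₀ V₁ ∘ₗ
      (TensorProduct.lift A.l01 ∘ₗ
          TensorProduct.map (LinearMap.fst K V₀ V₁) (LinearMap.snd K V₀ V₁) +
        TensorProduct.lift A.l10 ∘ₗ
          TensorProduct.map (LinearMap.snd K V₀ V₁) (LinearMap.fst K V₀ V₁))

/-- The ternary bracket on `V = V₀ ⊕ V₁`. -/
def br₃ : ((V₀ × V₁) ⊗[K] (V₀ × V₁)) ⊗[K] (V₀ × V₁) →ₗ[K] V₀ × V₁ :=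
  LinearMap.inr K V₀ V₁ ∘ₗ TensorProduct.lift (TensorProduct.lift A.l3) ∘ₗ
    TensorProduct.map (TensorProduct.map (LinearMap.fst K V₀ V₁) (LinearMap.fst K V₀ V₁))
      (LinearMap.fst K V₀ V₁)

/-- The corestriction `Zin^c(sV) → sV` of the codifferential, with components `D_i` such that
`l_i = s⁻¹ D_i s^{⊗ i}`, i.e. `D₁(sv) = s l₁(v)`, `D₂(sv₁, sv₂) = (-1)^{|v₁|} s l₂(v₁, v₂)`,
`D₃(sv₁, sv₂, sv₃) = (-1)^{|v₂|} s l₃(v₁, v₂, v₃)`. -/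
def corestriction : Zin K V₀ V₁ →ₗ[K] V₀ × V₁ :=
  A.br₁ ∘ₗ arity₁ K V₀ V₁ +
    A.br₂ ∘ₗ TensorProduct.map (parity K V₀ V₁) LinearMap.id ∘ₗ arity₂ K V₀ V₁ +
    A.br₃ ∘ₗ TensorProduct.map (TensorProduct.map LinearMap.id (parity K V₀ V₁)) LinearMap.id ∘ₗ
      arity₃ K V₀ V₁

/-- The terms of the codifferential that involve the last letter:
`w ⊗ x ↦ ∑ ± (-1)^{|w'|} w' D(w'' x)`, over all unshuffles `± w' ⊗ w''` of `w`. -/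
def codiffLast : Zin K V₀ V₁ →ₗ[K] Zin K V₀ V₁ :=
  TensorProduct.map (wordsParity K V₀ V₁) A.corestriction ∘ₗ
    (TensorProduct.assoc K _ _ _).toLinearMap ∘ₗ LinearMap.rTensor _ (unshuffle K V₀ V₁)

/-- The codifferential on `T(sV)` (zero on the empty word), by recursion on the last letter:
`D(w x) = D(w) x + ` the terms that involve the letter `x`. -/
def codiffWords : Words K V₀ V₁ →ₗ[K] Words K V₀ V₁ :=
  LinearMap.snd K (Words K V₀ V₁) (Words K V₀ V₁) ∘ₗ
    foldRight (S := Words K V₀ V₁ × Words K V₀ V₁)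
      (LinearMap.mk₂ K
        (fun x s => (concat K V₀ V₁ (s.1 ⊗ₜ[K] x),
          concat K V₀ V₁ (s.2 ⊗ₜ[K] x) + concat K V₀ V₁ (A.codiffLast (s.1 ⊗ₜ[K] x))))
        (by intros; simp only [TensorProduct.tmul_add, map_add, Prod.mk_add_mk, Prod.mk.injEq,
              true_and]; abel)
        (by intros; simp)
        (by intros; simp only [Prod.fst_add, Prod.snd_add, TensorProduct.add_tmul, map_add,
              Prod.mk_add_mk, Prod.mk.injEq, true_and]; abel)
        (by intros; simp [← TensorProduct.smul_tmul'])) (1, 0)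

/-- The codifferential `D` of `Zin^c(sV)` that encodes the brackets: on a word `v₁ ⋯ vₙ` of
homogeneous letters of `sV`, it is the sum over `j ≤ k ≤ n` and `σ ∈ Sh(k - j, j - 1)` of
`ε(σ) (-1)^{|v_{σ(1)}| + ⋯ + |v_{σ(k-j)}|}
v_{σ(1)} ⋯ v_{σ(k-j)} D_j(v_{σ(k-j+1)}, …, v_{σ(k-1)}, v_k) v_{k+1} ⋯ vₙ`. -/
def codiff : Zin K V₀ V₁ →ₗ[K] Zin K V₀ V₁ :=
  LinearMap.rTensor _ A.codiffWords + A.codiffLast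

end TwoTermLeibniz

end Zinbiel

/-! ## The convolution Lie infinity algebra `L(V, W) = Hom(Zin^c(sV), W)` -/

section Convolution

section Space

variable (K V₀ V₁ W₀ W₁ : Type*) [Field K]
  [AddCommGroup V₀] [Module K V₀] [AddCommGroup V₁] [Module K V₁]
  [AddCommGroup W₀] [Module K W₀] [AddCommGroup W₁] [Module K W₁]

/-- `Hom(Zin^c(sV), W)`. -/
abbrev Conv := Zin K V₀ V₁ →ₗ[K] W₀ × W₁

/-- `f ↦ (-1)^{|f|} f` on `L(V, W)`. -/
def convParity : Conv K V₀ V₁ W₀ W₁ →ₗ[K] Conv K V₀ V₁ W₀ W₁ :=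
  homParity (zinParity K V₀ V₁) (parity K W₀ W₁)

/-- A homogeneous element of `sV`. -/
def letter : V₀ ⊕ V₁ → V₀ × V₁ := Sum.elim (fun x => (x, 0)) (fun h => (0, h))

/-- The degree in `sV` of a homogeneous element. -/
def letterDeg : V₀ ⊕ V₁ → ℤ := Sum.elim (fun _ => 1) (fun _ => 2)

/-- The degree `j` part of `W = W₀ ⊕ W₁`. -/
def degPart (j : ℤ) : Submodule K (W₀ × W₁) where
  carrier := {w | (j ≠ 0 → w.1 = 0) ∧ (j ≠ 1 → w.2 = 0)}
  add_mem' := by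
    rintro a b ⟨ha, ha'⟩ ⟨hb, hb'⟩
    exact ⟨fun h => by simp [ha h, hb h], fun h => by simp [ha' h, hb' h]⟩
  zero_mem' := by simp
  smul_mem' := by
    rintro c a ⟨ha, ha'⟩
    exact ⟨fun h => by simp [ha h], fun h => by simp [ha' h]⟩

/-- The degree `k` part of `L(V, W)`: the maps that send words of degree `m` to `W_{m + k}`. -/
def convDeg (k : ℤ) : Submodule K (Conv K V₀ V₁ W₀ W₁) where
  carrier := {f | ∀ (l : List (V₀ ⊕ V₁)) (v : V₀ ⊕ V₁),
    f ((l.map fun u => TensorAlgebra.ι K (letter V₀ V₁ u)).prod ⊗ₜ[K] letter V₀ V₁ v) ∈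
      degPart K W₀ W₁ ((l.map (letterDeg V₀ V₁)).sum + letterDeg V₀ V₁ v + k)}
  add_mem' := fun ha hb l v => Submodule.add_mem _ (ha l v) (hb l v)
  zero_mem' := fun _ _ => Submodule.zero_mem _
  smul_mem' := fun c _ ha l v => Submodule.smul_mem _ c (ha l v)

end Space

variable {K V₀ V₁ W₀ W₁ : Type*} [Field K]
  [AddCommGroup V₀] [Module K V₀] [AddCommGroup V₁] [Module K V₁]
  [AddCommGroup W₀] [Module K W₀] [AddCommGroup W₁] [Module K W₁]
  (A : TwoTermLeibniz K V₀ V₁) (B : TwoTermLeibniz K W₀ W₁)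

/-- `f ↦ m₁ ∘ f + (-1)^{|f|} f ∘ D`. -/
def conv₁ : Conv K V₀ V₁ W₀ W₁ →ₗ[K] Conv K V₀ V₁ W₀ W₁ :=
  LinearMap.llcomp K _ _ _ B.br₁ + LinearMap.lcomp K _ A.codiff ∘ₗ convParity K V₀ V₁ W₀ W₁

/-- `(f₁, f₂) ↦ m₂ ∘ (∑_σ ε(σ) sign(σ) f_{σ(1)} ⊗ f_{σ(2)}) ∘ Δ`. -/
def conv₂ : Conv K V₀ V₁ W₀ W₁ ⊗[K] Conv K V₀ V₁ W₀ W₁ →ₗ[K] Conv K V₀ V₁ W₀ W₁ :=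
  LinearMap.lcomp K _ (zinComul K V₀ V₁) ∘ₗ LinearMap.llcomp K _ _ _ B.br₂ ∘ₗ
    koszulHom (zinParity K V₀ V₁) (zinParity K V₀ V₁) (parity K W₀ W₁) ∘ₗ
    antisymm₂ (convParity K V₀ V₁ W₀ W₁)

/-- `(f₁, f₂, f₃) ↦ m₃ ∘ (∑_σ ε(σ) sign(σ) f_{σ(1)} ⊗ f_{σ(2)} ⊗ f_{σ(3)}) ∘ (Δ ⊗ id) ∘ Δ`. The
brackets with more than three arguments vanish, since `m_p = 0` for `p > 3`. -/
def conv₃ : (Conv K V₀ V₁ W₀ W₁ ⊗[K] Conv K V₀ V₁ W₀ W₁) ⊗[K] Conv K V₀ V₁ W₀ W₁ →ₗ[K]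
    Conv K V₀ V₁ W₀ W₁ :=
  LinearMap.lcomp K _ (LinearMap.rTensor _ (zinComul K V₀ V₁) ∘ₗ zinComul K V₀ V₁) ∘ₗ
    LinearMap.llcomp K _ _ _ B.br₃ ∘ₗ
    koszulHom (A := Zin K V₀ V₁ ⊗[K] Zin K V₀ V₁) (C := (W₀ × W₁) ⊗[K] (W₀ × W₁))
      (TensorProduct.map (zinParity K V₀ V₁) (zinParity K V₀ V₁)) (zinParity K V₀ V₁)
      (parity K W₀ W₁) ∘ₗ
    LinearMap.rTensor _
      (koszulHom (zinParity K V₀ V₁) (zinParity K V₀ V₁) (parity K W₀ W₁)) ∘ₗ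
    antisymm₃ (convParity K V₀ V₁ W₀ W₁)

variable {A B}

/-- The element of `L(V, W)` that corresponds to an infinity morphism `(f₁, f₂)`: its components are
`f₁ s⁻¹` on `sV` and `f₂ (s^{⊗ 2})⁻¹` on `(sV)^{⊗ 2}`. -/
def InftyMorphism.toConv (f : InftyMorphism A B) : Conv K V₀ V₁ W₀ W₁ :=
  LinearMap.prodMap f.f0 f.f1 ∘ₗ arity₁ K V₀ V₁ +
    LinearMap.inr K W₀ W₁ ∘ₗ TensorProduct.lift f.f2 ∘ₗ
      TensorProduct.map (LinearMap.fst K V₀ V₁) (LinearMap.fst K V₀ V₁) ∘ₗ arity₂ K V₀ V₁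

end Convolution

/-! ## Polynomial differential forms -/

section Forms

variable (K : Type*) [Field K]

/-- Polynomial differential forms in coordinates indexed by the finite type `σ`. -/
abbrev Forms (σ : Type) [Fintype σ] := MvPolynomial σ K ⊗[K] ExteriorAlgebra K (σ → K)

section General

variable (σ : Type) [Fintype σ] [DecidableEq σ]

/-- The de Rham differential `p ω ↦ ∑ᵢ (∂p/∂tᵢ) dtᵢ ∧ ω`, for `ω` with constant coefficients. -/
def deRham : Forms K σ →ₗ[K] Forms K σ :=
  ∑ i, TensorProduct.map (MvPolynomial.pderiv i : Derivation K _ _).toLinearMap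
    (LinearMap.mulLeft K (ExteriorAlgebra.ι K (Pi.single i 1 : σ → K)))

/-- The forms of degree `k`. -/
def formsDeg (k : ℕ) : Submodule K (Forms K σ) :=
  LinearMap.range (LinearMap.lTensor (MvPolynomial σ K) (⋀[K]^k (σ → K)).subtype)

/-- `ω ↦ (-1)^{|ω|} ω`. -/
def formsParity : Forms K σ →ₗ[K] Forms K σ :=
  LinearMap.lTensor (MvPolynomial σ K)
    (CliffordAlgebra.involute (Q := (0 : QuadraticForm K (σ → K)))).toLinearMap

variable {K σ}

/-- The exact form `dp`. -/
def dPoly (p : MvPolynomial σ K) : Forms K σ := deRham K σ (p ⊗ₜ[K] 1)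

theorem dPoly_eq (p : MvPolynomial σ K) :
    dPoly p = ∑ i, MvPolynomial.pderiv i p ⊗ₜ[K] ExteriorAlgebra.ι K (Pi.single i 1 : σ → K) := by
  simp [dPoly, deRham]

theorem dPoly_anticomm (p q : MvPolynomial σ K) : dPoly p * dPoly q + dPoly q * dPoly p = 0 := by
  rw [dPoly_eq, dPoly_eq, Finset.sum_mul_sum, Finset.sum_mul_sum, Finset.sum_comm,
    ← Finset.sum_add_distrib]
  refine Finset.sum_eq_zero fun i _ => ?_
  rw [← Finset.sum_add_distrib]
  refine Finset.sum_eq_zero fun j _ => ?_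
  rw [Algebra.TensorProduct.tmul_mul_tmul, Algebra.TensorProduct.tmul_mul_tmul,
    mul_comm (MvPolynomial.pderiv j p), ← TensorProduct.tmul_add,
    ExteriorAlgebra.ι_add_mul_swap, TensorProduct.tmul_zero]

theorem dPoly_sq [CharZero K] (p : MvPolynomial σ K) : dPoly p * dPoly p = 0 := by
  have h := dPoly_anticomm p p
  rw [← two_smul K, smul_eq_zero] at h
  exact h.resolve_left two_ne_zero

/-- The linear map `∑ᵢ vᵢ dtᵢ ↦ ∑ᵢ vᵢ dφᵢ`. -/
def pullbackOne {τ : Type} [Fintype τ] (φ : τ → MvPolynomial σ K) : (τ → K) →ₗ[K] Forms K σ :=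
  deRham K σ ∘ₗ (TensorProduct.mk K _ _).flip 1 ∘ₗ Fintype.linearCombination K φ

theorem pullbackOne_sq [CharZero K] {τ : Type} [Fintype τ] (φ : τ → MvPolynomial σ K)
    (v : τ → K) : pullbackOne φ v * pullbackOne φ v = 0 :=
  dPoly_sq (Fintype.linearCombination K φ v)

theorem commute_function (p : MvPolynomial σ K) (y : Forms K σ) :
    Commute (p ⊗ₜ[K] (1 : ExteriorAlgebra K (σ → K))) y := by
  rw [commute_iff_eq]
  induction y using TensorProduct.induction_on with
  | zero => simp
  | tmul q η => simp [mul_comm]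
  | add a b ha hb => rw [mul_add, add_mul, ha, hb]

/-- The pullback of forms along the polynomial map with components `φᵢ`: `tᵢ ↦ φᵢ`,
`dtᵢ ↦ dφᵢ`. -/
def pullback [CharZero K] {τ : Type} [Fintype τ] (φ : τ → MvPolynomial σ K) :
    Forms K τ →ₐ[K] Forms K σ :=
  Algebra.TensorProduct.lift
    (Algebra.TensorProduct.includeLeft.comp (MvPolynomial.aeval φ))
    (ExteriorAlgebra.lift K ⟨pullbackOne φ, pullbackOne_sq φ⟩)
    (fun _ _ => commute_function _ _)

end General

section Simplex

variable [CharZero K]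

/-- Polynomial differential forms on the `n`-simplex, in the coordinates `t₁, …, tₙ` (indexed by
`Fin n`); the remaining barycentric coordinate is `t₀ = 1 - t₁ - ⋯ - tₙ`. -/
abbrev Ω (n : ℕ) := Forms K (Fin n)

/-- The barycentric coordinates `t₀, …, tₙ`. -/
def bary (n : ℕ) : Fin (n + 1) → MvPolynomial (Fin n) K :=
  Fin.cons (1 - ∑ j, MvPolynomial.X j) MvPolynomial.X

/-- The pullback of forms along the affine map `Δ^m → Δ^n` that is induced by a map of vertices:
the barycentric coordinates transform by `yᵢ = ∑_{k ∈ f⁻¹(i)} xₖ`. -/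
def simplicial {m n : ℕ} (f : Fin (m + 1) → Fin (n + 1)) : Ω K n →ₐ[K] Ω K m :=
  pullback fun j : Fin n => ∑ k with f k = j.succ, bary K m k

/-- The face map `Ω_{n+1} → Ω_n`, restriction to the face opposite to the vertex `i`. -/
def face {n : ℕ} (i : Fin (n + 2)) : Ω K (n + 1) →ₐ[K] Ω K n := simplicial K i.succAbove

/-- The coordinate `t_j` (with `j ≥ 1`) of the vertex `e_i`. -/
def vertex {n : ℕ} (i : Fin (n + 1)) (j : Fin n) : K := if i = j.succ then 1 else 0

/-- The evaluation `ε_n^i` at the vertex `e_i`. -/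
def evalVertex {n : ℕ} (i : Fin (n + 1)) : Ω K n →ₗ[K] K :=
  (TensorProduct.lid K K).toLinearMap ∘ₗ
    TensorProduct.map (MvPolynomial.aeval (vertex K i)).toLinearMap
      (ExteriorAlgebra.algebraMapInv (R := K) (M := Fin n → K)).toLinearMap

/-- `p ↦ ∫₀¹ p(u, t) du`, where `u` is the variable `none`. -/
def integrate (n : ℕ) : MvPolynomial (Option (Fin n)) K →ₗ[K] MvPolynomial (Fin n) K :=
  Polynomial.lsum (fun k => ((k : K) + 1)⁻¹ • LinearMap.id) ∘ₗ
    (MvPolynomial.optionEquivLeft K (Fin n)).toLinearMap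

/-- Integration over the fibre `I` of forms on `I × Δ^n`: forms without `du` are sent to zero, and
`p du ∧ ω ↦ (∫₀¹ p(u, t) du) ω`. -/
def fibreIntegral (n : ℕ) : Forms K (Option (Fin n)) →ₗ[K] Ω K n :=
  TensorProduct.map (integrate K n)
    ((ExteriorAlgebra.map (LinearMap.funLeft K K some)).toLinearMap ∘ₗ
      CliffordAlgebra.contractLeft (Q := (0 : QuadraticForm K (Option (Fin n) → K)))
        (LinearMap.proj none))

/-- The operator `h_n^i`: pull back along `(u, t) ↦ u t + (1 - u) e_i`, then integrate over `u`. -/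
def hOp {n : ℕ} (i : Fin (n + 1)) : Ω K n →ₗ[K] Ω K n :=
  fibreIntegral K n ∘ₗ
    (pullback fun j : Fin n => (MvPolynomial.X none * MvPolynomial.X (some j) +
      (1 - MvPolynomial.X none) * MvPolynomial.C (vertex K i j) :
        MvPolynomial (Option (Fin n)) K)).toLinearMap

end Simplex

end Forms

/-! ## The simplicial set of Maurer-Cartan elements -/

section MaurerCartan

section Space

variable (K V₀ V₁ W₀ W₁ : Type*) [Field K]
  [AddCommGroup V₀] [Module K V₀] [AddCommGroup V₁] [Module K V₁]
  [AddCommGroup W₀] [Module K W₀] [AddCommGroup W₁] [Module K W₁]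

/-- `L(V, W) ⊗ Ω_n`. -/
abbrev ConvForms (n : ℕ) := Conv K V₀ V₁ W₀ W₁ ⊗[K] Ω K n

/-- The (homological) degree `k` part of `L(V, W) ⊗ Ω_n`, a `j`-form having degree `-j`. -/
def convFormsDeg (n : ℕ) (k : ℤ) : Submodule K (ConvForms K V₀ V₁ W₀ W₁ n) :=
  ⨆ j : ℕ, LinearMap.range (TensorProduct.map (convDeg K V₀ V₁ W₀ W₁ (k + j)).subtype
    (formsDeg K (Fin n) j).subtype)

variable {K V₀ V₁ W₀ W₁} [CharZero K]

/-- The structure maps `id ⊗ d_i` of the simplicial module `L(V, W) ⊗ Ω_•`. -/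
def faceBar {n : ℕ} (i : Fin (n + 2)) :
    ConvForms K V₀ V₁ W₀ W₁ (n + 1) →ₗ[K] ConvForms K V₀ V₁ W₀ W₁ n :=
  LinearMap.lTensor _ (face K i).toLinearMap

/-- The evaluation `id ⊗ ε_n^i` at the vertex `e_i`. -/
def evalBar {n : ℕ} (i : Fin (n + 1)) :
    ConvForms K V₀ V₁ W₀ W₁ n →ₗ[K] Conv K V₀ V₁ W₀ W₁ :=
  (TensorProduct.rid K _).toLinearMap ∘ₗ LinearMap.lTensor _ (evalVertex K i)

/-- The extension `f ⊗ ω ↦ (-1)^{|f|} f ⊗ h_n^i ω` of the operator `h_n^i`, which is odd. -/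
def hBar {n : ℕ} (i : Fin (n + 1)) :
    ConvForms K V₀ V₁ W₀ W₁ n →ₗ[K] ConvForms K V₀ V₁ W₀ W₁ n :=
  TensorProduct.map (convParity K V₀ V₁ W₀ W₁) (hOp K i)

end Space

variable {K V₀ V₁ W₀ W₁ : Type*} [Field K] [CharZero K]
  [AddCommGroup V₀] [Module K V₀] [AddCommGroup V₁] [Module K V₁]
  [AddCommGroup W₀] [Module K W₀] [AddCommGroup W₁] [Module K W₁]
  (A : TwoTermLeibniz K V₀ V₁) (B : TwoTermLeibniz K W₀ W₁)

/-- `f ⊗ ω ↦ 𝓛₁ f ⊗ ω + (-1)^{|f|} f ⊗ dω`. -/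
def bar₁ (n : ℕ) : ConvForms K V₀ V₁ W₀ W₁ n →ₗ[K] ConvForms K V₀ V₁ W₀ W₁ n :=
  LinearMap.rTensor _ (conv₁ A B) +
    TensorProduct.map (convParity K V₀ V₁ W₀ W₁) (deRham K (Fin n))

/-- `(f₁ ⊗ ω₁, f₂ ⊗ ω₂) ↦ ± 𝓛₂(f₁, f₂) ⊗ ω₁ ω₂`. -/
def bar₂ (n : ℕ) : ConvForms K V₀ V₁ W₀ W₁ n ⊗[K] ConvForms K V₀ V₁ W₀ W₁ n →ₗ[K]
    ConvForms K V₀ V₁ W₀ W₁ n :=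
  TensorProduct.map (conv₂ B) (LinearMap.mul' K (Ω K n)) ∘ₗ
    middleBraid (formsParity K (Fin n)) (convParity K V₀ V₁ W₀ W₁)

/-- `(f₁ ⊗ ω₁, f₂ ⊗ ω₂, f₃ ⊗ ω₃) ↦ ± 𝓛₃(f₁, f₂, f₃) ⊗ ω₁ ω₂ ω₃`. -/
def bar₃ (n : ℕ) : (ConvForms K V₀ V₁ W₀ W₁ n ⊗[K] ConvForms K V₀ V₁ W₀ W₁ n) ⊗[K]
    ConvForms K V₀ V₁ W₀ W₁ n →ₗ[K] ConvForms K V₀ V₁ W₀ W₁ n :=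
  TensorProduct.map (conv₃ B)
      (LinearMap.mul' K (Ω K n) ∘ₗ LinearMap.rTensor _ (LinearMap.mul' K (Ω K n))) ∘ₗ
    middleBraid (A := Conv K V₀ V₁ W₀ W₁ ⊗[K] Conv K V₀ V₁ W₀ W₁) (B := Ω K n ⊗[K] Ω K n)
      (TensorProduct.map (formsParity K (Fin n)) (formsParity K (Fin n)))
      (convParity K V₀ V₁ W₀ W₁) ∘ₗ
    LinearMap.rTensor _ (middleBraid (formsParity K (Fin n)) (convParity K V₀ V₁ W₀ W₁))

/-- The nonlinear part `∑_{i ≥ 2} (1/i!) (-1)^{i(i-1)/2} 𝓛ᵢ(α, …, α)` of the Maurer-Cartan equation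
of `L(V, W) ⊗ Ω_n`. -/
def nonlinear {n : ℕ} (α : ConvForms K V₀ V₁ W₀ W₁ n) : ConvForms K V₀ V₁ W₀ W₁ n :=
  -((2⁻¹ : K) • bar₂ B n (α ⊗ₜ[K] α)) - (6⁻¹ : K) • bar₃ B n ((α ⊗ₜ[K] α) ⊗ₜ[K] α)

/-- The set `MC_n` of Maurer-Cartan elements of `L(V, W) ⊗ Ω_n`. -/
def MC (n : ℕ) : Set (ConvForms K V₀ V₁ W₀ W₁ n) :=
  {α | α ∈ convFormsDeg K V₀ V₁ W₀ W₁ n (-1) ∧ bar₁ A B n α + nonlinear B α = 0}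

/-- The approximations `α₀ = μ + ν`, `α_{k+1} = α₀ - h_n^i R(α_k)`, where `R` is the nonlinear part
of the Maurer-Cartan equation. -/
def kanIter {n : ℕ} (i : Fin (n + 1)) (μ : Conv K V₀ V₁ W₀ W₁)
    (ν : ConvForms K V₀ V₁ W₀ W₁ n) : ℕ → ConvForms K V₀ V₁ W₀ W₁ n
  | 0 => μ ⊗ₜ[K] 1 + ν
  | k + 1 => μ ⊗ₜ[K] 1 + ν - hBar i (nonlinear B (kanIter i μ ν k))

/-- `α = 𝓑_n^i(μ, ν)`: the approximations stabilize at `α`. -/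
def IsKanLimit {n : ℕ} (i : Fin (n + 1)) (μ : Conv K V₀ V₁ W₀ W₁)
    (ν α : ConvForms K V₀ V₁ W₀ W₁ n) : Prop :=
  ∃ N, ∀ k ≥ N, kanIter B i μ ν k = α

variable {A B}

/-- The set `𝓘(f, g)` of infinity homotopies from `f` to `g`. -/
def inftyHomotopies (f g : InftyMorphism A B) : Set (ConvForms K V₀ V₁ W₀ W₁ 1) :=
  {α | α ∈ MC A B 1 ∧ evalBar 0 α = f.toConv ∧ evalBar 1 α = g.toConv}

/-- The map `S_1^i`, which sends `α` to `(β(1) - β(0)) s`, where `β = h_1^i α`. -/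
def project (i : Fin 2) (α : ConvForms K V₀ V₁ W₀ W₁ 1) : V₀ →ₗ[K] W₁ :=
  LinearMap.snd K W₀ W₁ ∘ₗ (evalBar 1 (hBar i α) - evalBar 0 (hBar i α)) ∘ₗ
    TensorProduct.mk K (Words K V₀ V₁) (V₀ × V₁) 1 ∘ₗ LinearMap.inl K V₀ V₁

/-- `α` is an infinity homotopy from `f` to `g` that lifts `θ` along `S_1^i`. -/
def IsLift (i : Fin 2) (f g : InftyMorphism A B) (θ : V₀ →ₗ[K] W₁)
    (α : ConvForms K V₀ V₁ W₀ W₁ 1) : Prop :=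
  α ∈ inftyHomotopies f g ∧ project i α = θ

/-- `β`, of degree `0` on the 2-simplex, extends the pair `h_1^1 α'` on the face `01`, `h_1^0 α''`
on the face `12`. -/
def IsHornExtension (α' α'' : ConvForms K V₀ V₁ W₀ W₁ 1) (β : ConvForms K V₀ V₁ W₀ W₁ 2) : Prop :=
  β ∈ convFormsDeg K V₀ V₁ W₀ W₁ 2 0 ∧ faceBar 2 β = hBar 1 α' ∧ faceBar 0 β = hBar 0 α''

/-- `α = 𝓑_2^1(g, (δ + d) β)`, for some extension `β` of the data `β' = h_1^1 α'`,
`β'' = h_1^0 α''` that correspond, together with `g`, to the horn `(α', α'')` under the maps `B_1^1`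
and `B_1^0`. -/
def IsKanFiller (g : InftyMorphism A B) (α' α'' : ConvForms K V₀ V₁ W₀ W₁ 1)
    (α : ConvForms K V₀ V₁ W₀ W₁ 2) : Prop :=
  ∃ β, IsHornExtension α' α'' β ∧ IsKanLimit B 1 g.toConv (bar₁ A B 2 β) α

/-- `ρ` is a value of the composite of `θ : f ⇒ g` and `τ : g ⇒ h`: for some lifts `α'` of `θ` and
`α''` of `τ` and some filler `α` of the horn `(α', α'')` in `MC_•(L(V, W) ⊗ Ω_•)` provided by the
Kan construction, `ρ` is the projection of the face `02` of `α`. -/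
def IsVerticalComposite (f g h : InftyMorphism A B) (θ τ ρ : V₀ →ₗ[K] W₁) : Prop :=
  ∃ α' α'' α, IsLift 1 f g θ α' ∧ IsLift 0 g h τ α'' ∧ IsKanFiller g α' α'' α ∧
    ρ = project 0 (faceBar 1 α)

end MaurerCartan

end LeibnizHomotopy

end

/-! Degrees make everything explicit. A word of `Zin^c(sV)` has degree at least its length, and `W`
lives in degrees `0` and `1`. So `L` vanishes in positive degrees, `L_0 = Hom(V₀, W₁)`
(`exists_ofHom_of_mem_convDeg`), and `L_{-1}` consists of the triples `Components`
(`exists_ofComponents_of_mem_convDeg`). Hence an element of degree `0` of `L ⊗ Ω_n` is a polynomial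
`b` with values in `Hom(V₀, W₁)`. An element of degree `-1` is a polynomial `a` with values in
`Components` plus a one-form with values in `Hom(V₀, W₁)`; on the interval this one-form is some
`db`.

An infinity morphism can be moved along any linear map `V₀ → W₁` (`InftyMorphism.translate`). A
2-term homotopy `θ : f ⇒ g` means that `g` is the translate of `f` by `θ`, or equally that `f` is
the translate of `g` by `-θ`. Moving `g` along a polynomial `b` and adding `db` gives `g.family b`.
This is a Maurer-Cartan element: its function part satisfies the equation at each point because each
translate is an infinity morphism, and its one-form part reduces to the product rule
(`mixedForm_linearPart`). There is no two-form part, since `m₂` vanishes on `W₁ ⊗ W₁` and `m₃` sees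
only `W₀`. Conversely, each Maurer-Cartan element on the interval with value `g` at the vertex `e_i`
is `g.family b` with `b(e_i) = 0` (`InftyMorphism.exists_eq_family_of_mem_MC`), and `h^i` recovers
`b`.

The operator `h^i` kills functions and sends `dp` to `p - p(e_i)`. The one-form part of the
nonlinear term depends only on the `V₀ → W₀` component of `a`, which is already correct in `α₀`. So
if `b(e_i) = 0`, the Kan iteration that starts from `g + (δ + d) b` reaches `g.family b` after one
step and stays there (`InftyMorphism.kanIter_homForm`).

The theorem is now about vertex values. The lifts are polynomials around `g` on the two edges, with
end values `(-θ, 0)` and `(0, τ)`. The element `β` is a polynomial on the triangle that extends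
both, so it takes the values `-θ, 0, τ` at the vertices. The edge `02` of the filler runs from the
translate of `g` by `-θ`, which is `f`, to the translate by `τ`, which is `h`, and its projection is
`τ - (-θ)`, whatever the choices. -/

open scoped TensorProduct

noncomputable section

namespace LeibnizHomotopy

/-! ### Translates of infinity morphisms and sums of 2-term homotopies. -/

section TwoTerm

variable {K V₀ V₁ W₀ W₁ : Type*} [Field K]
  [AddCommGroup V₀] [Module K V₀] [AddCommGroup V₁] [Module K V₁]
  [AddCommGroup W₀] [Module K W₀] [AddCommGroup W₁] [Module K W₁]
  {A : TwoTermLeibniz K V₀ V₁} {B : TwoTermLeibniz K W₀ W₁}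

/-- The infinity morphism at the end of the homotopy `θ` that starts at `f`. -/
def InftyMorphism.translate (f : InftyMorphism A B) (θ : V₀ →ₗ[K] W₁) : InftyMorphism A B where
  f0 := f.f0 + B.l1 ∘ₗ θ
  f1 := f.f1 + θ ∘ₗ A.l1
  -- The homotopy equation has the target morphism in its last slot; substituting `f.f0 + B.l1 ∘ₗ θ`
  -- there produces the quadratic term.
  f2 := f.f2 + A.l00.compr₂ θ - B.l01.compl₁₂ f.f0 θ - B.l10.compl₁₂ θ f.f0
    - B.l10.compl₁₂ θ (B.l1 ∘ₗ θ)
  comm_l1 h := by simp [f.comm_l1]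
  comm_l00 x y := by
    simp only [LinearMap.add_apply, LinearMap.sub_apply, LinearMap.comp_apply,
      LinearMap.compr₂_apply, LinearMap.compl₁₂_apply, map_add, map_sub, ← f.comm_l00, B.l1_l01,
      B.l1_l10]
    abel
  comm_l01 x h := by
    simp only [LinearMap.add_apply, LinearMap.sub_apply, LinearMap.comp_apply,
      LinearMap.compr₂_apply, LinearMap.compl₁₂_apply, map_add, f.comm_l01, A.l1_l01,
      B.l1_comm, f.comm_l1]
    abel
  comm_l10 h x := by
    simp only [LinearMap.add_apply, LinearMap.sub_apply, LinearMap.comp_apply,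
      LinearMap.compr₂_apply, LinearMap.compl₁₂_apply, map_add, f.comm_l10, A.l1_l10,
      ← B.l1_comm, f.comm_l1]
    abel
  comm_l3 x y z := by
    have h := f.comm_l3 x y z
    have e : f.f1 (A.l3 x y z) = B.l3 (f.f0 x) (f.f0 y) (f.f0 z) - B.l10 (f.f2 x y) (f.f0 z)
      + B.l01 (f.f0 x) (f.f2 y z) - B.l01 (f.f0 y) (f.f2 x z)
      - f.f2 (A.l00 x y) z + f.f2 x (A.l00 y z) - f.f2 y (A.l00 x z) := by
      rw [h]; abel
    -- These bring the terms in which `l₁` sits inside a double bracket to one normal form, after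
    -- which all terms cancel formally.
    have h₁ : ∀ k w k', B.l01 (B.l00 (B.l1 k) w) k' = B.l10 (B.l10 k w) (B.l1 k') :=
      fun k w k' => by rw [← B.l1_l10, B.l1_comm]
    have h₂ : ∀ w k k', B.l01 (B.l00 w (B.l1 k)) k' = B.l10 (B.l01 w k) (B.l1 k') :=
      fun w k k' => by rw [← B.l1_l01, B.l1_comm]
    simp only [LinearMap.add_apply, LinearMap.sub_apply, LinearMap.comp_apply,
      LinearMap.compr₂_apply, LinearMap.compl₁₂_apply, map_add, map_sub, e, A.l1_l3,
      B.l3_l1_right, B.l3_l1_mid, B.l3_l1_left, ← f.comm_l00, B.l1_comm, h₁, h₂, B.l1_l10]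
    abel

/-- The sum of the two equations involves `g` in the middle; replacing it by `f` or `h` leaves the
cross terms `[l₁ θ x, τ y]` and `[θ x, l₁ τ y]`, which agree by `l1_comm`. -/
theorem IsTwoTermHomotopy.trans {f g h : InftyMorphism A B} {θ τ : V₀ →ₗ[K] W₁}
    (hθ : IsTwoTermHomotopy f g θ) (hτ : IsTwoTermHomotopy g h τ) :
    IsTwoTermHomotopy f h (τ + θ) where
  deg_zero x := by
    rw [LinearMap.add_apply, map_add, ← hθ.deg_zero, ← hτ.deg_zero]; abel
  deg_one x := by
    rw [LinearMap.add_apply, ← hθ.deg_one, ← hτ.deg_one]; abel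
  two x y := by
    have e : h.f2 x y - f.f2 x y = (h.f2 x y - g.f2 x y) + (g.f2 x y - f.f2 x y) := by abel
    have e1 : g.f0 x = f.f0 x + B.l1 (θ x) := by rw [← hθ.deg_zero]; abel
    have e2 : h.f0 y = g.f0 y + B.l1 (τ y) := by rw [← hτ.deg_zero]; abel
    rw [e, hθ.two, hτ.two, e1, e2]
    simp only [LinearMap.add_apply, map_add, B.l1_comm]
    abel

end TwoTerm

/-! ### Induction on words, and Koszul signs on homogeneous tensors. -/

section TensorWords

open TensorAlgebra

variable {K X S : Type*} [Field K] [AddCommGroup X] [Module K X] [AddCommGroup S] [Module K S]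

/-- `TensorAlgebra.induction` cuts a word at an arbitrary place. The stronger claim that `P v`
implies `P (w * v)` is stable under products, and so gives induction on the first letter. -/
theorem word_induction_left {P : TensorAlgebra K X → Prop} (one : P 1)
    (add : ∀ v w, P v → P w → P (v + w)) (smul : ∀ (c : K) w, P w → P (c • w))
    (cons : ∀ x w, P w → P (ι K x * w)) (w : TensorAlgebra K X) : P w := by
  have key : ∀ v, P v → P (w * v) := by
    induction w using TensorAlgebra.induction with
    | algebraMap r => intro v hv; rw [← Algebra.smul_def]; exact smul _ _ hv
    | ι x => exact cons x
    | mul a b ha hb => intro v hv; rw [mul_assoc]; exact ha _ (hb _ hv)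
    | add a b ha hb => intro v hv; rw [add_mul]; exact add _ _ (ha _ hv) (hb _ hv)
  simpa using key 1 one

theorem word_induction_right {P : TensorAlgebra K X → Prop} (one : P 1)
    (add : ∀ v w, P v → P w → P (v + w)) (smul : ∀ (c : K) w, P w → P (c • w))
    (snoc : ∀ w x, P w → P (w * ι K x)) (w : TensorAlgebra K X) : P w := by
  have key : ∀ v, P v → P (v * w) := by
    induction w using TensorAlgebra.induction with
    | algebraMap r =>
      intro v hv
      rw [← Algebra.commutes, ← Algebra.smul_def]; exact smul _ _ hv
    | ι x => exact fun v => snoc v x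
    | mul a b ha hb => intro v hv; rw [← mul_assoc]; exact hb _ (ha _ hv)
    | add a b ha hb => intro v hv; rw [mul_add]; exact add _ _ (ha _ hv) (hb _ hv)
  simpa using key 1 one

theorem foldLeft_one (R : X →ₗ[K] Module.End K S) (s : S) : foldLeft R s 1 = s := by
  simp [foldLeft]

theorem foldLeft_cons (R : X →ₗ[K] Module.End K S) (s : S) (x : X) (w : TensorAlgebra K X) :
    foldLeft R s (ι K x * w) = R x (foldLeft R s w) := by
  simp [foldLeft]

theorem foldRight_one (R : X →ₗ[K] Module.End K S) (s : S) : foldRight R s 1 = s := by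
  simp [foldRight]

theorem foldRight_snoc (R : X →ₗ[K] Module.End K S) (s : S) (x : X) (w : TensorAlgebra K X) :
    foldRight R s (w * ι K x) = R x (foldRight R s w) := by
  simp [foldRight]

theorem algebraMapInv_cons (x : X) (w : TensorAlgebra K X) :
    algebraMapInv (ι K x * w) = (0 : K) := by
  simp [algebraMapInv]

theorem algebraMapInv_snoc (w : TensorAlgebra K X) (x : X) :
    algebraMapInv (w * ι K x) = (0 : K) := by
  simp [algebraMapInv]

/-- Freezes the last letter `y`, so that `zinComul` and `codiffLast` become maps applied to the
unshuffles of the prefix. -/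
theorem map_assoc_tmul {M N P Q Y : Type*} [AddCommGroup M] [Module K M] [AddCommGroup N]
    [Module K N] [AddCommGroup P] [Module K P] [AddCommGroup Q] [Module K Q]
    [AddCommGroup Y] [Module K Y]
    (F : M →ₗ[K] P) (G : N ⊗[K] Y →ₗ[K] Q) (u : M ⊗[K] N) (y : Y) :
    TensorProduct.map F G (TensorProduct.assoc K M N Y (u ⊗ₜ[K] y))
      = TensorProduct.map F (G ∘ₗ (TensorProduct.mk K N Y).flip y) u := by
  induction u using TensorProduct.induction_on with
  | zero => simp
  | tmul a b => simp
  | add a b ha hb => rw [TensorProduct.add_tmul, map_add, map_add, map_add, ha, hb]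

/-- The operator `(1 + p + q - pq) / 2` becomes `1` where `q = 1` and `p` where `q = -1`, so it
suffices that one factor is homogeneous. -/
theorem koszulSign_tmul_even {M N : Type*} [AddCommGroup M] [Module K M] [AddCommGroup N]
    [Module K N] [CharZero K] (p : M →ₗ[K] M) (q : N →ₗ[K] N) (a : M) (b : N) (hb : q b = b) :
    koszulSign p q (a ⊗ₜ[K] b) = a ⊗ₜ[K] b := by
  have h2 : (2 : K) ≠ 0 := two_ne_zero
  simp only [koszulSign, LinearMap.smul_apply, LinearMap.sub_apply, LinearMap.add_apply,
    LinearMap.id_apply, TensorProduct.map_tmul, hb]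
  rw [inv_smul_eq_iff₀ h2, two_smul]; abel

theorem koszulSign_tmul_odd {M N : Type*} [AddCommGroup M] [Module K M] [AddCommGroup N]
    [Module K N] [CharZero K] (p : M →ₗ[K] M) (q : N →ₗ[K] N) (a : M) (b : N) (hb : q b = -b) :
    koszulSign p q (a ⊗ₜ[K] b) = p a ⊗ₜ[K] b := by
  have h2 : (2 : K) ≠ 0 := two_ne_zero
  simp only [koszulSign, LinearMap.smul_apply, LinearMap.sub_apply, LinearMap.add_apply,
    LinearMap.id_apply, TensorProduct.map_tmul, hb, TensorProduct.tmul_neg]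
  rw [inv_smul_eq_iff₀ h2, two_smul]; abel

theorem koszulSign_even_tmul {M N : Type*} [AddCommGroup M] [Module K M] [AddCommGroup N]
    [Module K N] [CharZero K] (p : M →ₗ[K] M) (q : N →ₗ[K] N) (a : M) (b : N) (ha : p a = a) :
    koszulSign p q (a ⊗ₜ[K] b) = a ⊗ₜ[K] b := by
  have h2 : (2 : K) ≠ 0 := two_ne_zero
  simp only [koszulSign, LinearMap.smul_apply, LinearMap.sub_apply, LinearMap.add_apply,
    LinearMap.id_apply, TensorProduct.map_tmul, ha]
  rw [inv_smul_eq_iff₀ h2, two_smul]; abel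

theorem koszulHom_tmul_even {M N P Q : Type*} [AddCommGroup M] [Module K M] [AddCommGroup N]
    [Module K N] [AddCommGroup P] [Module K P] [AddCommGroup Q] [Module K Q] [CharZero K]
    (pM : M →ₗ[K] M) (pN : N →ₗ[K] N) (pQ : Q →ₗ[K] Q) (f : M →ₗ[K] P) (g : N →ₗ[K] Q)
    (hg : homParity pN pQ g = g) :
    koszulHom pM pN pQ (f ⊗ₜ[K] g) = TensorProduct.map f g := by
  rw [koszulHom, LinearMap.comp_apply, koszulSign_tmul_even _ _ _ _ hg]
  rfl

theorem koszulHom_tmul_odd {M N P Q : Type*} [AddCommGroup M] [Module K M] [AddCommGroup N]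
    [Module K N] [AddCommGroup P] [Module K P] [AddCommGroup Q] [Module K Q] [CharZero K]
    (pM : M →ₗ[K] M) (pN : N →ₗ[K] N) (pQ : Q →ₗ[K] Q) (f : M →ₗ[K] P) (g : N →ₗ[K] Q)
    (hg : homParity pN pQ g = -g) :
    koszulHom pM pN pQ (f ⊗ₜ[K] g) = TensorProduct.map (f ∘ₗ pM) g := by
  rw [koszulHom, LinearMap.comp_apply, koszulSign_tmul_odd _ _ _ _ hg]
  rfl

end TensorWords

/-! ### Parts of small length in words, and their unshuffles. -/

section Words

open TensorAlgebra

variable {K V₀ V₁ : Type*} [Field K] [AddCommGroup V₀] [Module K V₀] [AddCommGroup V₁] [Module K V₁]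

theorem wordsParity_one : wordsParity K V₀ V₁ 1 = 1 := by simp [wordsParity]

theorem wordsParity_mul (v w : Words K V₀ V₁) :
    wordsParity K V₀ V₁ (v * w) = wordsParity K V₀ V₁ v * wordsParity K V₀ V₁ w := by
  simp [wordsParity]

theorem wordsParity_ι (x : V₀ × V₁) :
    wordsParity K V₀ V₁ (ι K x) = ι K (sParity K V₀ V₁ x) := by
  simp [wordsParity]

theorem sParity_apply (x : V₀ × V₁) : sParity K V₀ V₁ x = (-x.1, x.2) := by
  simp [sParity, parity]

theorem parity_apply (x : V₀ × V₁) : parity K V₀ V₁ x = (x.1, -x.2) := by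
  simp [parity]

theorem wordsParity_wordsParity (w : Words K V₀ V₁) :
    wordsParity K V₀ V₁ (wordsParity K V₀ V₁ w) = w := by
  induction w using word_induction_left with
  | one => simp [wordsParity_one]
  | add v w hv hw => rw [map_add, map_add, hv, hw]
  | smul c w hw => rw [map_smul, map_smul, hw]
  | cons x w hw => simp [wordsParity_mul, wordsParity_ι, hw, sParity_apply]

theorem concat_tmul (w : Words K V₀ V₁) (x : V₀ × V₁) :
    concat K V₀ V₁ (w ⊗ₜ[K] x) = w * ι K x := by
  simp [concat]

theorem split_one : split K V₀ V₁ 1 = 0 := by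
  simp [split, foldRight_one]

theorem split_snoc (w : Words K V₀ V₁) (x : V₀ × V₁) :
    split K V₀ V₁ (w * ι K x) = w ⊗ₜ[K] x := by
  rw [split, LinearMap.comp_apply, foldRight_snoc, LinearMap.mk₂_apply, LinearMap.snd_apply]
  refine congrArg (fun v => v ⊗ₜ[K] x) ?_
  induction w using word_induction_right with
  | one => simp [foldRight_one]
  | add v w hv hw => rw [map_add, Prod.fst_add, hv, hw]
  | smul c w hw => rw [map_smul, Prod.smul_fst, hw]
  | snoc w y hw => rw [foldRight_snoc, LinearMap.mk₂_apply, concat_tmul, hw]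

theorem unshuffle_one : unshuffle K V₀ V₁ 1 = 1 ⊗ₜ[K] 1 := foldLeft_one _ _

variable (K V₀ V₁) in
/-- Left concatenation with a letter. -/
def cons : V₀ × V₁ →ₗ[K] Words K V₀ V₁ →ₗ[K] Words K V₀ V₁ :=
  LinearMap.mul K (Words K V₀ V₁) ∘ₗ ι K

theorem cons_apply (x : V₀ × V₁) (w : Words K V₀ V₁) : cons K V₀ V₁ x w = ι K x * w := rfl

theorem homParity_cons (x : V₀ × V₁) :
    homParity (wordsParity K V₀ V₁) (wordsParity K V₀ V₁) (cons K V₀ V₁ x) =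
      cons K V₀ V₁ (sParity K V₀ V₁ x) := by
  refine LinearMap.ext fun v => ?_
  simp only [homParity, LinearMap.comp_apply, LinearMap.llcomp_apply, LinearMap.lcomp_apply,
    cons_apply, wordsParity_mul, wordsParity_wordsParity, wordsParity_ι]

theorem cons_eq (x : V₀ × V₁) : cons K V₀ V₁ x = cons K V₀ V₁ (0, x.2) + cons K V₀ V₁ (x.1, 0) := by
  rw [← map_add]; simp

/-- The new letter goes to the left subword or to the right one. In the second case its even `sV₁`
part passes freely, whereas its odd `sV₀` part collects the parity of the left subword. -/
theorem unshuffle_cons [CharZero K] (x : V₀ × V₁) (w : Words K V₀ V₁) :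
    unshuffle K V₀ V₁ (ι K x * w) =
      TensorProduct.map (cons K V₀ V₁ x) LinearMap.id (unshuffle K V₀ V₁ w) +
      TensorProduct.map LinearMap.id (cons K V₀ V₁ (0, x.2)) (unshuffle K V₀ V₁ w) +
      TensorProduct.map (wordsParity K V₀ V₁) (cons K V₀ V₁ (x.1, 0)) (unshuffle K V₀ V₁ w) := by
  have e : unshuffle K V₀ V₁ (ι K x * w) =
      TensorProduct.map (cons K V₀ V₁ x) LinearMap.id (unshuffle K V₀ V₁ w) +
        koszulHom (wordsParity K V₀ V₁) (wordsParity K V₀ V₁) (wordsParity K V₀ V₁)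
          (LinearMap.id ⊗ₜ[K] cons K V₀ V₁ x) (unshuffle K V₀ V₁ w) := by
    rw [unshuffle, foldLeft_cons]
    rfl
  have e₀ : homParity (wordsParity K V₀ V₁) (wordsParity K V₀ V₁) (cons K V₀ V₁ (0, x.2)) =
      cons K V₀ V₁ (0, x.2) := by
    rw [homParity_cons, sParity_apply]; simp
  have e₁ : homParity (wordsParity K V₀ V₁) (wordsParity K V₀ V₁) (cons K V₀ V₁ (x.1, 0)) =
      -cons K V₀ V₁ (x.1, 0) := by
    rw [homParity_cons, sParity_apply, ← map_neg]; simp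
  rw [e, add_assoc, ← LinearMap.add_apply (TensorProduct.map LinearMap.id _)]
  congr 2
  rw [cons_eq x, TensorProduct.tmul_add, map_add, koszulHom_tmul_even _ _ _ _ _ e₀,
    koszulHom_tmul_odd _ _ _ _ _ e₁, LinearMap.id_comp]

/-- The coefficient of the empty word. -/
abbrev coeff₀ : Words K V₀ V₁ →ₗ[K] K := (algebraMapInv (R := K) (M := V₀ × V₁)).toLinearMap

/-- The part of length one. -/
abbrev part₁ : Words K V₀ V₁ →ₗ[K] V₀ × V₁ := arity₁ K V₀ V₁ ∘ₗ split K V₀ V₁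

/-- The part in `sV₀ ⊗ sV₀` of length two. -/
def part₀₀ : Words K V₀ V₁ →ₗ[K] V₀ ⊗[K] V₀ :=
  TensorProduct.map (LinearMap.fst K V₀ V₁) (LinearMap.fst K V₀ V₁) ∘ₗ arity₂ K V₀ V₁ ∘ₗ
    split K V₀ V₁

theorem arity₁_tmul (w : Words K V₀ V₁) (x : V₀ × V₁) :
    arity₁ K V₀ V₁ (w ⊗ₜ[K] x) = coeff₀ w • x := by
  simp [arity₁]

theorem arity₂_tmul (w : Words K V₀ V₁) (x : V₀ × V₁) :
    arity₂ K V₀ V₁ (w ⊗ₜ[K] x) = part₁ w ⊗ₜ[K] x := by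
  simp [arity₂]

theorem arity₃_tmul (w : Words K V₀ V₁) (x : V₀ × V₁) :
    arity₃ K V₀ V₁ (w ⊗ₜ[K] x) = arity₂ K V₀ V₁ (split K V₀ V₁ w) ⊗ₜ[K] x := by
  simp [arity₃]

theorem part₁_one : part₁ (1 : Words K V₀ V₁) = 0 := by simp [split_one]

theorem part₁_snoc (w : Words K V₀ V₁) (x : V₀ × V₁) :
    part₁ (w * ι K x) = coeff₀ w • x := by
  rw [LinearMap.comp_apply, split_snoc, arity₁_tmul]

theorem part₀₀_one : part₀₀ (1 : Words K V₀ V₁) = 0 := by simp [part₀₀, split_one]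

theorem part₀₀_snoc (w : Words K V₀ V₁) (x : V₀ × V₁) :
    part₀₀ (w * ι K x) = (part₁ w).1 ⊗ₜ[K] x.1 := by
  rw [part₀₀, LinearMap.comp_apply, LinearMap.comp_apply, split_snoc, arity₂_tmul,
    TensorProduct.map_tmul]
  rfl

theorem coeff₀_one : coeff₀ (1 : Words K V₀ V₁) = 1 := by simp

theorem coeff₀_snoc (w : Words K V₀ V₁) (x : V₀ × V₁) : coeff₀ (w * ι K x) = 0 :=
  algebraMapInv_snoc _ _

theorem coeff₀_cons (x : V₀ × V₁) (w : Words K V₀ V₁) : coeff₀ (ι K x * w) = 0 :=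
  algebraMapInv_cons _ _

/-- `split` reads words from the right but `unshuffle` grows them on the left; the rules for
prepending a letter connect the two recursions. -/
theorem part₁_cons (x : V₀ × V₁) (w : Words K V₀ V₁) :
    part₁ (ι K x * w) = coeff₀ w • x := by
  induction w using word_induction_right with
  | one => rw [mul_one, ← one_mul (ι K x), part₁_snoc]
  | add v w hv hw => rw [mul_add, map_add, map_add, hv, hw, add_smul]
  | smul c w hw => rw [mul_smul_comm, map_smul, map_smul, hw, smul_assoc]
  | snoc w y _ => rw [← mul_assoc, part₁_snoc, coeff₀_cons, coeff₀_snoc, zero_smul, zero_smul]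

theorem part₀₀_cons (x : V₀ × V₁) (w : Words K V₀ V₁) :
    part₀₀ (ι K x * w) = x.1 ⊗ₜ[K] (part₁ w).1 := by
  induction w using word_induction_right with
  | one => rw [mul_one, ← one_mul (ι K x), part₀₀_snoc, part₁_one]; simp
  | add v w hv hw => rw [mul_add, map_add, map_add, hv, hw, Prod.fst_add, TensorProduct.tmul_add]
  | smul c w hw => rw [mul_smul_comm, map_smul, map_smul, hw, Prod.smul_fst, TensorProduct.tmul_smul]
  | snoc w y _ => rw [← mul_assoc, part₀₀_snoc, part₁_snoc, part₁_cons, Prod.smul_fst,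
      Prod.smul_fst, TensorProduct.smul_tmul]

theorem coeff₀_wordsParity (w : Words K V₀ V₁) : coeff₀ (wordsParity K V₀ V₁ w) = coeff₀ w := by
  induction w using word_induction_right with
  | one => rw [wordsParity_one]
  | add v w hv hw => rw [map_add, map_add, map_add, hv, hw]
  | smul c w hw => rw [map_smul, map_smul, map_smul, hw]
  | snoc w y _ => rw [wordsParity_mul, wordsParity_ι, coeff₀_snoc, coeff₀_snoc]

theorem part₁_wordsParity (w : Words K V₀ V₁) :
    part₁ (wordsParity K V₀ V₁ w) = sParity K V₀ V₁ (part₁ w) := by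
  induction w using word_induction_right with
  | one => rw [wordsParity_one, part₁_one, map_zero]
  | add v w hv hw => rw [map_add, map_add, map_add, map_add, hv, hw]
  | smul c w hw => rw [map_smul, map_smul, map_smul, map_smul, hw]
  | snoc w y _ => rw [wordsParity_mul, wordsParity_ι, part₁_snoc, part₁_snoc, coeff₀_wordsParity,
      map_smul]

section Counit

variable [CharZero K] {M N : Type*} [AddCommGroup M] [Module K M] [AddCommGroup N] [Module K N]

/-- Counit law: only the unshuffle with empty right subword survives. In the induction, a letter put
on the right kills the coefficient of the empty word. -/
theorem map_coeff₀_unshuffle (f : Words K V₀ V₁ →ₗ[K] M) (n : N) (w : Words K V₀ V₁) :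
    TensorProduct.map f (coeff₀.smulRight n) (unshuffle K V₀ V₁ w) = f w ⊗ₜ[K] n := by
  suffices h : TensorProduct.map LinearMap.id (coeff₀.smulRight n) (unshuffle K V₀ V₁ w)
      = w ⊗ₜ[K] n by
    rw [← LinearMap.comp_id f, ← LinearMap.id_comp (coeff₀.smulRight n), TensorProduct.map_comp,
      LinearMap.comp_apply, h]
    simp
  have h0 : ∀ x : V₀ × V₁,
      (coeff₀.smulRight n) ∘ₗ cons K V₀ V₁ x = (0 : Words K V₀ V₁ →ₗ[K] N) := by
    intro x; ext1 v
    simp only [LinearMap.comp_apply, LinearMap.smulRight_apply, cons_apply,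
      coeff₀_cons, zero_smul, LinearMap.zero_apply]
  induction w using word_induction_left with
  | one => simp [unshuffle_one]
  | add v w hv hw => rw [map_add, map_add, hv, hw, TensorProduct.add_tmul]
  | smul c w hw => rw [map_smul, map_smul, hw, TensorProduct.smul_tmul']
  | cons x w hw =>
    rw [unshuffle_cons]
    simp only [map_add, TensorProduct.map_map, h0,
      TensorProduct.map_zero_right, LinearMap.zero_apply, add_zero]
    rw [LinearMap.id_comp, LinearMap.comp_id, ← LinearMap.comp_id (cons K V₀ V₁ x),
      ← LinearMap.id_comp (coeff₀.smulRight n), TensorProduct.map_comp, LinearMap.comp_apply, hw]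
    simp [cons_apply]

/-- The other counit law. The sign caused by moving a letter across the left subword is invisible,
since that subword must be empty. -/
theorem coeff₀_map_unshuffle (m : M) (f : Words K V₀ V₁ →ₗ[K] N) (w : Words K V₀ V₁) :
    TensorProduct.map (coeff₀.smulRight m) f (unshuffle K V₀ V₁ w) = m ⊗ₜ[K] f w := by
  suffices h : TensorProduct.map (coeff₀.smulRight m) LinearMap.id (unshuffle K V₀ V₁ w)
      = m ⊗ₜ[K] w by
    rw [← LinearMap.comp_id f, ← LinearMap.id_comp (coeff₀.smulRight m), TensorProduct.map_comp,
      LinearMap.comp_apply, h]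
    simp
  have h0 : ∀ x : V₀ × V₁,
      (coeff₀.smulRight m) ∘ₗ cons K V₀ V₁ x = (0 : Words K V₀ V₁ →ₗ[K] M) := by
    intro x; ext1 v
    simp only [LinearMap.comp_apply, LinearMap.smulRight_apply, cons_apply,
      coeff₀_cons, zero_smul, LinearMap.zero_apply]
  have h1 : (coeff₀.smulRight m) ∘ₗ wordsParity K V₀ V₁ = coeff₀.smulRight m := by
    ext1 v
    rw [LinearMap.comp_apply, LinearMap.smulRight_apply, LinearMap.smulRight_apply,
      coeff₀_wordsParity]
  induction w using word_induction_left with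
  | one => simp [unshuffle_one]
  | add v w hv hw => rw [map_add, map_add, hv, hw, TensorProduct.tmul_add]
  | smul c w hw => rw [map_smul, map_smul, hw, TensorProduct.tmul_smul]
  | cons x w hw =>
    rw [unshuffle_cons]
    simp only [map_add, TensorProduct.map_map, h0, h1,
      TensorProduct.map_zero_left, LinearMap.zero_apply, zero_add, LinearMap.id_comp,
      LinearMap.comp_id]
    rw [← LinearMap.add_apply, ← TensorProduct.map_add_right, ← cons_eq x,
      ← LinearMap.comp_id (cons K V₀ V₁ x),
      ← LinearMap.id_comp (coeff₀.smulRight m), TensorProduct.map_comp, LinearMap.comp_apply, hw]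
    simp [cons_apply]

end Counit

/-- The part of length one in `sV₀`. -/
abbrev part₀ : Words K V₀ V₁ →ₗ[K] V₀ := LinearMap.fst K V₀ V₁ ∘ₗ part₁

/-- Only two-letter words contribute, through the unshuffles `y ⊗ z` and `z ⊗ y`; the second has a
minus sign because letters of `sV₀` are odd. -/
theorem part₀_map_unshuffle [CharZero K] (w : Words K V₀ V₁) :
    TensorProduct.map part₀ part₀ (unshuffle K V₀ V₁ w)
      = part₀₀ w - TensorProduct.comm K V₀ V₀ (part₀₀ w) := by
  induction w using word_induction_left with
  | one => rw [unshuffle_one, part₀₀_one, TensorProduct.map_tmul, LinearMap.comp_apply, part₁_one]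
           simp
  | add v w hv hw => simp only [map_add, hv, hw]; abel
  | smul c w hw => simp only [map_smul, hw, smul_sub]
  | cons x w _ =>
    have h : ∀ x : V₀ × V₁, part₀ ∘ₗ cons K V₀ V₁ x
        = (coeff₀.smulRight x.1 : Words K V₀ V₁ →ₗ[K] V₀) := by
      intro x; ext1 v
      simp only [LinearMap.comp_apply, cons_apply]
      rw [← LinearMap.comp_apply (arity₁ K V₀ V₁), part₁_cons]; rfl
    rw [unshuffle_cons]
    simp only [map_add]
    rw [TensorProduct.map_map, TensorProduct.map_map, TensorProduct.map_map, h, h, h,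
      LinearMap.comp_id, coeff₀_map_unshuffle, map_coeff₀_unshuffle,
      map_coeff₀_unshuffle, part₀₀_cons, TensorProduct.comm_tmul]
    have e : part₀ (wordsParity K V₀ V₁ w) = -part₀ w := by
      rw [LinearMap.comp_apply, part₁_wordsParity, sParity_apply]; rfl
    simp only [TensorProduct.tmul_zero, add_zero, LinearMap.comp_apply] at e ⊢
    rw [e, TensorProduct.neg_tmul, sub_eq_add_neg]
    rfl

end Words

/-! ### The codifferential in the lengths that elements of degree `-1` can see. -/

section Codiff

open TensorAlgebra

variable {K V₀ V₁ : Type*} [Field K] [AddCommGroup V₀] [Module K V₀] [AddCommGroup V₁] [Module K V₁]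
  (A : TwoTermLeibniz K V₀ V₁)

theorem map_neg_left_apply {M N P Q : Type*} [AddCommGroup M] [Module K M] [AddCommGroup N]
    [Module K N] [AddCommGroup P] [Module K P] [AddCommGroup Q] [Module K Q]
    (f : M →ₗ[K] P) (g : N →ₗ[K] Q) (u : M ⊗[K] N) :
    TensorProduct.map (-f) g u = -TensorProduct.map f g u := by
  rw [← neg_one_smul K f, TensorProduct.map_smul_left, LinearMap.smul_apply, neg_one_smul]

theorem map_neg_right_apply {M N P Q : Type*} [AddCommGroup M] [Module K M] [AddCommGroup N]
    [Module K N] [AddCommGroup P] [Module K P] [AddCommGroup Q] [Module K Q]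
    (f : M →ₗ[K] P) (g : N →ₗ[K] Q) (u : M ⊗[K] N) :
    TensorProduct.map f (-g) u = -TensorProduct.map f g u := by
  rw [← neg_one_smul K g, TensorProduct.map_smul_right, LinearMap.smul_apply, neg_one_smul]

theorem br₁_apply (x : V₀ × V₁) : A.br₁ x = (A.l1 x.2, 0) := rfl

theorem br₂_tmul (x y : V₀ × V₁) :
    A.br₂ (x ⊗ₜ[K] y) = (A.l00 x.1 y.1, A.l01 x.1 y.2 + A.l10 x.2 y.1) := by
  simp [TwoTermLeibniz.br₂]

theorem br₂_apply (u : (V₀ × V₁) ⊗[K] (V₀ × V₁)) :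
    A.br₂ u = (TensorProduct.lift A.l00 (TensorProduct.map (LinearMap.fst K V₀ V₁)
        (LinearMap.fst K V₀ V₁) u),
      TensorProduct.lift A.l01 (TensorProduct.map (LinearMap.fst K V₀ V₁)
        (LinearMap.snd K V₀ V₁) u) +
      TensorProduct.lift A.l10 (TensorProduct.map (LinearMap.snd K V₀ V₁)
        (LinearMap.fst K V₀ V₁) u)) := by
  simp [TwoTermLeibniz.br₂]

theorem br₃_tmul (u : (V₀ × V₁) ⊗[K] (V₀ × V₁)) (x : V₀ × V₁) :
    A.br₃ (u ⊗ₜ[K] x) = (0, TensorProduct.lift A.l3 (TensorProduct.map (LinearMap.fst K V₀ V₁)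
        (LinearMap.fst K V₀ V₁) u) x.1) := by
  simp [TwoTermLeibniz.br₃]

/-- The minus sign of the `l10` term is the sign of `D₂` for a first argument in `V₁`; the sign of
`D₃` disappears because `l₃` is nonzero only on `V₀`. -/
theorem corestriction_tmul (w : Words K V₀ V₁) (x : V₀ × V₁) :
    A.corestriction (w ⊗ₜ[K] x) = (coeff₀ w • A.l1 x.2 + A.l00 (part₀ w) x.1,
      A.l01 (part₀ w) x.2 - A.l10 (part₁ w).2 x.1 + TensorProduct.lift A.l3 (part₀₀ w) x.1) := by
  have e : TensorProduct.map (LinearMap.fst K V₀ V₁) (LinearMap.fst K V₀ V₁)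
      (TensorProduct.map LinearMap.id (parity K V₀ V₁) (arity₂ K V₀ V₁ (split K V₀ V₁ w)))
      = part₀₀ w := by
    rw [TensorProduct.map_map]
    rfl
  simp only [TwoTermLeibniz.corestriction, LinearMap.add_apply, LinearMap.comp_apply, arity₁_tmul,
    arity₂_tmul, arity₃_tmul, TensorProduct.map_tmul, br₁_apply, br₂_tmul, br₃_tmul, e,
    parity_apply, LinearMap.id_apply, map_neg, LinearMap.neg_apply, map_smul, LinearMap.fst_apply]
  simp [sub_eq_add_neg]

theorem codiffLast_tmul (w : Words K V₀ V₁) (x : V₀ × V₁) :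
    A.codiffLast (w ⊗ₜ[K] x) = TensorProduct.map (wordsParity K V₀ V₁)
      (A.corestriction ∘ₗ (TensorProduct.mk K _ _).flip x) (unshuffle K V₀ V₁ w) := by
  rw [TwoTermLeibniz.codiffLast, LinearMap.comp_apply, LinearMap.comp_apply,
    LinearMap.rTensor_tmul]
  exact map_assoc_tmul _ _ _ _

theorem codiffWords_one : A.codiffWords 1 = 0 := by
  simp [TwoTermLeibniz.codiffWords, foldRight_one]

theorem codiffWords_snoc (w : Words K V₀ V₁) (x : V₀ × V₁) :
    A.codiffWords (w * ι K x) =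
      A.codiffWords w * ι K x + concat K V₀ V₁ (A.codiffLast (w ⊗ₜ[K] x)) := by
  rw [TwoTermLeibniz.codiffWords, LinearMap.comp_apply, foldRight_snoc, LinearMap.mk₂_apply,
    LinearMap.snd_apply]
  refine congrArg₂ (· + ·) (concat_tmul _ _)
    (congrArg (fun v => concat K V₀ V₁ (A.codiffLast (v ⊗ₜ[K] x))) ?_)
  induction w using word_induction_right with
  | one => simp [foldRight_one]
  | add v w hv hw => rw [map_add, Prod.fst_add, hv, hw]
  | smul c w hw => rw [map_smul, Prod.smul_fst, hw]
  | snoc w y hw => rw [foldRight_snoc, LinearMap.mk₂_apply, concat_tmul, hw]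

theorem codiff_tmul (w : Words K V₀ V₁) (x : V₀ × V₁) :
    A.codiff (w ⊗ₜ[K] x) = A.codiffWords w ⊗ₜ[K] x + A.codiffLast (w ⊗ₜ[K] x) := by
  simp [TwoTermLeibniz.codiff]

theorem coeff₀_concat (z : Zin K V₀ V₁) : coeff₀ (concat K V₀ V₁ z) = 0 := by
  induction z using TensorProduct.induction_on with
  | zero => simp only [map_zero]
  | tmul w x => rw [concat_tmul, coeff₀_snoc]
  | add a b ha hb => rw [map_add, map_add, ha, hb, add_zero]

theorem part₁_concat (z : Zin K V₀ V₁) : part₁ (concat K V₀ V₁ z) = arity₁ K V₀ V₁ z := by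
  induction z using TensorProduct.induction_on with
  | zero => simp only [map_zero]
  | tmul w x => rw [concat_tmul, part₁_snoc, arity₁_tmul]
  | add a b ha hb => rw [map_add, map_add, map_add, ha, hb]

theorem coeff₀_codiffWords (w : Words K V₀ V₁) : coeff₀ (A.codiffWords w) = 0 := by
  induction w using word_induction_right with
  | one => rw [codiffWords_one, map_zero]
  | add v w hv hw => rw [map_add, map_add, hv, hw, add_zero]
  | smul c w hw => rw [map_smul, map_smul, hw, smul_zero]
  | snoc w x _ => rw [codiffWords_snoc, map_add, coeff₀_snoc, coeff₀_concat, add_zero]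

variable [CharZero K]

/-- A single letter remains only if the left subword is empty, that is, if `D` consumes the whole
word. -/
theorem arity₁_codiffLast (z : Zin K V₀ V₁) :
    arity₁ K V₀ V₁ (A.codiffLast z) = A.corestriction z := by
  induction z using TensorProduct.induction_on with
  | zero => simp only [map_zero]
  | add a b ha hb => rw [map_add, map_add, map_add, ha, hb]
  | tmul w x =>
    have h : coeff₀ ∘ₗ wordsParity K V₀ V₁ = coeff₀.smulRight (1 : K) := by
      refine LinearMap.ext fun v => ?_
      rw [LinearMap.comp_apply, coeff₀_wordsParity, LinearMap.smulRight_apply, smul_eq_mul, mul_one]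
    rw [codiffLast_tmul, arity₁, LinearMap.comp_apply, LinearMap.rTensor, TensorProduct.map_map, h,
      coeff₀_map_unshuffle]
    simp

theorem arity₁_codiff (z : Zin K V₀ V₁) :
    arity₁ K V₀ V₁ (A.codiff z) = A.corestriction z := by
  induction z using TensorProduct.induction_on with
  | zero => simp only [map_zero]
  | add a b ha hb => rw [map_add, map_add, map_add, ha, hb]
  | tmul w x =>
    rw [codiff_tmul, map_add, arity₁_tmul, coeff₀_codiffWords, zero_smul, zero_add,
      arity₁_codiffLast]

/-- A letter of `sV₀` arises from `l₁` on one letter of `sV₁` or from `l₂` on two letters of `sV₀`.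
-/
theorem part₀_codiffWords (w : Words K V₀ V₁) :
    part₀ (A.codiffWords w) = A.l1 (part₁ w).2 + TensorProduct.lift A.l00 (part₀₀ w) := by
  induction w using word_induction_right with
  | one => simp only [codiffWords_one, map_zero, part₁_one, part₀₀_one, Prod.snd_zero, add_zero]
  | add v w hv hw => simp only [map_add, hv, hw, Prod.snd_add]; abel
  | smul c w hw => simp only [map_smul, hw, Prod.smul_snd, smul_add]
  | snoc w x _ =>
    rw [codiffWords_snoc, map_add, LinearMap.comp_apply, part₁_snoc, coeff₀_codiffWords, zero_smul,
      map_zero, zero_add, LinearMap.comp_apply, part₁_concat, arity₁_codiffLast,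
      corestriction_tmul, part₁_snoc, part₀₀_snoc, TensorProduct.lift.tmul, LinearMap.fst_apply,
      Prod.smul_snd, map_smul]
    rfl

/-- The left subword is one odd letter, which accounts for the overall minus sign. Either the prefix
is that letter and `D₁` acts on `x`, or the prefix is a pair and `D₂` joins its other letter to `x`;
the two unshuffles of the pair give terms of opposite sign. -/
theorem lift_map_codiffLast {N : Type*} [AddCommGroup N] [Module K N] (b : V₀ →ₗ[K] V₀ →ₗ[K] N)
    (w : Words K V₀ V₁) (x : V₀ × V₁) :
    TensorProduct.lift b (TensorProduct.map part₀ (LinearMap.fst K V₀ V₁)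
        (A.codiffLast (w ⊗ₜ[K] x)))
      = -b (part₀ w) (A.l1 x.2) - TensorProduct.lift (b.compl₂ (A.l00.flip x.1)) (part₀₀ w)
        + TensorProduct.lift (b.flip.compl₁₂ (A.l00.flip x.1) LinearMap.id) (part₀₀ w) := by
  have h₀ : part₀ ∘ₗ wordsParity K V₀ V₁ = -part₀ := by
    refine LinearMap.ext fun v => ?_
    rw [LinearMap.comp_apply, LinearMap.comp_apply, part₁_wordsParity, sParity_apply]; rfl
  have h₁ : LinearMap.fst K V₀ V₁ ∘ₗ A.corestriction ∘ₗ (TensorProduct.mk K _ _).flip x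
      = coeff₀.smulRight (A.l1 x.2) + A.l00.flip x.1 ∘ₗ part₀ := by
    refine LinearMap.ext fun v => ?_
    simp only [LinearMap.comp_apply, LinearMap.flip_apply, TensorProduct.mk_apply,
      corestriction_tmul, LinearMap.fst_apply, LinearMap.add_apply, LinearMap.smulRight_apply]
  have h₂ : TensorProduct.map (part₀ (K := K) (V₁ := V₁)) (A.l00.flip x.1 ∘ₗ part₀)
      (unshuffle K V₀ V₁ w) = TensorProduct.map LinearMap.id (A.l00.flip x.1)
        (part₀₀ w - TensorProduct.comm K V₀ V₀ (part₀₀ w)) := by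
    rw [← part₀_map_unshuffle, TensorProduct.map_map, LinearMap.id_comp]
  have h₃ : ∀ u : V₀ ⊗[K] V₀, TensorProduct.lift b (TensorProduct.map LinearMap.id (A.l00.flip x.1) u)
      = TensorProduct.lift (b.compl₂ (A.l00.flip x.1)) u := by
    intro u
    induction u using TensorProduct.induction_on with
    | zero => simp only [map_zero]
    | tmul y z => simp
    | add u v hu hv => simp only [map_add, hu, hv]
  have h₄ : ∀ u : V₀ ⊗[K] V₀, TensorProduct.lift (b.compl₂ (A.l00.flip x.1))
      (TensorProduct.comm K V₀ V₀ u)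
      = TensorProduct.lift (b.flip.compl₁₂ (A.l00.flip x.1) LinearMap.id) u := by
    intro u
    induction u using TensorProduct.induction_on with
    | zero => simp only [map_zero]
    | tmul y z => simp
    | add u v hu hv => simp only [map_add, hu, hv]
  rw [codiffLast_tmul, TensorProduct.map_map, h₀, h₁, TensorProduct.map_add_right,
    LinearMap.add_apply, map_coeff₀_unshuffle, map_neg_left_apply, h₂,
    map_add, map_neg, map_sub, map_sub, h₃, h₃, h₄, TensorProduct.lift.tmul]
  simp only [LinearMap.neg_apply, map_neg]
  abel

end Codiff

/-! ### Graded antisymmetrization of homogeneous maps. -/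

section Antisymmetrization

variable {K M Z W : Type*} [Field K] [CharZero K] [AddCommGroup M] [Module K M]
  [AddCommGroup Z] [Module K Z] [AddCommGroup W] [Module K W]

theorem antisymm₂_tmul_even (p : M →ₗ[K] M) (f : M) {g : M} (hg : p g = g) :
    antisymm₂ p (f ⊗ₜ[K] g) = f ⊗ₜ[K] g - g ⊗ₜ[K] f := by
  rw [antisymm₂, LinearMap.sub_apply, braid, LinearMap.comp_apply, koszulSign_tmul_even _ _ _ _ hg]
  simp

theorem antisymm₂_even_tmul (p : M →ₗ[K] M) {f : M} (g : M) (hf : p f = f) :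
    antisymm₂ p (f ⊗ₜ[K] g) = f ⊗ₜ[K] g - g ⊗ₜ[K] f := by
  rw [antisymm₂, LinearMap.sub_apply, braid, LinearMap.comp_apply, koszulSign_even_tmul _ _ _ _ hf]
  simp

theorem antisymm₂_odd (p : M →ₗ[K] M) {f g : M} (hf : p f = -f) (hg : p g = -g) :
    antisymm₂ p (f ⊗ₜ[K] g) = f ⊗ₜ[K] g + g ⊗ₜ[K] f := by
  rw [antisymm₂, LinearMap.sub_apply, braid, LinearMap.comp_apply, koszulSign_tmul_odd _ _ _ _ hg,
    hf]
  simp [TensorProduct.neg_tmul]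

/-- Each adjacent braiding acts as `-1` on `f ⊗ f` for odd `f`, so all six signed permutations
contribute equally. The factor cancels the `1/3!` of the Maurer-Cartan equation. -/
theorem antisymm₃_odd (p : M →ₗ[K] M) {f : M} (hf : p f = -f) :
    antisymm₃ p ((f ⊗ₜ[K] f) ⊗ₜ[K] f) = (6 : K) • ((f ⊗ₜ[K] f) ⊗ₜ[K] f) := by
  have h : braid p p (f ⊗ₜ[K] f) = -(f ⊗ₜ[K] f) := by
    rw [braid, LinearMap.comp_apply, koszulSign_tmul_odd _ _ _ _ hf, hf]
    simp [TensorProduct.neg_tmul]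
  simp only [antisymm₃, LinearMap.sub_apply, LinearMap.add_apply, LinearMap.id_apply,
    LinearMap.comp_apply, LinearMap.rTensor_tmul, LinearEquiv.coe_coe, TensorProduct.assoc_tmul,
    LinearMap.lTensor_tmul, h, TensorProduct.neg_tmul, TensorProduct.tmul_neg, map_neg,
    TensorProduct.assoc_symm_tmul]
  module

theorem koszulHom_antisymm₂_odd (pZ : Z →ₗ[K] Z) (pW : W →ₗ[K] W) {f g : Z →ₗ[K] W}
    (hf : homParity pZ pW f = -f) (hg : homParity pZ pW g = -g) :
    koszulHom pZ pZ pW (antisymm₂ (homParity pZ pW) (f ⊗ₜ[K] g)) =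
      TensorProduct.map (f ∘ₗ pZ) g + TensorProduct.map (g ∘ₗ pZ) f := by
  rw [antisymm₂_odd _ hf hg, map_add, koszulHom_tmul_odd _ _ _ _ _ hg,
    koszulHom_tmul_odd _ _ _ _ _ hf]

theorem koszulHom_antisymm₂_odd_even (pZ : Z →ₗ[K] Z) (pW : W →ₗ[K] W) {f g : Z →ₗ[K] W}
    (hf : homParity pZ pW f = -f) (hg : homParity pZ pW g = g) :
    koszulHom pZ pZ pW (antisymm₂ (homParity pZ pW) (f ⊗ₜ[K] g)) =
      TensorProduct.map f g - TensorProduct.map (g ∘ₗ pZ) f := by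
  rw [antisymm₂_tmul_even _ _ hg, map_sub, koszulHom_tmul_even _ _ _ _ _ hg,
    koszulHom_tmul_odd _ _ _ _ _ hf]

theorem koszulHom_antisymm₂_even (pZ : Z →ₗ[K] Z) (pW : W →ₗ[K] W) {f g : Z →ₗ[K] W}
    (hf : homParity pZ pW f = f) (hg : homParity pZ pW g = g) :
    koszulHom pZ pZ pW (antisymm₂ (homParity pZ pW) (f ⊗ₜ[K] g)) =
      TensorProduct.map f g - TensorProduct.map g f := by
  rw [antisymm₂_tmul_even _ _ hg, map_sub, koszulHom_tmul_even _ _ _ _ _ hg,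
    koszulHom_tmul_even _ _ _ _ _ hf]

theorem koszulHom_antisymm₂_even_odd (pZ : Z →ₗ[K] Z) (pW : W →ₗ[K] W) {f g : Z →ₗ[K] W}
    (hf : homParity pZ pW f = -f) (hg : homParity pZ pW g = g) :
    koszulHom pZ pZ pW (antisymm₂ (homParity pZ pW) (g ⊗ₜ[K] f)) =
      TensorProduct.map (g ∘ₗ pZ) f - TensorProduct.map f g := by
  rw [antisymm₂_even_tmul _ _ hg, map_sub, koszulHom_tmul_even _ _ _ _ _ hg,
    koszulHom_tmul_odd _ _ _ _ _ hf]

/-- Two odd maps pass the first argument and one passes the second, whence two parity twists on the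
first factor and one on the second. -/
theorem koszulHom_antisymm₃_odd (pZ : Z →ₗ[K] Z) (pW : W →ₗ[K] W) {f : Z →ₗ[K] W}
    (hf : homParity pZ pW f = -f) :
    koszulHom (A := Z ⊗[K] Z) (C := W ⊗[K] W) (TensorProduct.map pZ pZ) pZ pW
      (LinearMap.rTensor _ (koszulHom pZ pZ pW)
        (antisymm₃ (homParity pZ pW) ((f ⊗ₜ[K] f) ⊗ₜ[K] f))) =
      (6 : K) • TensorProduct.map (TensorProduct.map (f ∘ₗ pZ ∘ₗ pZ) (f ∘ₗ pZ)) f := by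
  rw [antisymm₃_odd _ hf, map_smul, map_smul, LinearMap.rTensor_tmul,
    koszulHom_tmul_odd _ _ _ _ _ hf, koszulHom_tmul_odd _ _ _ _ _ hf, ← TensorProduct.map_comp]
  rfl

end Antisymmetrization

/-! ### The brackets of `L` on elements of degrees `-1` and `0`. -/

section Components

variable (K V₀ V₁ W₀ W₁ : Type*) [Field K]
  [AddCommGroup V₀] [Module K V₀] [AddCommGroup V₁] [Module K V₁]
  [AddCommGroup W₀] [Module K W₀] [AddCommGroup W₁] [Module K W₁]

/-- The components `V₀ → W₀`, `V₁ → W₁`, `V₀ × V₀ → W₁` of an element of `L(V, W)` of degree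
`-1`. -/
abbrev Components := (V₀ →ₗ[K] W₀) × (V₁ →ₗ[K] W₁) × (V₀ →ₗ[K] V₀ →ₗ[K] W₁)

/-- The element of `L(V, W)` of degree `-1` with given components. -/
def ofComponents : Components K V₀ V₁ W₀ W₁ →ₗ[K] Conv K V₀ V₁ W₀ W₁ where
  toFun p := LinearMap.prodMap p.1 p.2.1 ∘ₗ arity₁ K V₀ V₁ +
    LinearMap.inr K W₀ W₁ ∘ₗ TensorProduct.lift p.2.2 ∘ₗ
      TensorProduct.map (LinearMap.fst K V₀ V₁) (LinearMap.fst K V₀ V₁) ∘ₗ arity₂ K V₀ V₁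
  map_add' p q := by
    refine TensorProduct.ext' fun w x => ?_
    simp only [LinearMap.add_apply, LinearMap.comp_apply, arity₁_tmul, arity₂_tmul,
      TensorProduct.map_tmul, TensorProduct.lift.tmul, LinearMap.prodMap_apply,
      LinearMap.inr_apply, Prod.fst_add, Prod.snd_add]
    ext <;> simp; abel
  map_smul' c p := by
    refine TensorProduct.ext' fun w x => ?_
    simp only [LinearMap.add_apply, LinearMap.comp_apply, arity₁_tmul, arity₂_tmul,
      TensorProduct.map_tmul, TensorProduct.lift.tmul, LinearMap.prodMap_apply,
      LinearMap.inr_apply, Prod.smul_fst, Prod.smul_snd, LinearMap.smul_apply]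
    ext <;> simp [smul_comm c]

/-- The element of `L(V, W)` of degree `0` given by a map `V₀ → W₁`. -/
def ofHom : (V₀ →ₗ[K] W₁) →ₗ[K] Conv K V₀ V₁ W₀ W₁ where
  toFun q := LinearMap.inr K W₀ W₁ ∘ₗ q ∘ₗ LinearMap.fst K V₀ V₁ ∘ₗ arity₁ K V₀ V₁
  map_add' p q := by ext <;> simp
  map_smul' c p := by ext <;> simp

variable {K V₀ V₁ W₀ W₁}

theorem ofComponents_tmul (p : Components K V₀ V₁ W₀ W₁) (w : Words K V₀ V₁) (x : V₀ × V₁) :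
    ofComponents K V₀ V₁ W₀ W₁ p (w ⊗ₜ[K] x) =
      (coeff₀ w • p.1 x.1, coeff₀ w • p.2.1 x.2 + p.2.2 (part₀ w) x.1) := by
  simp [ofComponents, arity₁_tmul, arity₂_tmul]

theorem ofHom_tmul (q : V₀ →ₗ[K] W₁) (w : Words K V₀ V₁) (x : V₀ × V₁) :
    ofHom K V₀ V₁ W₀ W₁ q (w ⊗ₜ[K] x) = (0, coeff₀ w • q x.1) := by
  simp [ofHom, arity₁_tmul]

theorem ofComponents_apply (p : Components K V₀ V₁ W₀ W₁) (z : Zin K V₀ V₁) :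
    ofComponents K V₀ V₁ W₀ W₁ p z = (p.1 (arity₁ K V₀ V₁ z).1, p.2.1 (arity₁ K V₀ V₁ z).2 +
      TensorProduct.lift p.2.2 (TensorProduct.map (LinearMap.fst K V₀ V₁) (LinearMap.fst K V₀ V₁)
        (arity₂ K V₀ V₁ z))) := by
  simp [ofComponents]

theorem ofHom_apply (q : V₀ →ₗ[K] W₁) (z : Zin K V₀ V₁) :
    ofHom K V₀ V₁ W₀ W₁ q z = (0, q (arity₁ K V₀ V₁ z).1) := by
  simp [ofHom]

theorem ofComponents_split (p : Components K V₀ V₁ W₀ W₁) (w : Words K V₀ V₁) :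
    ofComponents K V₀ V₁ W₀ W₁ p (split K V₀ V₁ w) =
      (p.1 (part₀ w), p.2.1 (part₁ w).2 + TensorProduct.lift p.2.2 (part₀₀ w)) := by
  rw [ofComponents_apply]; rfl

theorem ofHom_split (q : V₀ →ₗ[K] W₁) (w : Words K V₀ V₁) :
    ofHom K V₀ V₁ W₀ W₁ q (split K V₀ V₁ w) = (0, q (part₀ w)) := by
  rw [ofHom_apply]; rfl

theorem zinParity_tmul (w : Words K V₀ V₁) (x : V₀ × V₁) :
    zinParity K V₀ V₁ (w ⊗ₜ[K] x) = wordsParity K V₀ V₁ w ⊗ₜ[K] sParity K V₀ V₁ x := by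
  simp [zinParity]

theorem part₀_wordsParity (w : Words K V₀ V₁) : part₀ (wordsParity K V₀ V₁ w) = -part₀ w := by
  rw [LinearMap.comp_apply, part₁_wordsParity, sParity_apply]; rfl

theorem ofComponents_zinParity (p : Components K V₀ V₁ W₀ W₁) :
    ofComponents K V₀ V₁ W₀ W₁ p ∘ₗ zinParity K V₀ V₁
      = -(parity K W₀ W₁ ∘ₗ ofComponents K V₀ V₁ W₀ W₁ p) := by
  refine TensorProduct.ext' fun w x => ?_
  rw [LinearMap.neg_apply, LinearMap.comp_apply, LinearMap.comp_apply, zinParity_tmul,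
    ofComponents_tmul, ofComponents_tmul, coeff₀_wordsParity, part₀_wordsParity, sParity_apply,
    parity_apply]
  simp

theorem ofHom_zinParity (q : V₀ →ₗ[K] W₁) :
    ofHom K V₀ V₁ W₀ W₁ q ∘ₗ zinParity K V₀ V₁ = -ofHom K V₀ V₁ W₀ W₁ q := by
  refine TensorProduct.ext' fun w x => ?_
  rw [LinearMap.comp_apply, zinParity_tmul, ofHom_tmul, LinearMap.neg_apply, ofHom_tmul,
    coeff₀_wordsParity, sParity_apply]
  simp

theorem parity_parity (x : W₀ × W₁) : parity K W₀ W₁ (parity K W₀ W₁ x) = x := by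
  simp [parity_apply]

theorem convParity_apply (f : Conv K V₀ V₁ W₀ W₁) :
    convParity K V₀ V₁ W₀ W₁ f = parity K W₀ W₁ ∘ₗ f ∘ₗ zinParity K V₀ V₁ := rfl

theorem convParity_ofComponents (p : Components K V₀ V₁ W₀ W₁) :
    convParity K V₀ V₁ W₀ W₁ (ofComponents K V₀ V₁ W₀ W₁ p)
      = -ofComponents K V₀ V₁ W₀ W₁ p := by
  rw [convParity_apply, ofComponents_zinParity]
  refine LinearMap.ext fun z => ?_
  simp [parity_parity]

theorem convParity_ofHom (q : V₀ →ₗ[K] W₁) :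
    convParity K V₀ V₁ W₀ W₁ (ofHom K V₀ V₁ W₀ W₁ q) = ofHom K V₀ V₁ W₀ W₁ q := by
  rw [convParity_apply, ofHom_zinParity]
  refine TensorProduct.ext' fun w x => ?_
  simp [ofHom_tmul, parity_apply]

theorem zinComul_tmul (w : Words K V₀ V₁) (x : V₀ × V₁) :
    zinComul K V₀ V₁ (w ⊗ₜ[K] x) = TensorProduct.map (split K V₀ V₁)
      ((TensorProduct.mk K _ _).flip x) (unshuffle K V₀ V₁ w) := by
  rw [zinComul, LinearMap.comp_apply, LinearMap.comp_apply, LinearMap.rTensor_tmul]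
  exact map_assoc_tmul _ LinearMap.id _ _

section Brackets

variable (A : TwoTermLeibniz K V₀ V₁) (B : TwoTermLeibniz K W₀ W₁)

/-- The components of `𝓛₁ q`, for `q` of degree `0`. -/
def linearPart : (V₀ →ₗ[K] W₁) →ₗ[K] Components K V₀ V₁ W₀ W₁ where
  toFun q := (B.l1 ∘ₗ q, q ∘ₗ A.l1, A.l00.compr₂ q)
  map_add' p q := by ext <;> simp
  map_smul' c p := by ext <;> simp

/-- The components of `𝓛₂(p, q)`, for `p` of degree `-1` and `q` of degree `0`. -/
def mixedBracket : Components K V₀ V₁ W₀ W₁ →ₗ[K] (V₀ →ₗ[K] W₁) →ₗ[K] Components K V₀ V₁ W₀ W₁ :=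
  LinearMap.mk₂ K (fun p q => (0, 0, B.l01.compl₁₂ p.1 q + B.l10.compl₁₂ q p.1))
    (by intros; ext <;> simp; abel) (by intros; ext <;> simp)
    (by intros; ext <;> simp; abel) (by intros; ext <;> simp)

theorem conv₂_eq (t : Conv K V₀ V₁ W₀ W₁ ⊗[K] Conv K V₀ V₁ W₀ W₁) :
    conv₂ B t = B.br₂ ∘ₗ koszulHom (zinParity K V₀ V₁) (zinParity K V₀ V₁) (parity K W₀ W₁)
      (antisymm₂ (convParity K V₀ V₁ W₀ W₁) t) ∘ₗ zinComul K V₀ V₁ := rfl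

theorem conv₃_eq (t : (Conv K V₀ V₁ W₀ W₁ ⊗[K] Conv K V₀ V₁ W₀ W₁) ⊗[K] Conv K V₀ V₁ W₀ W₁) :
    conv₃ B t = B.br₃ ∘ₗ
      koszulHom (A := Zin K V₀ V₁ ⊗[K] Zin K V₀ V₁) (C := (W₀ × W₁) ⊗[K] (W₀ × W₁))
      (TensorProduct.map (zinParity K V₀ V₁) (zinParity K V₀ V₁)) (zinParity K V₀ V₁)
      (parity K W₀ W₁) (LinearMap.rTensor _
        (koszulHom (zinParity K V₀ V₁) (zinParity K V₀ V₁) (parity K W₀ W₁))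
        (antisymm₃ (convParity K V₀ V₁ W₀ W₁) t)) ∘ₗ
      LinearMap.rTensor _ (zinComul K V₀ V₁) ∘ₗ zinComul K V₀ V₁ := rfl

variable [CharZero K]

/-- An element of degree `0` reads only words of length one, so of the whole codifferential only the
corestriction matters. -/
theorem conv₁_ofHom (q : V₀ →ₗ[K] W₁) :
    conv₁ A B (ofHom K V₀ V₁ W₀ W₁ q) = ofComponents K V₀ V₁ W₀ W₁ (linearPart A B q) := by
  refine TensorProduct.ext' fun w x => ?_
  have e : conv₁ A B (ofHom K V₀ V₁ W₀ W₁ q) (w ⊗ₜ[K] x) =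
      B.br₁ (ofHom K V₀ V₁ W₀ W₁ q (w ⊗ₜ[K] x)) +
      convParity K V₀ V₁ W₀ W₁ (ofHom K V₀ V₁ W₀ W₁ q) (A.codiff (w ⊗ₜ[K] x)) := rfl
  rw [e, convParity_ofHom, ofHom_tmul, ofHom_apply, arity₁_codiff, corestriction_tmul,
    ofComponents_tmul, br₁_apply]
  simp [linearPart]

/-- An element of degree `-1` reads the parts of `D` of lengths one and two: `arity₁_codiff` gives
the first, `part₀_codiffWords` and `lift_map_codiffLast` the second. -/
theorem conv₁_ofComponents (p : Components K V₀ V₁ W₀ W₁) (w : Words K V₀ V₁) (x : V₀ × V₁) :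
    conv₁ A B (ofComponents K V₀ V₁ W₀ W₁ p) (w ⊗ₜ[K] x) =
      (B.l1 (coeff₀ w • p.2.1 x.2 + p.2.2 (part₀ w) x.1)
          - p.1 (coeff₀ w • A.l1 x.2 + A.l00 (part₀ w) x.1),
        -(p.2.1 (A.l01 (part₀ w) x.2 - A.l10 (part₁ w).2 x.1 +
            TensorProduct.lift A.l3 (part₀₀ w) x.1)
          + p.2.2 (A.l1 (part₁ w).2 + TensorProduct.lift A.l00 (part₀₀ w)) x.1
          - p.2.2 (part₀ w) (A.l1 x.2)
          - TensorProduct.lift (p.2.2.compl₂ (A.l00.flip x.1)) (part₀₀ w)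
          + TensorProduct.lift (p.2.2.flip.compl₁₂ (A.l00.flip x.1) LinearMap.id) (part₀₀ w))) := by
  have e : conv₁ A B (ofComponents K V₀ V₁ W₀ W₁ p) (w ⊗ₜ[K] x) =
      B.br₁ (ofComponents K V₀ V₁ W₀ W₁ p (w ⊗ₜ[K] x)) +
      convParity K V₀ V₁ W₀ W₁ (ofComponents K V₀ V₁ W₀ W₁ p) (A.codiff (w ⊗ₜ[K] x)) := rfl
  have e₂ : TensorProduct.map (LinearMap.fst K V₀ V₁) (LinearMap.fst K V₀ V₁)
      (arity₂ K V₀ V₁ (A.codiff (w ⊗ₜ[K] x))) = part₀ (A.codiffWords w) ⊗ₜ[K] x.1 +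
      TensorProduct.map part₀ (LinearMap.fst K V₀ V₁) (A.codiffLast (w ⊗ₜ[K] x)) := by
    rw [codiff_tmul, map_add, map_add, arity₂_tmul, TensorProduct.map_tmul, arity₂,
      LinearMap.rTensor, TensorProduct.map_map]
    rfl
  rw [e, convParity_ofComponents, LinearMap.neg_apply, ofComponents_tmul, ofComponents_apply,
    arity₁_codiff, corestriction_tmul, br₁_apply, e₂, map_add (TensorProduct.lift p.2.2),
    lift_map_codiffLast, TensorProduct.lift.tmul, part₀_codiffWords]
  ext
  · simp only [Prod.fst_add, Prod.neg_mk, sub_eq_add_neg]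
  · simp only [Prod.snd_add, Prod.neg_mk, zero_add, neg_inj]
    abel

theorem conv₂_tmul_odd {f g : Conv K V₀ V₁ W₀ W₁} (hf : convParity K V₀ V₁ W₀ W₁ f = -f)
    (hg : convParity K V₀ V₁ W₀ W₁ g = -g) :
    conv₂ B (f ⊗ₜ[K] g) = B.br₂ ∘ₗ (TensorProduct.map (f ∘ₗ zinParity K V₀ V₁) g +
      TensorProduct.map (g ∘ₗ zinParity K V₀ V₁) f) ∘ₗ zinComul K V₀ V₁ := by
  rw [conv₂_eq]
  exact congrArg (fun t => B.br₂ ∘ₗ t ∘ₗ zinComul K V₀ V₁)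
    (koszulHom_antisymm₂_odd _ _ hf hg)

theorem conv₂_tmul_odd_even {f g : Conv K V₀ V₁ W₀ W₁} (hf : convParity K V₀ V₁ W₀ W₁ f = -f)
    (hg : convParity K V₀ V₁ W₀ W₁ g = g) :
    conv₂ B (f ⊗ₜ[K] g) = B.br₂ ∘ₗ (TensorProduct.map f g -
      TensorProduct.map (g ∘ₗ zinParity K V₀ V₁) f) ∘ₗ zinComul K V₀ V₁ := by
  rw [conv₂_eq]
  exact congrArg (fun t => B.br₂ ∘ₗ t ∘ₗ zinComul K V₀ V₁)
    (koszulHom_antisymm₂_odd_even _ _ hf hg)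

theorem conv₂_tmul_comm {f g : Conv K V₀ V₁ W₀ W₁} (hf : convParity K V₀ V₁ W₀ W₁ f = -f)
    (hg : convParity K V₀ V₁ W₀ W₁ g = g) : conv₂ B (g ⊗ₜ[K] f) = -conv₂ B (f ⊗ₜ[K] g) := by
  have h : conv₂ B (g ⊗ₜ[K] f) = B.br₂ ∘ₗ (TensorProduct.map (g ∘ₗ zinParity K V₀ V₁) f -
      TensorProduct.map f g) ∘ₗ zinComul K V₀ V₁ := by
    rw [conv₂_eq]
    exact congrArg (fun t => B.br₂ ∘ₗ t ∘ₗ zinComul K V₀ V₁)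
      (koszulHom_antisymm₂_even_odd _ _ hf hg)
  rw [h, conv₂_tmul_odd_even B hf hg]
  refine LinearMap.ext fun z => ?_
  simp only [LinearMap.neg_apply, LinearMap.comp_apply, LinearMap.sub_apply, map_sub, neg_sub]

/-- Both maps take values in `W₁`, and `m₂` vanishes on `W₁ ⊗ W₁` for degree reasons. -/
theorem conv₂_ofHom_ofHom (q r : V₀ →ₗ[K] W₁) :
    conv₂ B (ofHom K V₀ V₁ W₀ W₁ q ⊗ₜ[K] ofHom K V₀ V₁ W₀ W₁ r) = 0 := by
  rw [conv₂_eq]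
  refine (congrArg (fun t => B.br₂ ∘ₗ t ∘ₗ zinComul K V₀ V₁)
    (koszulHom_antisymm₂_even _ _ (convParity_ofHom q) (convParity_ofHom r))).trans ?_
  have key : ∀ q r : V₀ →ₗ[K] W₁, B.br₂ ∘ₗ TensorProduct.map (ofHom K V₀ V₁ W₀ W₁ q)
      (ofHom K V₀ V₁ W₀ W₁ r) = 0 := by
    intro q r
    refine TensorProduct.ext' fun y z => ?_
    simp [br₂_tmul, ofHom_apply]
  rw [LinearMap.sub_comp, LinearMap.comp_sub, ← LinearMap.comp_assoc, ← LinearMap.comp_assoc, key,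
    key, sub_self]

/-- As `q` takes values in `W₁`, only the `W₀` component of `p` takes part, and that one lives on
single letters; the counit laws then leave one unshuffle per term. -/
theorem conv₂_ofComponents_ofHom (p : Components K V₀ V₁ W₀ W₁) (q : V₀ →ₗ[K] W₁) :
    conv₂ B (ofComponents K V₀ V₁ W₀ W₁ p ⊗ₜ[K] ofHom K V₀ V₁ W₀ W₁ q) =
      ofComponents K V₀ V₁ W₀ W₁ (mixedBracket B p q) := by
  rw [conv₂_tmul_odd_even _ (convParity_ofComponents p) (convParity_ofHom q), ofHom_zinParity]
  refine TensorProduct.ext' fun w x => ?_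
  have h₁ : LinearMap.fst K W₀ W₁ ∘ₗ ofComponents K V₀ V₁ W₀ W₁ p ∘ₗ
      (TensorProduct.mk K _ _).flip x = coeff₀.smulRight (p.1 x.1) := by
    refine LinearMap.ext fun v => ?_
    simp [ofComponents_tmul]
  have h₂ : LinearMap.snd K W₀ W₁ ∘ₗ ofHom K V₀ V₁ W₀ W₁ q ∘ₗ
      (TensorProduct.mk K _ _).flip x = coeff₀.smulRight (q x.1) := by
    refine LinearMap.ext fun v => ?_
    simp [ofHom_tmul]
  have h₃ : LinearMap.fst K W₀ W₁ ∘ₗ ofHom K V₀ V₁ W₀ W₁ q = 0 := by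
    refine LinearMap.ext fun v => ?_
    simp [ofHom_apply]
  have h₄ : LinearMap.fst K W₀ W₁ ∘ₗ ofComponents K V₀ V₁ W₀ W₁ p ∘ₗ split K V₀ V₁
      = p.1 ∘ₗ part₀ := by
    refine LinearMap.ext fun v => ?_
    simp only [LinearMap.comp_apply, ofComponents_split, LinearMap.fst_apply]
  have h₅ : LinearMap.snd K W₀ W₁ ∘ₗ ofHom K V₀ V₁ W₀ W₁ q ∘ₗ split K V₀ V₁
      = q ∘ₗ part₀ := by
    refine LinearMap.ext fun v => ?_
    simp only [LinearMap.comp_apply, ofHom_split, LinearMap.snd_apply]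
  rw [LinearMap.comp_apply, LinearMap.comp_apply, zinComul_tmul, LinearMap.sub_apply,
    map_neg_left_apply, sub_neg_eq_add, map_add, TensorProduct.map_map, TensorProduct.map_map,
    br₂_apply, br₂_apply]
  simp only [TensorProduct.map_map]
  have h₃' : ∀ {M : Type _} [AddCommGroup M] [Module K M] (u : M →ₗ[K] Zin K V₀ V₁),
      LinearMap.fst K W₀ W₁ ∘ₗ ofHom K V₀ V₁ W₀ W₁ q ∘ₗ u = 0 := by
    intro M _ _ u
    rw [← LinearMap.comp_assoc, h₃, LinearMap.zero_comp]
  rw [h₃', h₃', h₁, h₂, h₄, h₅]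
  simp only [TensorProduct.map_zero_right, TensorProduct.map_zero_left, LinearMap.zero_apply,
    map_zero, map_coeff₀_unshuffle, TensorProduct.lift.tmul, ofComponents_tmul]
  simp [mixedBracket]

end Brackets
end Components

/-! ### Infinity morphisms are Maurer-Cartan elements of `L`. -/

section MaurerCartanMorphism

variable {K V₀ V₁ W₀ W₁ : Type*} [Field K] [CharZero K]
  [AddCommGroup V₀] [Module K V₀] [AddCommGroup V₁] [Module K V₁]
  [AddCommGroup W₀] [Module K W₀] [AddCommGroup W₁] [Module K W₁]

/-- The factor `2` comes from antisymmetrizing two equal odd elements and cancels the `1/2!`. The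
two `l01` terms on pairs come from the two unshuffles of a pair. -/
theorem conv₂_ofComponents_self (B : TwoTermLeibniz K W₀ W₁) (p : Components K V₀ V₁ W₀ W₁)
    (w : Words K V₀ V₁) (x : V₀ × V₁) :
    conv₂ B (ofComponents K V₀ V₁ W₀ W₁ p ⊗ₜ[K] ofComponents K V₀ V₁ W₀ W₁ p) (w ⊗ₜ[K] x) =
      (2 : K) • (-B.l00 (p.1 (part₀ w)) (p.1 x.1),
        -B.l01 (p.1 (part₀ w)) (p.2.1 x.2)
        - TensorProduct.lift (B.l01.compl₁₂ p.1 (p.2.2.flip x.1)) (part₀₀ w)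
        + TensorProduct.lift ((B.l01.compl₁₂ p.1 (p.2.2.flip x.1)).flip) (part₀₀ w)
        + B.l10 (p.2.1 (part₁ w).2 + TensorProduct.lift p.2.2 (part₀₀ w)) (p.1 x.1)) := by
  rw [conv₂_tmul_odd _ (convParity_ofComponents p) (convParity_ofComponents p),
    ofComponents_zinParity, ← two_smul K, LinearMap.smul_comp, LinearMap.comp_smul,
    LinearMap.smul_apply, LinearMap.comp_apply, LinearMap.comp_apply, zinComul_tmul,
    map_neg_left_apply, map_neg, TensorProduct.map_map, br₂_apply]
  congr 1
  have h₁ : LinearMap.fst K W₀ W₁ ∘ₗ ofComponents K V₀ V₁ W₀ W₁ p ∘ₗ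
      (TensorProduct.mk K _ _).flip x = coeff₀.smulRight (p.1 x.1) := by
    refine LinearMap.ext fun v => ?_
    simp [ofComponents_tmul]
  have h₂ : LinearMap.snd K W₀ W₁ ∘ₗ ofComponents K V₀ V₁ W₀ W₁ p ∘ₗ
      (TensorProduct.mk K _ _).flip x =
        coeff₀.smulRight (p.2.1 x.2) + p.2.2.flip x.1 ∘ₗ part₀ := by
    refine LinearMap.ext fun v => ?_
    simp [ofComponents_tmul]
  have h₃ : LinearMap.fst K W₀ W₁ ∘ₗ (parity K W₀ W₁ ∘ₗ ofComponents K V₀ V₁ W₀ W₁ p) ∘ₗ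
      split K V₀ V₁ = p.1 ∘ₗ part₀ := by
    refine LinearMap.ext fun v => ?_
    simp only [LinearMap.comp_apply, ofComponents_split, parity_apply, LinearMap.fst_apply]
  have h₄ : LinearMap.snd K W₀ W₁ ∘ₗ (parity K W₀ W₁ ∘ₗ ofComponents K V₀ V₁ W₀ W₁ p) ∘ₗ
      split K V₀ V₁ = -(p.2.1 ∘ₗ LinearMap.snd K V₀ V₁ ∘ₗ part₁ +
        TensorProduct.lift p.2.2 ∘ₗ part₀₀) := by
    refine LinearMap.ext fun v => ?_
    simp only [LinearMap.comp_apply, ofComponents_split, parity_apply, LinearMap.snd_apply,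
      LinearMap.neg_apply, LinearMap.add_apply]
  have h₅ : TensorProduct.lift B.l01 (TensorProduct.map (p.1 ∘ₗ part₀ (K := K) (V₁ := V₁))
      (p.2.2.flip x.1 ∘ₗ part₀) (unshuffle K V₀ V₁ w)) =
      TensorProduct.lift (B.l01.compl₁₂ p.1 (p.2.2.flip x.1)) (part₀₀ w)
        - TensorProduct.lift ((B.l01.compl₁₂ p.1 (p.2.2.flip x.1)).flip) (part₀₀ w) := by
    rw [TensorProduct.map_comp, LinearMap.comp_apply, part₀_map_unshuffle]
    generalize part₀₀ w = u
    induction u using TensorProduct.induction_on with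
    | zero => simp only [map_zero, sub_zero]
    | tmul y z => simp
    | add u v hu hv =>
      simp only [map_add, map_sub] at hu hv ⊢
      rw [← sub_add_sub_comm, ← sub_add_sub_comm, ← hu, ← hv]
  simp only [TensorProduct.map_map, h₁, h₂, h₃, h₄, map_coeff₀_unshuffle, map_neg_left_apply,
    TensorProduct.map_add_right, LinearMap.add_apply, map_add, h₅, TensorProduct.lift.tmul, map_neg,
    LinearMap.comp_apply, LinearMap.snd_apply]
  ext
  · simp
  · simp
    abel

/-- `m₃` reads only `W₀` components, and these live on single letters, so just one iterated
splitting of a three-letter word survives. The minus sign is the parity twist on the middle letter;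
the two twists on the first one cancel. -/
theorem conv₃_ofComponents_self (B : TwoTermLeibniz K W₀ W₁) (p : Components K V₀ V₁ W₀ W₁)
    (w : Words K V₀ V₁) (x : V₀ × V₁) :
    conv₃ B ((ofComponents K V₀ V₁ W₀ W₁ p ⊗ₜ[K] ofComponents K V₀ V₁ W₀ W₁ p) ⊗ₜ[K]
      ofComponents K V₀ V₁ W₀ W₁ p) (w ⊗ₜ[K] x) =
      (6 : K) • (0, -TensorProduct.lift (B.l3.compl₁₂ p.1 p.1) (part₀₀ w) (p.1 x.1)) := by
  set f := ofComponents K V₀ V₁ W₀ W₁ p with hf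
  have e : conv₃ B ((f ⊗ₜ[K] f) ⊗ₜ[K] f) = B.br₃ ∘ₗ ((6 : K) • TensorProduct.map
      (TensorProduct.map (f ∘ₗ zinParity K V₀ V₁ ∘ₗ zinParity K V₀ V₁) (f ∘ₗ zinParity K V₀ V₁)) f)
      ∘ₗ LinearMap.rTensor _ (zinComul K V₀ V₁) ∘ₗ zinComul K V₀ V₁ := by
    rw [conv₃_eq]
    exact congrArg (fun t => B.br₃ ∘ₗ t ∘ₗ LinearMap.rTensor _ (zinComul K V₀ V₁) ∘ₗ
      zinComul K V₀ V₁) (koszulHom_antisymm₃_odd (zinParity K V₀ V₁) (parity K W₀ W₁)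
        (convParity_ofComponents p))
  have h₀ : ∀ u, (f u).1 = p.1 (arity₁ K V₀ V₁ u).1 := fun u => by rw [hf, ofComponents_apply]
  have h₁ : LinearMap.fst K W₀ W₁ ∘ₗ f ∘ₗ zinParity K V₀ V₁ = -(LinearMap.fst K W₀ W₁ ∘ₗ f) := by
    rw [hf, ofComponents_zinParity]
    refine LinearMap.ext fun v => ?_
    simp [parity_apply]
  have h₂ : LinearMap.fst K W₀ W₁ ∘ₗ f ∘ₗ zinParity K V₀ V₁ ∘ₗ zinParity K V₀ V₁
      = LinearMap.fst K W₀ W₁ ∘ₗ f := by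
    refine (congrArg (fun t => t ∘ₗ zinParity K V₀ V₁) h₁).trans ?_
    rw [LinearMap.neg_comp, LinearMap.comp_assoc, h₁, neg_neg]
  have h₃ : LinearMap.fst K W₀ W₁ ∘ₗ f ∘ₗ (TensorProduct.mk K _ _).flip x
      = coeff₀.smulRight (p.1 x.1) := by
    refine LinearMap.ext fun v => ?_
    simp [hf, ofComponents_tmul]
  have h₄ : ∀ u, TensorProduct.map (LinearMap.fst K W₀ W₁ ∘ₗ f) (LinearMap.fst K W₀ W₁ ∘ₗ f)
      (zinComul K V₀ V₁ u) = TensorProduct.map p.1 p.1 (TensorProduct.map (LinearMap.fst K V₀ V₁)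
        (LinearMap.fst K V₀ V₁) (arity₂ K V₀ V₁ u)) := by
    intro u
    induction u using TensorProduct.induction_on with
    | zero => simp only [map_zero]
    | add u v hu hv => simp only [map_add, hu, hv]
    | tmul v y =>
      have h : (LinearMap.fst K W₀ W₁ ∘ₗ f) ∘ₗ (TensorProduct.mk K _ _).flip y
          = coeff₀.smulRight (p.1 y.1) := by
        refine LinearMap.ext fun v => ?_
        simp [hf, ofComponents_tmul]
      rw [zinComul_tmul, TensorProduct.map_map, h, map_coeff₀_unshuffle, arity₂_tmul]
      simp only [LinearMap.comp_apply, LinearMap.fst_apply, h₀, TensorProduct.map_tmul]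
  have h₅ : ∀ u, B.br₃ u = (0, TensorProduct.lift (TensorProduct.lift B.l3) (TensorProduct.map
      (TensorProduct.map (LinearMap.fst K W₀ W₁) (LinearMap.fst K W₀ W₁)) (LinearMap.fst K W₀ W₁)
        u)) := fun u => rfl
  have h₆ : ∀ u : Zin K V₀ V₁ ⊗[K] Zin K V₀ V₁,
      TensorProduct.map (LinearMap.fst K W₀ W₁) (LinearMap.fst K W₀ W₁)
        (TensorProduct.map (f ∘ₗ zinParity K V₀ V₁ ∘ₗ zinParity K V₀ V₁) (f ∘ₗ zinParity K V₀ V₁) u)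
      = -TensorProduct.map (LinearMap.fst K W₀ W₁ ∘ₗ f) (LinearMap.fst K W₀ W₁ ∘ₗ f) u := by
    intro u
    rw [TensorProduct.map_map, h₂, h₁, map_neg_right_apply]
  have h₇ : ∀ u : V₀ ⊗[K] V₀, TensorProduct.lift B.l3 (TensorProduct.map p.1 p.1 u) =
      TensorProduct.lift (B.l3.compl₁₂ p.1 p.1) u := by
    intro u
    induction u using TensorProduct.induction_on with
    | zero => simp only [map_zero]
    | tmul y z => simp
    | add u v hu hv => simp only [map_add, hu, hv]
  rw [e, LinearMap.smul_comp, LinearMap.comp_smul, LinearMap.smul_apply, LinearMap.comp_apply,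
    LinearMap.comp_apply, LinearMap.comp_apply, zinComul_tmul, LinearMap.rTensor,
    TensorProduct.map_map, TensorProduct.map_map, h₅, TensorProduct.map_map]
  rw [LinearMap.comp_id, h₃, map_coeff₀_unshuffle, TensorProduct.lift.tmul]
  simp only [LinearMap.comp_apply]
  rw [h₆, h₄, map_neg, h₇]
  rfl

/-- In `W₀` the equation is `comm_l1` and `comm_l00`; in `W₁` it splits, by the length of the prefix
and the type of the letters, into `comm_l1`-free parts given by `comm_l01`, `comm_l10` and
`comm_l3`. -/
theorem InftyMorphism.toConv_maurerCartan {A : TwoTermLeibniz K V₀ V₁} {B : TwoTermLeibniz K W₀ W₁}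
    (f : InftyMorphism A B) :
    conv₁ A B f.toConv - (2⁻¹ : K) • conv₂ B (f.toConv ⊗ₜ[K] f.toConv)
      - (6⁻¹ : K) • conv₃ B ((f.toConv ⊗ₜ[K] f.toConv) ⊗ₜ[K] f.toConv) = 0 := by
  have e : f.toConv = ofComponents K V₀ V₁ W₀ W₁ (f.f0, f.f1, f.f2) := rfl
  refine TensorProduct.ext' fun w x => ?_
  rw [e, LinearMap.sub_apply, LinearMap.sub_apply, LinearMap.smul_apply, LinearMap.smul_apply,
    conv₁_ofComponents, conv₂_ofComponents_self, conv₃_ofComponents_self,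
    inv_smul_smul₀ two_ne_zero, inv_smul_smul₀ (by norm_num : (6 : K) ≠ 0), LinearMap.zero_apply]
  dsimp only
  ext
  · simp only [Prod.fst_sub, map_add, map_smul, f.comm_l1, Prod.fst_zero, ← f.comm_l00]
    abel
  -- This is `comm_l3`, extended linearly from pure tensors to the two-letter part of the prefix.
  · have key : ∀ u : V₀ ⊗[K] V₀, TensorProduct.lift (B.l3.compl₁₂ f.f0 f.f0) u (f.f0 x.1)
        - B.l10 (TensorProduct.lift f.f2 u) (f.f0 x.1)
        + TensorProduct.lift (B.l01.compl₁₂ f.f0 (f.f2.flip x.1)) u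
        - TensorProduct.lift ((B.l01.compl₁₂ f.f0 (f.f2.flip x.1)).flip) u
        = f.f1 (TensorProduct.lift A.l3 u x.1) + f.f2 (TensorProduct.lift A.l00 u) x.1
          - TensorProduct.lift (f.f2.compl₂ (A.l00.flip x.1)) u
          + TensorProduct.lift (f.f2.flip.compl₁₂ (A.l00.flip x.1) LinearMap.id) u := by
      intro u
      induction u using TensorProduct.induction_on with
      | zero => simp
      | tmul y z => simpa using f.comm_l3 y z x.1
      | add u v hu hv =>
        have := congrArg₂ (· + ·) hu hv
        simp only [map_add, LinearMap.add_apply] at this ⊢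
        refine Eq.trans ?_ (this.trans ?_) <;> abel
    have k := key (part₀₀ w)
    have k₁ := f.comm_l01 (part₀ w) x.2
    have k₂ := f.comm_l10 (part₁ w).2 x.1
    have e₁ := sub_eq_zero.mpr k
    have e₂ := sub_eq_zero.mpr k₁
    have e₃ := sub_eq_zero.mpr k₂
    simp only [Prod.snd_sub, map_add, map_sub, LinearMap.add_apply, Prod.snd_zero]
    -- The relation `comm_l10` enters with a minus sign, because `D₂` carries the sign of its first
    -- argument.
    refine Eq.trans ?_ (congrArg₂ (· - ·) (congrArg₂ (· + ·) e₁ e₂) e₃ |>.trans (by simp))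
    abel

end MaurerCartanMorphism

/-! ### Koszul signs commute with maps that respect parity. -/

section Naturality

variable {K A B C D A' B' C' D' : Type*} [Field K]
  [AddCommGroup A] [Module K A] [AddCommGroup B] [Module K B]
  [AddCommGroup C] [Module K C] [AddCommGroup D] [Module K D]
  [AddCommGroup A'] [Module K A'] [AddCommGroup B'] [Module K B']
  [AddCommGroup C'] [Module K C'] [AddCommGroup D'] [Module K D']

theorem koszulSign_map {p : A →ₗ[K] A} {q : B →ₗ[K] B} {p' : A' →ₗ[K] A'} {q' : B' →ₗ[K] B'}
    {a : A →ₗ[K] A'} {b : B →ₗ[K] B'} (ha : p' ∘ₗ a = a ∘ₗ p) (hb : q' ∘ₗ b = b ∘ₗ q)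
    (t : A ⊗[K] B) :
    koszulSign p' q' (TensorProduct.map a b t) = TensorProduct.map a b (koszulSign p q t) := by
  simp only [koszulSign, LinearMap.smul_apply, LinearMap.sub_apply, LinearMap.add_apply,
    LinearMap.id_apply, map_smul, map_sub, map_add, TensorProduct.map_map, ha, hb,
    LinearMap.id_comp, LinearMap.comp_id]

theorem braid_map {p : A →ₗ[K] A} {q : B →ₗ[K] B} {p' : A' →ₗ[K] A'} {q' : B' →ₗ[K] B'}
    {a : A →ₗ[K] A'} {b : B →ₗ[K] B'} (ha : p' ∘ₗ a = a ∘ₗ p) (hb : q' ∘ₗ b = b ∘ₗ q)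
    (t : A ⊗[K] B) :
    braid p' q' (TensorProduct.map a b t) = TensorProduct.map b a (braid p q t) := by
  rw [braid, LinearMap.comp_apply, koszulSign_map ha hb, braid, LinearMap.comp_apply]
  exact (TensorProduct.map_comm b a _).symm

theorem middleBraid_map {q : B →ₗ[K] B} {r : C →ₗ[K] C} {q' : B' →ₗ[K] B'} {r' : C' →ₗ[K] C'}
    (a : A →ₗ[K] A') {b : B →ₗ[K] B'} {c : C →ₗ[K] C'} (d : D →ₗ[K] D')
    (hb : q' ∘ₗ b = b ∘ₗ q) (hc : r' ∘ₗ c = c ∘ₗ r) (t : (A ⊗[K] B) ⊗[K] (C ⊗[K] D)) :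
    middleBraid q' r' (TensorProduct.map (TensorProduct.map a b) (TensorProduct.map c d) t) =
      TensorProduct.map (TensorProduct.map a c) (TensorProduct.map b d) (middleBraid q r t) := by
  have h₁ : TensorProduct.map LinearMap.id q' ∘ₗ TensorProduct.map a b =
      TensorProduct.map a b ∘ₗ TensorProduct.map LinearMap.id q := by
    rw [← TensorProduct.map_comp, ← TensorProduct.map_comp, hb]; rfl
  have h₂ : TensorProduct.map r' LinearMap.id ∘ₗ TensorProduct.map c d =
      TensorProduct.map c d ∘ₗ TensorProduct.map r LinearMap.id := by
    rw [← TensorProduct.map_comp, ← TensorProduct.map_comp, hc]; rfl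
  rw [middleBraid, LinearMap.comp_apply, koszulSign_map h₁ h₂, middleBraid, LinearMap.comp_apply]
  generalize koszulSign (TensorProduct.map LinearMap.id q) (TensorProduct.map r LinearMap.id) t = u
  have key : (TensorProduct.tensorTensorTensorComm K A' B' C' D').toLinearMap ∘ₗ
      TensorProduct.map (TensorProduct.map a b) (TensorProduct.map c d) =
      TensorProduct.map (TensorProduct.map a c) (TensorProduct.map b d) ∘ₗ
        (TensorProduct.tensorTensorTensorComm K A B C D).toLinearMap := by
    ext; simp
  exact LinearMap.congr_fun key u

theorem antisymm₃_map {p : A →ₗ[K] A} {p' : A' →ₗ[K] A'} {e : A →ₗ[K] A'} (he : p' ∘ₗ e = e ∘ₗ p)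
    (t : (A ⊗[K] A) ⊗[K] A) :
    antisymm₃ p' (TensorProduct.map (TensorProduct.map e e) e t) =
      TensorProduct.map (TensorProduct.map e e) e (antisymm₃ p t) := by
  have hb : braid p' p' ∘ₗ TensorProduct.map e e = TensorProduct.map e e ∘ₗ braid p p :=
    LinearMap.ext fun u => braid_map he he u
  have h₁ : ∀ t, LinearMap.rTensor A' (braid p' p')
      (TensorProduct.map (TensorProduct.map e e) e t) =
      TensorProduct.map (TensorProduct.map e e) e (LinearMap.rTensor A (braid p p) t) := by
    intro t
    rw [LinearMap.rTensor, LinearMap.rTensor, TensorProduct.map_map, TensorProduct.map_map, hb]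
    rfl
  have h₂ : ∀ t, LinearMap.lTensor A' (braid p' p')
      (TensorProduct.map e (TensorProduct.map e e) t) =
      TensorProduct.map e (TensorProduct.map e e) (LinearMap.lTensor A (braid p p) t) := by
    intro t
    rw [LinearMap.lTensor, LinearMap.lTensor, TensorProduct.map_map, TensorProduct.map_map, hb]
    rfl
  have h₃ : ∀ t, TensorProduct.assoc K A' A' A' (TensorProduct.map (TensorProduct.map e e) e t) =
      TensorProduct.map e (TensorProduct.map e e) (TensorProduct.assoc K A A A t) := fun t =>
    (LinearMap.congr_fun (TensorProduct.map_map_comp_assoc_eq e e e) t).symm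
  have h₄ : ∀ t, (TensorProduct.assoc K A' A' A').symm
      (TensorProduct.map e (TensorProduct.map e e) t) =
      TensorProduct.map (TensorProduct.map e e) e ((TensorProduct.assoc K A A A).symm t) := by
    intro t
    rw [LinearEquiv.symm_apply_eq, h₃, LinearEquiv.apply_symm_apply]
  simp only [antisymm₃, LinearMap.sub_apply, LinearMap.add_apply, LinearMap.id_apply,
    LinearMap.comp_apply, LinearEquiv.coe_coe, h₁, h₂, h₃, h₄, map_sub, map_add]

theorem koszulHom_map {pA : A →ₗ[K] A} {pB : B →ₗ[K] B} {pD : D →ₗ[K] D} {pD' : D' →ₗ[K] D'}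
    (c : C →ₗ[K] C') {d : D →ₗ[K] D'} (hd : pD' ∘ₗ d = d ∘ₗ pD)
    (t : (A →ₗ[K] C) ⊗[K] (B →ₗ[K] D)) :
    koszulHom pA pB pD' (TensorProduct.map (LinearMap.llcomp K A C C' c)
      (LinearMap.llcomp K B D D' d) t) = TensorProduct.map c d ∘ₗ koszulHom pA pB pD t := by
  have h₁ : LinearMap.lcomp K C' pA ∘ₗ LinearMap.llcomp K A C C' c =
      LinearMap.llcomp K A C C' c ∘ₗ LinearMap.lcomp K C pA := rfl
  have h₂ : homParity pB pD' ∘ₗ LinearMap.llcomp K B D D' d =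
      LinearMap.llcomp K B D D' d ∘ₗ homParity pB pD := by
    refine LinearMap.ext fun f => LinearMap.ext fun x => ?_
    exact LinearMap.congr_fun hd (f (pB x))
  rw [koszulHom, LinearMap.comp_apply, koszulSign_map h₁ h₂, koszulHom, LinearMap.comp_apply]
  generalize koszulSign (LinearMap.lcomp K C pA) (homParity pB pD) t = u
  induction u using TensorProduct.induction_on with
  | zero => simp only [map_zero, LinearMap.comp_zero]
  | add u v hu hv => simp only [map_add, hu, hv, LinearMap.comp_add]
  | tmul f g => exact TensorProduct.map_comp c d f g

/-- Applied below with the projection of `W` onto `W₀` as `e`: projecting the three factors first is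
the same as projecting the antisymmetrized tensor product of maps. -/
theorem koszulHom_antisymm₃_map {Z W : Type*} [AddCommGroup Z] [Module K Z] [AddCommGroup W]
    [Module K W] (pZ : Z →ₗ[K] Z) {pW : W →ₗ[K] W} {e : W →ₗ[K] W} (he : pW ∘ₗ e = e ∘ₗ pW)
    (t : ((Z →ₗ[K] W) ⊗[K] (Z →ₗ[K] W)) ⊗[K] (Z →ₗ[K] W)) :
    koszulHom (A := Z ⊗[K] Z) (C := W ⊗[K] W) (TensorProduct.map pZ pZ) pZ pW
      (LinearMap.rTensor _ (koszulHom pZ pZ pW)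
        (antisymm₃ (homParity pZ pW) (TensorProduct.map (TensorProduct.map
          (LinearMap.llcomp K Z W W e) (LinearMap.llcomp K Z W W e))
            (LinearMap.llcomp K Z W W e) t))) =
    TensorProduct.map (TensorProduct.map e e) e ∘ₗ
    koszulHom (A := Z ⊗[K] Z) (C := W ⊗[K] W) (TensorProduct.map pZ pZ) pZ pW
      (LinearMap.rTensor _ (koszulHom pZ pZ pW) (antisymm₃ (homParity pZ pW) t)) := by
  have h₁ : homParity pZ pW ∘ₗ LinearMap.llcomp K Z W W e =
      LinearMap.llcomp K Z W W e ∘ₗ homParity pZ pW := by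
    refine LinearMap.ext fun f => LinearMap.ext fun x => ?_
    exact LinearMap.congr_fun he (f (pZ x))
  have h₂ : koszulHom pZ pZ pW ∘ₗ TensorProduct.map (LinearMap.llcomp K Z W W e)
      (LinearMap.llcomp K Z W W e) = LinearMap.llcomp K (Z ⊗[K] Z) (W ⊗[K] W) (W ⊗[K] W)
        (TensorProduct.map e e) ∘ₗ koszulHom pZ pZ pW := by
    refine LinearMap.ext fun u => ?_
    rw [LinearMap.comp_apply, koszulHom_map e he]
    rfl
  rw [antisymm₃_map h₁, ← koszulHom_map (TensorProduct.map e e) he, LinearMap.rTensor,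
    TensorProduct.map_map, h₂, TensorProduct.map_map]
  rfl

end Naturality

/-! ### Truncation of values to `W₀`. -/

section Truncation

variable {K V₀ V₁ W₀ W₁ : Type*} [Field K]
  [AddCommGroup V₀] [Module K V₀] [AddCommGroup V₁] [Module K V₁]
  [AddCommGroup W₀] [Module K W₀] [AddCommGroup W₁] [Module K W₁]

variable (K V₀ V₁ W₀ W₁) in
/-- The composition with the projection of `W` onto `W₀`. -/
def truncate : Conv K V₀ V₁ W₀ W₁ →ₗ[K] Conv K V₀ V₁ W₀ W₁ :=
  LinearMap.llcomp K (Zin K V₀ V₁) (W₀ × W₁) (W₀ × W₁)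
    (LinearMap.inl K W₀ W₁ ∘ₗ LinearMap.fst K W₀ W₁)

theorem parity_comp_inl_fst : parity K W₀ W₁ ∘ₗ (LinearMap.inl K W₀ W₁ ∘ₗ LinearMap.fst K W₀ W₁) =
    (LinearMap.inl K W₀ W₁ ∘ₗ LinearMap.fst K W₀ W₁) ∘ₗ parity K W₀ W₁ := by
  refine LinearMap.ext fun x => ?_
  simp [parity_apply]

theorem convParity_comp_truncate :
    convParity K V₀ V₁ W₀ W₁ ∘ₗ truncate K V₀ V₁ W₀ W₁ =
      truncate K V₀ V₁ W₀ W₁ ∘ₗ convParity K V₀ V₁ W₀ W₁ :=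
  LinearMap.ext fun f => LinearMap.ext fun z =>
    LinearMap.congr_fun parity_comp_inl_fst (f (zinParity K V₀ V₁ z))

theorem truncate_ofHom (q : V₀ →ₗ[K] W₁) :
    truncate K V₀ V₁ W₀ W₁ (ofHom K V₀ V₁ W₀ W₁ q) = 0 := by
  refine LinearMap.ext fun z => ?_
  simp [truncate, ofHom_apply]

/-- `m₃` depends only on the `W₀` components of its arguments, so `W₁` components may be dropped.
This removes the one-form parts from the cubic bracket. -/
theorem conv₃_truncate (B : TwoTermLeibniz K W₀ W₁)
    (t : (Conv K V₀ V₁ W₀ W₁ ⊗[K] Conv K V₀ V₁ W₀ W₁) ⊗[K] Conv K V₀ V₁ W₀ W₁) :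
    conv₃ B (TensorProduct.map (TensorProduct.map (truncate K V₀ V₁ W₀ W₁)
      (truncate K V₀ V₁ W₀ W₁)) (truncate K V₀ V₁ W₀ W₁) t) = conv₃ B t := by
  have h : ∀ u, B.br₃ (TensorProduct.map (TensorProduct.map
      (LinearMap.inl K W₀ W₁ ∘ₗ LinearMap.fst K W₀ W₁)
      (LinearMap.inl K W₀ W₁ ∘ₗ LinearMap.fst K W₀ W₁))
      (LinearMap.inl K W₀ W₁ ∘ₗ LinearMap.fst K W₀ W₁) u) = B.br₃ u := by
    intro u
    simp only [TwoTermLeibniz.br₃, LinearMap.comp_apply, TensorProduct.map_map,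
      ← TensorProduct.map_comp]
    rfl
  rw [conv₃_eq, conv₃_eq]
  refine LinearMap.ext fun z => ?_
  refine Eq.trans ?_ (h _)
  exact congrArg B.br₃ (LinearMap.congr_fun (koszulHom_antisymm₃_map (zinParity K V₀ V₁)
    parity_comp_inl_fst t) _)

end Truncation

/-! ### Polynomials with vector coefficients, and commuting derivatives. -/

section Polynomials

variable {K : Type*} [Field K] {σ : Type*}

/-- In a basis of `M` this is the fact that a polynomial over an infinite field is determined by its
values. It allows identities between families to be checked point by point. -/
theorem eq_zero_of_forall_aeval [CharZero K] {M : Type*} [AddCommGroup M] [Module K M]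
    (x : M ⊗[K] MvPolynomial σ K)
    (h : ∀ t : σ → K, LinearMap.lTensor M (MvPolynomial.aeval t).toLinearMap x = 0) : x = 0 := by
  classical
  have : Infinite K := CharZero.infinite K
  let b := Module.Basis.ofVectorSpace K M
  apply (TensorProduct.equivFinsuppOfBasisLeft b).injective
  rw [map_zero]
  ext1 i
  apply MvPolynomial.funext
  intro t
  have key : ∀ x : M ⊗[K] MvPolynomial σ K,
      MvPolynomial.eval t (TensorProduct.equivFinsuppOfBasisLeft b x i) =
      TensorProduct.lid K K (LinearMap.rTensor K (b.coord i)
        (LinearMap.lTensor M (MvPolynomial.aeval t).toLinearMap x)) := by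
    intro x
    induction x using TensorProduct.induction_on with
    | zero => simp
    | tmul m p => simp [MvPolynomial.smul_eval, MvPolynomial.aeval_eq_eval]
    | add x y hx hy => simp only [map_add, Finsupp.add_apply, hx, hy]
  rw [key, h]
  simp

/-- The commutator of two derivations is a derivation, and this one vanishes on the variables. -/
theorem pderiv_comm [DecidableEq σ] (i j : σ) (p : MvPolynomial σ K) :
    MvPolynomial.pderiv i (MvPolynomial.pderiv j p) =
      MvPolynomial.pderiv j (MvPolynomial.pderiv i p) := by
  have h : ⁅(MvPolynomial.pderiv i : Derivation K (MvPolynomial σ K) (MvPolynomial σ K)),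
      (MvPolynomial.pderiv j : Derivation K (MvPolynomial σ K) (MvPolynomial σ K))⁆ = 0 := by
    refine MvPolynomial.derivation_ext fun k => ?_
    rw [Derivation.commutator_apply, MvPolynomial.pderiv_X, MvPolynomial.pderiv_X]
    simp [Pi.single_apply, apply_ite]
  have := DFunLike.congr_fun h p
  rw [Derivation.commutator_apply] at this
  exact sub_eq_zero.mp this

end Polynomials

/-! ### Functions, their differentials, and pullbacks. -/

section PolynomialForms

variable {K : Type*} [Field K] {σ : Type} [Fintype σ]

variable (K σ) in
/-- Polynomials, viewed as forms of degree `0`. -/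
def fn : MvPolynomial σ K →ₗ[K] Forms K σ := (TensorProduct.mk K _ _).flip 1

theorem fn_apply (p : MvPolynomial σ K) : fn K σ p = p ⊗ₜ[K] 1 := rfl

theorem fn_mul (p q : MvPolynomial σ K) : fn K σ (p * q) = fn K σ p * fn K σ q := by
  simp [fn_apply]

theorem fn_one : fn K σ 1 = 1 := rfl

theorem formsParity_fn (p : MvPolynomial σ K) : formsParity K σ (fn K σ p) = fn K σ p := by
  simp [formsParity, fn_apply]

variable (K) in
/-- The evaluation of forms at a point. -/
def evalPoint (t : σ → K) : Forms K σ →ₗ[K] K :=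
  (TensorProduct.lid K K).toLinearMap ∘ₗ
    TensorProduct.map (MvPolynomial.aeval t).toLinearMap
      (ExteriorAlgebra.algebraMapInv (R := K) (M := σ → K)).toLinearMap

theorem evalPoint_fn (t : σ → K) (p : MvPolynomial σ K) :
    evalPoint K t (fn K σ p) = MvPolynomial.aeval t p := by
  simp [evalPoint, fn_apply]

theorem fn_mem_formsDeg (p : MvPolynomial σ K) : fn K σ p ∈ formsDeg K σ 0 :=
  ⟨p ⊗ₜ[K] ⟨1, by simp⟩, rfl⟩

theorem exists_fn_of_mem_formsDeg {ω : Forms K σ} (h : ω ∈ formsDeg K σ 0) :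
    ∃ p, fn K σ p = ω := by
  obtain ⟨u, rfl⟩ := h
  induction u using TensorProduct.induction_on with
  | zero => exact ⟨0, by simp⟩
  | add u v hu hv =>
    obtain ⟨p, hp⟩ := hu
    obtain ⟨q, hq⟩ := hv
    exact ⟨p + q, by rw [map_add, map_add, hp, hq]⟩
  | tmul p η =>
    obtain ⟨η, hη⟩ := η
    have hη' : η ∈ (1 : Submodule K (ExteriorAlgebra K (σ → K))) := by
      simpa using hη
    obtain ⟨c, rfl⟩ := Submodule.mem_one.mp hη'
    refine ⟨c • p, ?_⟩
    rw [LinearMap.lTensor_tmul, fn_apply, TensorProduct.smul_tmul, ← Algebra.algebraMap_eq_smul_one]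
    rfl

variable [DecidableEq σ]

variable (K σ) in
/-- The differential of polynomials. -/
def dfn : MvPolynomial σ K →ₗ[K] Forms K σ := deRham K σ ∘ₗ fn K σ

theorem dfn_eq (p : MvPolynomial σ K) : dfn K σ p =
    ∑ i, MvPolynomial.pderiv i p ⊗ₜ[K] ExteriorAlgebra.ι K (Pi.single i 1 : σ → K) :=
  dPoly_eq p

theorem deRham_fn (p : MvPolynomial σ K) : deRham K σ (fn K σ p) = dfn K σ p := rfl

theorem dfn_mul (p q : MvPolynomial σ K) :
    dfn K σ (p * q) = fn K σ p * dfn K σ q + fn K σ q * dfn K σ p := by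
  simp only [dfn_eq, fn_apply, Finset.mul_sum, ← Finset.sum_add_distrib]
  refine Finset.sum_congr rfl fun i _ => ?_
  rw [Derivation.leibniz, Algebra.TensorProduct.tmul_mul_tmul, Algebra.TensorProduct.tmul_mul_tmul,
    one_mul, TensorProduct.add_tmul]
  rfl

theorem dfn_C (a : K) : dfn K σ (MvPolynomial.C a) = 0 := by
  simp [dfn_eq]

theorem dfn_one : dfn K σ 1 = 0 := by
  rw [← MvPolynomial.C_1, dfn_C]

theorem dfn_X (i : σ) : dfn K σ (MvPolynomial.X i) =
    1 ⊗ₜ[K] ExteriorAlgebra.ι K (Pi.single i 1 : σ → K) := by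
  rw [dfn_eq, Finset.sum_eq_single i]
  · simp
  · intro j _ hj
    rw [MvPolynomial.pderiv_X_of_ne hj.symm, TensorProduct.zero_tmul]
  · simp

/-- Second derivatives are symmetric and `dtᵢ dtⱼ` is antisymmetric. Exchanging the summations in
one of two copies shows that twice the sum vanishes. -/
theorem deRham_dfn [CharZero K] (p : MvPolynomial σ K) : deRham K σ (dfn K σ p) = 0 := by
  have e : deRham K σ (dfn K σ p) = ∑ i, ∑ j,
      MvPolynomial.pderiv i (MvPolynomial.pderiv j p) ⊗ₜ[K]
        (ExteriorAlgebra.ι K (Pi.single i 1 : σ → K) *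
          ExteriorAlgebra.ι K (Pi.single j 1 : σ → K)) := by
    rw [dfn_eq, deRham, LinearMap.sum_apply]
    refine Finset.sum_congr rfl fun i _ => ?_
    rw [map_sum]
    rfl
  have h : deRham K σ (dfn K σ p) + deRham K σ (dfn K σ p) = 0 := by
    rw [e]
    nth_rewrite 2 [Finset.sum_comm]
    rw [← Finset.sum_add_distrib]
    refine Finset.sum_eq_zero fun i _ => ?_
    rw [← Finset.sum_add_distrib]
    refine Finset.sum_eq_zero fun j _ => ?_
    rw [pderiv_comm j i, ← TensorProduct.tmul_add, ExteriorAlgebra.ι_add_mul_swap,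
      TensorProduct.tmul_zero]
  rw [← two_smul K, smul_eq_zero] at h
  exact h.resolve_left two_ne_zero

theorem formsParity_dfn (p : MvPolynomial σ K) : formsParity K σ (dfn K σ p) = -dfn K σ p := by
  simp only [dfn_eq, map_sum, ← Finset.sum_neg_distrib]
  refine Finset.sum_congr rfl fun i _ => ?_
  rw [formsParity, LinearMap.lTensor_tmul, ← TensorProduct.tmul_neg]
  congr 1
  exact CliffordAlgebra.involute_ι _

theorem evalPoint_dfn (t : σ → K) (p : MvPolynomial σ K) : evalPoint K t (dfn K σ p) = 0 := by
  simp [evalPoint, dfn_eq, ExteriorAlgebra.algebraMapInv]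

theorem dfn_mem_formsDeg (p : MvPolynomial σ K) : dfn K σ p ∈ formsDeg K σ 1 := by
  rw [dfn_eq]
  refine Submodule.sum_mem _ fun i _ => ?_
  exact ⟨MvPolynomial.pderiv i p ⊗ₜ[K] ⟨ExteriorAlgebra.ι K (Pi.single i 1), by
    simp⟩, rfl⟩

theorem exists_pderiv_eq [CharZero K] (p : MvPolynomial (Fin 1) K) :
    ∃ q, MvPolynomial.pderiv 0 q = p := by
  induction p using MvPolynomial.induction_on' with
  | monomial s a =>
    refine ⟨MvPolynomial.monomial (s + Finsupp.single 0 1) (a * ((s 0 : K) + 1)⁻¹), ?_⟩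
    have : (s 0 : K) + 1 ≠ 0 := by exact_mod_cast Nat.succ_ne_zero (s 0)
    rw [MvPolynomial.pderiv_monomial]
    simp [this]
  | add p q hp hq =>
    obtain ⟨p', rfl⟩ := hp
    obtain ⟨q', rfl⟩ := hq
    exact ⟨p' + q', map_add _ _ _⟩

/-- On the interval every one-form is exact, by integrating monomials. Closedness would be needed in
higher dimension, but only `n = 1` is used. -/
theorem exists_dfn_of_mem_formsDeg [CharZero K] {ω : Forms K (Fin 1)}
    (h : ω ∈ formsDeg K (Fin 1) 1) : ∃ p, dfn K (Fin 1) p = ω := by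
  obtain ⟨u, rfl⟩ := h
  induction u using TensorProduct.induction_on with
  | zero => exact ⟨0, by simp⟩
  | add u v hu hv =>
    obtain ⟨p, hp⟩ := hu
    obtain ⟨q, hq⟩ := hv
    exact ⟨p + q, by rw [map_add, map_add, hp, hq]⟩
  | tmul p η =>
    obtain ⟨η, hη⟩ := η
    have hη' : η ∈ LinearMap.range (ExteriorAlgebra.ι K (M := Fin 1 → K)) := by
      simpa using hη
    obtain ⟨v, rfl⟩ := hη'
    obtain ⟨q, rfl⟩ := exists_pderiv_eq p
    refine ⟨v 0 • q, ?_⟩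
    have hv : v = v 0 • (Pi.single 0 1 : Fin 1 → K) := by
      ext i
      fin_cases i
      simp
    have e : ExteriorAlgebra.ι K v = v 0 • ExteriorAlgebra.ι K (Pi.single 0 1 : Fin 1 → K) := by
      rw [← map_smul, ← hv]
    refine Eq.trans ?_ (congrArg (TensorProduct.tmul K (MvPolynomial.pderiv 0 q)) e).symm
    rw [dfn_eq]
    simp [TensorProduct.smul_tmul]

section Pullback

variable [CharZero K] {τ : Type} [Fintype τ]

theorem pullback_tmul (φ : τ → MvPolynomial σ K) (p : MvPolynomial τ K)
    (η : ExteriorAlgebra K (τ → K)) : pullback φ (p ⊗ₜ[K] η) = fn K σ (MvPolynomial.aeval φ p) *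
      ExteriorAlgebra.lift K ⟨pullbackOne φ, pullbackOne_sq φ⟩ η :=
  Algebra.TensorProduct.lift_tmul _ _ _ _ _

theorem pullback_fn (φ : τ → MvPolynomial σ K) (p : MvPolynomial τ K) :
    pullback φ (fn K τ p) = fn K σ (MvPolynomial.aeval φ p) := by
  rw [fn_apply, pullback_tmul, map_one, mul_one]

variable [DecidableEq τ]

theorem pullback_dfn (φ : τ → MvPolynomial σ K) (p : MvPolynomial τ K) :
    pullback φ (dfn K τ p) = dfn K σ (MvPolynomial.aeval φ p) := by
  induction p using MvPolynomial.induction_on with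
  | C a => rw [dfn_C, map_zero, MvPolynomial.aeval_C, MvPolynomial.algebraMap_eq, dfn_C]
  | add p q hp hq => simp only [map_add, hp, hq]
  | mul_X p i hp =>
    have hX : pullback φ (dfn K τ (MvPolynomial.X i)) = dfn K σ (φ i) := by
      rw [dfn_X, pullback_tmul, map_one, fn_one, one_mul, ExteriorAlgebra.lift_ι_apply]
      simp [pullbackOne, Fintype.linearCombination_apply_single, dfn, fn_apply]
    rw [dfn_mul, map_add, map_mul, map_mul, hp, hX, pullback_fn, pullback_fn, map_mul,
      MvPolynomial.aeval_X, dfn_mul]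

end Pullback

end PolynomialForms

/-! ### Affine maps of simplices and the operators `h_n^i`. -/

section SimplexForms

variable {K : Type*} [Field K]

theorem optionEquivLeft_pderiv_none {n : ℕ} (p : MvPolynomial (Option (Fin n)) K) :
    MvPolynomial.optionEquivLeft K (Fin n) (MvPolynomial.pderiv none p) =
      Polynomial.derivative (MvPolynomial.optionEquivLeft K (Fin n) p) := by
  induction p using MvPolynomial.induction_on with
  | C a => rw [MvPolynomial.pderiv_C, map_zero, MvPolynomial.optionEquivLeft_C,
      Polynomial.derivative_C]
  | add p q hp hq => simp only [map_add, hp, hq]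
  | mul_X p i hp =>
    rw [Derivation.leibniz, map_add, smul_eq_mul, smul_eq_mul, map_mul, map_mul, map_mul,
      Polynomial.derivative_mul, hp]
    cases i with
    | none =>
      rw [MvPolynomial.pderiv_X_self, MvPolynomial.optionEquivLeft_X_none,
        Polynomial.derivative_X, map_one]
      ring
    | some i =>
      rw [MvPolynomial.pderiv_X_of_ne (by simp), MvPolynomial.optionEquivLeft_X_some,
        Polynomial.derivative_C, map_zero]
      ring

theorem eval_optionEquivLeft {n : ℕ} (c : MvPolynomial (Fin n) K)
    (p : MvPolynomial (Option (Fin n)) K) :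
    (MvPolynomial.optionEquivLeft K (Fin n) p).eval c =
      MvPolynomial.aeval (fun i : Option (Fin n) => i.elim c MvPolynomial.X) p := by
  induction p using MvPolynomial.induction_on with
  | C a => rw [MvPolynomial.optionEquivLeft_C, Polynomial.eval_C, MvPolynomial.aeval_C]; rfl
  | add p q hp hq => simp only [map_add, Polynomial.eval_add, hp, hq]
  | mul_X p i hp =>
    rw [map_mul, Polynomial.eval_mul, hp, map_mul, MvPolynomial.aeval_X]
    cases i <;> simp

theorem aeval_vertex_bary {n : ℕ} (i k : Fin (n + 1)) :
    MvPolynomial.aeval (vertex K i) (bary K n k) = if i = k then 1 else 0 := by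
  refine Fin.cases ?_ (fun k => ?_) k
  · simp only [bary, Fin.cons_zero, map_sub, map_one, map_sum, MvPolynomial.aeval_X, vertex]
    refine Fin.cases ?_ (fun i => ?_) i
    · simp [(Fin.succ_ne_zero _).symm]
    · simp [Fin.succ_inj]
  · simp [bary, vertex]

/-- The coordinates of the affine map that is induced by a map of vertices. -/
def affineMap (K : Type*) [Field K] {m n : ℕ} (f : Fin (m + 1) → Fin (n + 1)) (j : Fin n) :
    MvPolynomial (Fin m) K :=
  ∑ k with f k = j.succ, bary K m k

theorem aeval_vertex_affineMap {m n : ℕ} (f : Fin (m + 1) → Fin (n + 1)) (i : Fin (m + 1))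
    (j : Fin n) : MvPolynomial.aeval (vertex K i) (affineMap K f j) = vertex K (f i) j := by
  simp only [affineMap, map_sum, aeval_vertex_bary, Finset.sum_ite_eq, vertex, Finset.mem_filter,
    Finset.mem_univ, true_and]

theorem aeval_vertex_aeval_affineMap {m n : ℕ} (f : Fin (m + 1) → Fin (n + 1)) (i : Fin (m + 1))
    (p : MvPolynomial (Fin n) K) :
    MvPolynomial.aeval (vertex K i) (MvPolynomial.aeval (affineMap K f) p) =
      MvPolynomial.aeval (vertex K (f i)) p := by
  rw [← AlgHom.comp_apply, MvPolynomial.comp_aeval]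
  congr 2
  funext j
  exact aeval_vertex_affineMap f i j

theorem sum_bary (n : ℕ) : ∑ k, bary K n k = 1 := by
  rw [Fin.sum_univ_succ]
  simp [bary]

/-- For `k = 0` the barycentric coordinate is not a variable; its formula follows from the others,
because the coordinates on both simplices sum to `1` and the sum can be sorted by the fibres of `f`.
-/
theorem aeval_affineMap_bary {m n : ℕ} (f : Fin (m + 1) → Fin (n + 1)) (k : Fin (n + 1)) :
    MvPolynomial.aeval (affineMap K f) (bary K n k) = ∑ l with f l = k, bary K m l := by
  refine Fin.cases ?_ (fun k => ?_) k
  · have h : ∑ l, bary K m l = ∑ k, ∑ l with f l = k, bary K m l :=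
      (Finset.sum_fiberwise _ _ _).symm
    rw [sum_bary, Fin.sum_univ_succ] at h
    simp only [bary, Fin.cons_zero, map_sub, map_one, map_sum, MvPolynomial.aeval_X]
    rw [sub_eq_iff_eq_add]
    exact h
  · simp [bary, affineMap]

theorem aeval_affineMap_aeval_affineMap {l m n : ℕ} (f : Fin (l + 1) → Fin (m + 1))
    (g : Fin (m + 1) → Fin (n + 1)) (p : MvPolynomial (Fin n) K) :
    MvPolynomial.aeval (affineMap K f) (MvPolynomial.aeval (affineMap K g) p) =
      MvPolynomial.aeval (affineMap K (g ∘ f)) p := by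
  rw [← AlgHom.comp_apply, MvPolynomial.comp_aeval]
  congr 2
  funext j
  have h : ∀ k, (if g k = j.succ then ∑ i, (if f i = k then bary K l i else 0) else 0) =
      ∑ i, (if g k = j.succ then (if f i = k then bary K l i else 0) else 0) := by
    intro k
    split_ifs <;> simp
  rw [affineMap, map_sum, Finset.sum_congr rfl fun k _ => aeval_affineMap_bary f k]
  simp only [affineMap, Finset.sum_filter, h, Function.comp_apply]
  rw [Finset.sum_comm]
  refine Finset.sum_congr rfl fun i _ => ?_
  rw [Finset.sum_eq_single (f i)]
  · simp
  · intro k _ hk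
    simp [hk.symm]
  · simp

theorem aeval_affineMap_id {n : ℕ} (p : MvPolynomial (Fin n) K) :
    MvPolynomial.aeval (affineMap K id) p = p := by
  have h : affineMap K (id : Fin (n + 1) → Fin (n + 1)) = MvPolynomial.X := by
    funext j
    simp [affineMap, Finset.filter_eq', bary]
  rw [h, MvPolynomial.aeval_X_left_apply]

theorem aeval_affineMap_const {m n : ℕ} (i : Fin (n + 1)) (p : MvPolynomial (Fin n) K) :
    MvPolynomial.aeval (affineMap K (fun _ : Fin (m + 1) => i)) p =
      MvPolynomial.C (MvPolynomial.aeval (vertex K i) p) := by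
  have h : affineMap K (fun _ : Fin (m + 1) => i) = fun j => MvPolynomial.C (vertex K i j) := by
    funext j
    by_cases hj : i = j.succ
    · simp [affineMap, vertex, hj, sum_bary]
    · simp [affineMap, vertex, hj]
  rw [h]
  induction p using MvPolynomial.induction_on with
  | C a => simp
  | add p q hp hq => simp only [map_add, hp, hq]
  | mul_X p j hp => simp only [map_mul, hp]; simp

/-- Fundamental theorem of calculus: the weight `1 / (k + 1)` is the integral of `u ^ k` over `[0,
1]`. -/
theorem lsum_derivative [CharZero K] {R : Type*} [CommRing R] [Algebra K R] (q : Polynomial R) :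
    Polynomial.lsum (fun k => ((k : K) + 1)⁻¹ • (LinearMap.id : R →ₗ[K] R))
      (Polynomial.derivative q) = q.eval 1 - q.eval 0 := by
  induction q using Polynomial.induction_on' with
  | add p q hp hq => simp only [map_add, Polynomial.eval_add, hp, hq]; ring
  | monomial k a =>
    rw [Polynomial.derivative_monomial, Polynomial.lsum_apply, Polynomial.sum_monomial_index _ _
      (by simp), Polynomial.eval_monomial, Polynomial.eval_monomial]
    cases k with
    | zero => simp
    | succ k =>
      have h : (k : K) + 1 ≠ 0 := by exact_mod_cast Nat.succ_ne_zero k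
      have e : a * ((k + 1 : ℕ) : R) = ((k : K) + 1) • a := by
        rw [Algebra.smul_def, mul_comm]; simp
      rw [e]
      simp [smul_smul, h]

theorem integrate_pderiv_none [CharZero K] {n : ℕ} (p : MvPolynomial (Option (Fin n)) K) :
    integrate K n (MvPolynomial.pderiv none p) =
      MvPolynomial.aeval (fun i : Option (Fin n) => i.elim 1 MvPolynomial.X) p -
      MvPolynomial.aeval (fun i : Option (Fin n) => i.elim 0 MvPolynomial.X) p := by
  rw [← eval_optionEquivLeft, ← eval_optionEquivLeft, ← lsum_derivative (K := K),
    ← optionEquivLeft_pderiv_none]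
  rfl

theorem fibreIntegral_fn {n : ℕ} (p : MvPolynomial (Option (Fin n)) K) :
    fibreIntegral K n (fn K _ p) = 0 := by
  rw [fibreIntegral, fn_apply, TensorProduct.map_tmul, LinearMap.comp_apply]
  have h : (CliffordAlgebra.contractLeft (Q := (0 : QuadraticForm K (Option (Fin n) → K)))
    (LinearMap.proj none)) (1 : ExteriorAlgebra K (Option (Fin n) → K)) = 0 :=
    CliffordAlgebra.contractLeft_one _ _
  rw [h, map_zero, TensorProduct.tmul_zero]

theorem fibreIntegral_dfn {n : ℕ} (p : MvPolynomial (Option (Fin n)) K) :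
    fibreIntegral K n (dfn K _ p) = fn K _ (integrate K n (MvPolynomial.pderiv none p)) := by
  have h : ∀ i : Option (Fin n),
      (CliffordAlgebra.contractLeft (Q := (0 : QuadraticForm K (Option (Fin n) → K)))
      (LinearMap.proj none)) (ExteriorAlgebra.ι K (Pi.single i 1 : Option (Fin n) → K)) =
      algebraMap K _ ((Pi.single i 1 : Option (Fin n) → K) none) := fun i =>
    CliffordAlgebra.contractLeft_ι _ _ _
  rw [dfn_eq, map_sum, Finset.sum_eq_single none]
  · rw [fibreIntegral, TensorProduct.map_tmul, LinearMap.comp_apply, h]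
    simp [fn_apply]
  · intro i _ hi
    rw [fibreIntegral, TensorProduct.map_tmul, LinearMap.comp_apply, h,
      Pi.single_eq_of_ne hi.symm]
    simp
  · simp

variable [CharZero K]

theorem hOp_fn {n : ℕ} (i : Fin (n + 1)) (p : MvPolynomial (Fin n) K) :
    hOp K i (fn K _ p) = 0 := by
  rw [hOp, LinearMap.comp_apply, AlgHom.toLinearMap_apply, pullback_fn, fibreIntegral_fn]

/-- The `du` part of the pulled back form is the `u`-derivative of `p` along the segment from `e_i`
to `t`, so its integral is a difference of end values. Together with `hOp_fn` this is all that is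
used about `h_n^i`. -/
theorem hOp_dfn {n : ℕ} (i : Fin (n + 1)) (p : MvPolynomial (Fin n) K) :
    hOp K i (dfn K _ p) =
      fn K _ (p - MvPolynomial.C (MvPolynomial.aeval (vertex K i) p)) := by
  rw [hOp, LinearMap.comp_apply, AlgHom.toLinearMap_apply, pullback_dfn, fibreIntegral_dfn,
    integrate_pderiv_none]
  congr 2
  -- At `u = 1` the contraction is the identity; at `u = 0` it is constant at the vertex.
  · induction p using MvPolynomial.induction_on with
    | C a => simp
    | add p q hp hq => simp only [map_add, hp, hq]
    | mul_X p j hp => simp only [map_mul, hp]; simp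
  · induction p using MvPolynomial.induction_on with
    | C a => simp
    | add p q hp hq => simp only [map_add, hp, hq]
    | mul_X p j hp => simp only [map_mul, hp]; simp

theorem simplicial_fn {m n : ℕ} (f : Fin (m + 1) → Fin (n + 1)) (p : MvPolynomial (Fin n) K) :
    simplicial K f (fn K _ p) = fn K _ (MvPolynomial.aeval (affineMap K f) p) :=
  pullback_fn _ _

theorem simplicial_dfn {m n : ℕ} (f : Fin (m + 1) → Fin (n + 1)) (p : MvPolynomial (Fin n) K) :
    simplicial K f (dfn K _ p) = dfn K _ (MvPolynomial.aeval (affineMap K f) p) :=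
  pullback_dfn _ _

end SimplexForms

/-! ### Signs of the middle exchange on homogeneous tensors. -/

section MiddleBraid

variable {K A B C D : Type*} [Field K] [CharZero K]
  [AddCommGroup A] [Module K A] [AddCommGroup B] [Module K B]
  [AddCommGroup C] [Module K C] [AddCommGroup D] [Module K D]

theorem middleBraid_even_left (q : B →ₗ[K] B) (r : C →ₗ[K] C) (a : A) {b : B} (c : C) (d : D)
    (hb : q b = b) :
    middleBraid q r ((a ⊗ₜ[K] b) ⊗ₜ[K] (c ⊗ₜ[K] d)) = (a ⊗ₜ[K] c) ⊗ₜ[K] (b ⊗ₜ[K] d) := by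
  rw [middleBraid, LinearMap.comp_apply, koszulSign_even_tmul]
  · simp
  · simp [hb]

theorem middleBraid_even_right (q : B →ₗ[K] B) (r : C →ₗ[K] C) (a : A) (b : B) {c : C} (d : D)
    (hc : r c = c) :
    middleBraid q r ((a ⊗ₜ[K] b) ⊗ₜ[K] (c ⊗ₜ[K] d)) = (a ⊗ₜ[K] c) ⊗ₜ[K] (b ⊗ₜ[K] d) := by
  rw [middleBraid, LinearMap.comp_apply, koszulSign_tmul_even]
  · simp
  · simp [hc]

theorem middleBraid_odd_right (q : B →ₗ[K] B) (r : C →ₗ[K] C) (a : A) (b : B) {c : C} (d : D)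
    (hc : r c = -c) :
    middleBraid q r ((a ⊗ₜ[K] b) ⊗ₜ[K] (c ⊗ₜ[K] d)) = (a ⊗ₜ[K] c) ⊗ₜ[K] (q b ⊗ₜ[K] d) := by
  rw [middleBraid, LinearMap.comp_apply, koszulSign_tmul_odd]
  · simp
  · simp [hc, TensorProduct.neg_tmul]

end MiddleBraid

/-! ### Polynomials with coefficients in a module, and bilinear maps on them. -/

section PolynomialCoefficients

theorem tensor_bilin_ext {K M N P R S : Type*} [CommSemiring K] [AddCommMonoid M] [Module K M]
    [AddCommMonoid N] [Module K N] [AddCommMonoid P] [Module K P] [AddCommMonoid R] [Module K R]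
    [AddCommMonoid S] [Module K S] {F G : (M ⊗[K] R) →ₗ[K] (N ⊗[K] S) →ₗ[K] P}
    (h : ∀ m r n s, F (m ⊗ₜ[K] r) (n ⊗ₜ[K] s) = G (m ⊗ₜ[K] r) (n ⊗ₜ[K] s)) : F = G :=
  TensorProduct.ext' fun m r => TensorProduct.ext' fun n s => h m r n s

variable {K M N P : Type*} [CommSemiring K] [AddCommMonoid M] [Module K M] [AddCommMonoid N]
  [Module K N] [AddCommMonoid P] [Module K P] {σ : Type*}

/-- The evaluation of polynomials with coefficients in `M` at a point. -/
def evalAt (M : Type*) [AddCommMonoid M] [Module K M] (t : σ → K) :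
    M ⊗[K] MvPolynomial σ K →ₗ[K] M :=
  (TensorProduct.rid K M).toLinearMap ∘ₗ LinearMap.lTensor M (MvPolynomial.aeval t).toLinearMap

theorem evalAt_tmul (t : σ → K) (m : M) (p : MvPolynomial σ K) :
    evalAt M t (m ⊗ₜ[K] p) = MvPolynomial.aeval t p • m := by
  simp [evalAt]

theorem evalAt_rTensor (t : σ → K) (f : M →ₗ[K] N) (x : M ⊗[K] MvPolynomial σ K) :
    evalAt N t (LinearMap.rTensor _ f x) = f (evalAt M t x) := by
  induction x using TensorProduct.induction_on with
  | zero => simp only [map_zero]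
  | tmul m p => rw [LinearMap.rTensor_tmul, evalAt_tmul, evalAt_tmul, map_smul]
  | add x y hx hy => simp only [map_add, hx, hy]

theorem eq_zero_of_forall_evalAt {K M : Type*} [Field K] [CharZero K] [AddCommGroup M] [Module K M]
    (x : M ⊗[K] MvPolynomial σ K)
    (h : ∀ t : σ → K, evalAt M t x = 0) : x = 0 :=
  eq_zero_of_forall_aeval x fun t => (TensorProduct.rid K M).injective
    ((h t).trans (map_zero _).symm)

/-- The extension of a bilinear map to polynomials with coefficients. -/
def polyBilin (σ : Type*) (b : M →ₗ[K] N →ₗ[K] P) :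
    (M ⊗[K] MvPolynomial σ K) →ₗ[K] (N ⊗[K] MvPolynomial σ K) →ₗ[K] P ⊗[K] MvPolynomial σ K :=
  TensorProduct.curry (TensorProduct.map (TensorProduct.lift b)
    (LinearMap.mul' K (MvPolynomial σ K)) ∘ₗ
    (TensorProduct.tensorTensorTensorComm K M (MvPolynomial σ K) N
      (MvPolynomial σ K)).toLinearMap)

theorem polyBilin_tmul (b : M →ₗ[K] N →ₗ[K] P) (m : M) (p : MvPolynomial σ K) (n : N)
    (q : MvPolynomial σ K) :
    polyBilin σ b (m ⊗ₜ[K] p) (n ⊗ₜ[K] q) = b m n ⊗ₜ[K] (p * q) := by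
  simp [polyBilin]

theorem evalAt_polyBilin (t : σ → K) (b : M →ₗ[K] N →ₗ[K] P) (x : M ⊗[K] MvPolynomial σ K)
    (y : N ⊗[K] MvPolynomial σ K) :
    evalAt P t (polyBilin σ b x y) = b (evalAt M t x) (evalAt N t y) := by
  have h : (polyBilin σ b).compr₂ (evalAt P t) = b.compl₁₂ (evalAt M t) (evalAt N t) :=
    tensor_bilin_ext fun m p n q => by
      simp [polyBilin_tmul, evalAt_tmul, smul_smul, mul_comm]
  exact LinearMap.congr_fun₂ h x y

end PolynomialCoefficients

/-! ### Functions and exact one-forms with values in `L`. -/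

section FormCoefficients

variable {K V₀ V₁ W₀ W₁ : Type*} [Field K]
  [AddCommGroup V₀] [Module K V₀] [AddCommGroup V₁] [Module K V₁]
  [AddCommGroup W₀] [Module K W₀] [AddCommGroup W₁] [Module K W₁]

section Definitions

variable (K V₀ V₁ W₀ W₁) (n : ℕ)

/-- Polynomials with coefficients of degree `-1`, as forms of degree `0` with values in
`L(V, W)`. -/
def compForm : Components K V₀ V₁ W₀ W₁ ⊗[K] MvPolynomial (Fin n) K →ₗ[K]
    ConvForms K V₀ V₁ W₀ W₁ n :=
  TensorProduct.map (ofComponents K V₀ V₁ W₀ W₁) (fn K (Fin n))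

/-- The differentials of polynomials with coefficients of degree `-1`. -/
def compDiff : Components K V₀ V₁ W₀ W₁ ⊗[K] MvPolynomial (Fin n) K →ₗ[K]
    ConvForms K V₀ V₁ W₀ W₁ n :=
  TensorProduct.map (ofComponents K V₀ V₁ W₀ W₁) (dfn K (Fin n))

/-- Polynomials with coefficients of degree `0`, as forms of degree `0` with values in
`L(V, W)`. -/
def homForm : (V₀ →ₗ[K] W₁) ⊗[K] MvPolynomial (Fin n) K →ₗ[K] ConvForms K V₀ V₁ W₀ W₁ n :=
  TensorProduct.map (ofHom K V₀ V₁ W₀ W₁) (fn K (Fin n))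

/-- The differentials of polynomials with coefficients of degree `0`. -/
def homDiff : (V₀ →ₗ[K] W₁) ⊗[K] MvPolynomial (Fin n) K →ₗ[K] ConvForms K V₀ V₁ W₀ W₁ n :=
  TensorProduct.map (ofHom K V₀ V₁ W₀ W₁) (dfn K (Fin n))

end Definitions

variable {n : ℕ}

theorem tmul_sub_C {M : Type*} [AddCommGroup M] [Module K M] (m : M) (p : MvPolynomial (Fin n) K)
    (t : Fin n → K) : m ⊗ₜ[K] (p - MvPolynomial.C (MvPolynomial.aeval t p)) =
      m ⊗ₜ[K] p - evalAt M t (m ⊗ₜ[K] p) ⊗ₜ[K] 1 := by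
  rw [TensorProduct.tmul_sub, evalAt_tmul, TensorProduct.smul_tmul, MvPolynomial.smul_eq_C_mul,
    mul_one]

theorem compDiff_tmul_one (p : Components K V₀ V₁ W₀ W₁) :
    compDiff K V₀ V₁ W₀ W₁ n (p ⊗ₜ[K] 1) = 0 := by
  rw [compDiff, TensorProduct.map_tmul, dfn_one, TensorProduct.tmul_zero]

theorem homDiff_tmul_one (q : V₀ →ₗ[K] W₁) :
    homDiff K V₀ V₁ W₀ W₁ n (q ⊗ₜ[K] 1) = 0 := by
  rw [homDiff, TensorProduct.map_tmul, dfn_one, TensorProduct.tmul_zero]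

variable [CharZero K]

theorem hBar_map_fn {M : Type*} [AddCommGroup M] [Module K M] (i : Fin (n + 1))
    (f : M →ₗ[K] Conv K V₀ V₁ W₀ W₁) (x : M ⊗[K] MvPolynomial (Fin n) K) :
    hBar i (TensorProduct.map f (fn K (Fin n)) x) = 0 := by
  induction x using TensorProduct.induction_on with
  | zero => simp only [map_zero]
  | tmul m p => rw [hBar, TensorProduct.map_tmul, TensorProduct.map_tmul, hOp_fn,
      TensorProduct.tmul_zero]
  | add x y hx hy => simp only [map_add, hx, hy, add_zero]

theorem hBar_compForm (i : Fin (n + 1))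
    (a : Components K V₀ V₁ W₀ W₁ ⊗[K] MvPolynomial (Fin n) K) :
    hBar i (compForm K V₀ V₁ W₀ W₁ n a) = 0 := hBar_map_fn i _ a

/-- The sign is the Koszul sign of the odd operator `h` passing a coefficient of degree `-1`;
coefficients of degree `0`, as in `hBar_homDiff`, produce none. -/
theorem hBar_compDiff (i : Fin (n + 1))
    (a : Components K V₀ V₁ W₀ W₁ ⊗[K] MvPolynomial (Fin n) K) :
    hBar i (compDiff K V₀ V₁ W₀ W₁ n a) =
      (-1 : K) • compForm K V₀ V₁ W₀ W₁ n (a - evalAt _ (vertex K i) a ⊗ₜ[K] 1) := by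
  induction a using TensorProduct.induction_on with
  | zero => simp
  | tmul m p => rw [hBar, compDiff, TensorProduct.map_tmul, TensorProduct.map_tmul, hOp_dfn,
      convParity_ofComponents, ← tmul_sub_C, compForm, TensorProduct.map_tmul, ← neg_one_smul K,
      TensorProduct.smul_tmul']
  | add x y hx hy =>
    rw [map_add, map_add, hx, hy, map_add, TensorProduct.add_tmul, ← smul_add, ← map_add]
    congr 2
    abel

theorem hBar_homDiff (i : Fin (n + 1))
    (b : (V₀ →ₗ[K] W₁) ⊗[K] MvPolynomial (Fin n) K) :
    hBar i (homDiff K V₀ V₁ W₀ W₁ n b) =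
      homForm K V₀ V₁ W₀ W₁ n (b - evalAt _ (vertex K i) b ⊗ₜ[K] 1) := by
  induction b using TensorProduct.induction_on with
  | zero => simp
  | tmul m p => rw [hBar, homDiff, TensorProduct.map_tmul, TensorProduct.map_tmul, hOp_dfn,
      convParity_ofHom, ← tmul_sub_C, homForm, TensorProduct.map_tmul]
  | add x y hx hy =>
    rw [map_add, map_add, hx, hy, map_add, TensorProduct.add_tmul, ← map_add]
    congr 1
    abel

theorem evalVertex_eq (i : Fin (n + 1)) : evalVertex K i = evalPoint K (vertex K i) := rfl

theorem evalBar_map_fn {M : Type*} [AddCommGroup M] [Module K M] (i : Fin (n + 1))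
    (f : M →ₗ[K] Conv K V₀ V₁ W₀ W₁) (x : M ⊗[K] MvPolynomial (Fin n) K) :
    evalBar i (TensorProduct.map f (fn K (Fin n)) x) = f (evalAt M (vertex K i) x) := by
  induction x using TensorProduct.induction_on with
  | zero => simp only [map_zero]
  | tmul m p => rw [evalBar, TensorProduct.map_tmul, LinearMap.comp_apply, LinearMap.lTensor_tmul,
      evalVertex_eq, evalPoint_fn, evalAt_tmul, map_smul]; simp
  | add x y hx hy => simp only [map_add, hx, hy]

theorem evalBar_map_dfn {M : Type*} [AddCommGroup M] [Module K M] (i : Fin (n + 1))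
    (f : M →ₗ[K] Conv K V₀ V₁ W₀ W₁) (x : M ⊗[K] MvPolynomial (Fin n) K) :
    evalBar i (TensorProduct.map f (dfn K (Fin n)) x) = 0 := by
  induction x using TensorProduct.induction_on with
  | zero => simp only [map_zero]
  | tmul m p => rw [evalBar, TensorProduct.map_tmul, LinearMap.comp_apply, LinearMap.lTensor_tmul,
      evalVertex_eq, evalPoint_dfn]; simp
  | add x y hx hy => simp only [map_add, hx, hy, add_zero]

/-- The restriction of polynomials with coefficients along an affine map. -/
def restrict {m : ℕ} (M : Type*) [AddCommGroup M] [Module K M] (f : Fin (m + 1) → Fin (n + 1)) :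
    M ⊗[K] MvPolynomial (Fin n) K →ₗ[K] M ⊗[K] MvPolynomial (Fin m) K :=
  LinearMap.lTensor M (MvPolynomial.aeval (affineMap K f)).toLinearMap

theorem faceBar_map_fn {M : Type*} [AddCommGroup M] [Module K M] (i : Fin (n + 2))
    (f : M →ₗ[K] Conv K V₀ V₁ W₀ W₁) (x : M ⊗[K] MvPolynomial (Fin (n + 1)) K) :
    faceBar i (TensorProduct.map f (fn K (Fin (n + 1))) x) =
      TensorProduct.map f (fn K (Fin n)) (restrict M i.succAbove x) := by
  induction x using TensorProduct.induction_on with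
  | zero => simp only [map_zero]
  | tmul m p =>
    rw [TensorProduct.map_tmul, restrict, LinearMap.lTensor_tmul, TensorProduct.map_tmul]
    exact congrArg (TensorProduct.tmul K (f m)) (simplicial_fn i.succAbove p)
  | add x y hx hy => simp only [map_add, hx, hy]

theorem faceBar_map_dfn {M : Type*} [AddCommGroup M] [Module K M] (i : Fin (n + 2))
    (f : M →ₗ[K] Conv K V₀ V₁ W₀ W₁) (x : M ⊗[K] MvPolynomial (Fin (n + 1)) K) :
    faceBar i (TensorProduct.map f (dfn K (Fin (n + 1))) x) =
      TensorProduct.map f (dfn K (Fin n)) (restrict M i.succAbove x) := by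
  induction x using TensorProduct.induction_on with
  | zero => simp only [map_zero]
  | tmul m p =>
    rw [TensorProduct.map_tmul, restrict, LinearMap.lTensor_tmul, TensorProduct.map_tmul]
    exact congrArg (TensorProduct.tmul K (f m)) (simplicial_dfn i.succAbove p)
  | add x y hx hy => simp only [map_add, hx, hy]

variable (A : TwoTermLeibniz K V₀ V₁) (B : TwoTermLeibniz K W₀ W₁)

theorem bar₁_tmul (f : Conv K V₀ V₁ W₀ W₁) (ω : Ω K n) :
    bar₁ A B n (f ⊗ₜ[K] ω) = conv₁ A B f ⊗ₜ[K] ω +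
      convParity K V₀ V₁ W₀ W₁ f ⊗ₜ[K] deRham K (Fin n) ω := by
  simp [bar₁]

theorem bar₁_homForm (b : (V₀ →ₗ[K] W₁) ⊗[K] MvPolynomial (Fin n) K) :
    bar₁ A B n (homForm K V₀ V₁ W₀ W₁ n b) =
      compForm K V₀ V₁ W₀ W₁ n (LinearMap.rTensor _ (linearPart A B) b) +
        homDiff K V₀ V₁ W₀ W₁ n b := by
  induction b using TensorProduct.induction_on with
  | zero => simp only [map_zero, add_zero]
  | tmul m p =>
    rw [homForm, TensorProduct.map_tmul, bar₁_tmul, conv₁_ofHom, convParity_ofHom, deRham_fn]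
    rfl
  | add x y hx hy => simp only [map_add, hx, hy]; abel

theorem bar₁_homDiff (b : (V₀ →ₗ[K] W₁) ⊗[K] MvPolynomial (Fin n) K) :
    bar₁ A B n (homDiff K V₀ V₁ W₀ W₁ n b) =
      compDiff K V₀ V₁ W₀ W₁ n (LinearMap.rTensor _ (linearPart A B) b) := by
  induction b using TensorProduct.induction_on with
  | zero => simp only [map_zero]
  | tmul m p =>
    rw [homDiff, TensorProduct.map_tmul, bar₁_tmul, conv₁_ofHom, deRham_dfn,
      TensorProduct.tmul_zero, add_zero]
    rfl
  | add x y hx hy => simp only [map_add, hx, hy]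

theorem bar₁_compForm (a : Components K V₀ V₁ W₀ W₁ ⊗[K] MvPolynomial (Fin n) K) :
    bar₁ A B n (compForm K V₀ V₁ W₀ W₁ n a) =
      TensorProduct.map LinearMap.id (fn K (Fin n))
        (LinearMap.rTensor _ (conv₁ A B ∘ₗ ofComponents K V₀ V₁ W₀ W₁) a) +
        (-1 : K) • compDiff K V₀ V₁ W₀ W₁ n a := by
  induction a using TensorProduct.induction_on with
  | zero => simp only [map_zero, smul_zero, add_zero]
  | tmul m p =>
    rw [compForm, TensorProduct.map_tmul, bar₁_tmul, convParity_ofComponents, deRham_fn,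
      ← neg_one_smul K, ← TensorProduct.smul_tmul']
    rfl
  | add x y hx hy => simp only [map_add, hx, hy, smul_add]; abel

end FormCoefficients

/-! ### Naturality of the iterated middle exchange. -/

section MiddleBraid

variable {K L F : Type*} [Field K] [AddCommGroup L] [Module K L] [AddCommGroup F] [Module K F]

theorem middleBraid_rTensor_map (q : F →ₗ[K] F) {p e : L →ₗ[K] L} (he : p ∘ₗ e = e ∘ₗ p)
    (t : ((L ⊗[K] F) ⊗[K] (L ⊗[K] F)) ⊗[K] (L ⊗[K] F)) :
    middleBraid (A := L ⊗[K] L) (B := F ⊗[K] F) (TensorProduct.map q q) p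
      (LinearMap.rTensor _ (middleBraid q p) (TensorProduct.map (TensorProduct.map
        (TensorProduct.map e LinearMap.id) (TensorProduct.map e LinearMap.id))
        (TensorProduct.map e LinearMap.id) t)) =
    TensorProduct.map (TensorProduct.map (TensorProduct.map e e) e) LinearMap.id
      (middleBraid (A := L ⊗[K] L) (B := F ⊗[K] F) (TensorProduct.map q q) p
        (LinearMap.rTensor _ (middleBraid q p) t)) := by
  have hq : q ∘ₗ LinearMap.id = LinearMap.id ∘ₗ q := rfl
  have hq₂ : TensorProduct.map q q ∘ₗ LinearMap.id = LinearMap.id ∘ₗ TensorProduct.map q q := rfl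
  have h : LinearMap.rTensor _ (middleBraid q p) (TensorProduct.map (TensorProduct.map
        (TensorProduct.map e LinearMap.id) (TensorProduct.map e LinearMap.id))
        (TensorProduct.map e LinearMap.id) t) =
      TensorProduct.map (TensorProduct.map (TensorProduct.map e e) LinearMap.id)
        (TensorProduct.map e LinearMap.id) (LinearMap.rTensor _ (middleBraid q p) t) := by
    induction t using TensorProduct.induction_on with
    | zero => simp only [map_zero]
    | add x y hx hy => simp only [map_add, hx, hy]
    | tmul u v =>
      rw [TensorProduct.map_tmul, LinearMap.rTensor_tmul, middleBraid_map _ _ hq he,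
        LinearMap.rTensor_tmul, TensorProduct.map_tmul, TensorProduct.map_id]
  rw [h, middleBraid_map _ _ hq₂ he, TensorProduct.map_id]

end MiddleBraid

/-! ### Trilinear brackets on functions. -/

section PolynomialExtension

variable {K L F : Type*} [CommSemiring K] [AddCommMonoid L] [Module K L] [AddCommMonoid F]
  [Module K F] {σ : Type*}

/-- Writes a trilinear bracket of functions as iterated `polyBilin`, the form in which it can be
evaluated at points. -/
theorem map_polyBilin_polyBilin_eq
    (Φ : ((L ⊗[K] F) ⊗[K] (L ⊗[K] F)) ⊗[K] (L ⊗[K] F) →ₗ[K] L ⊗[K] F)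
    (c : (L ⊗[K] L) ⊗[K] L →ₗ[K] L) (φ : MvPolynomial σ K →ₗ[K] F)
    (h : ∀ f g k r s t, Φ (((f ⊗ₜ[K] φ r) ⊗ₜ[K] (g ⊗ₜ[K] φ s)) ⊗ₜ[K] (k ⊗ₜ[K] φ t)) =
      c ((f ⊗ₜ[K] g) ⊗ₜ[K] k) ⊗ₜ[K] φ (r * s * t))
    (x y z : L ⊗[K] MvPolynomial σ K) :
    Φ ((TensorProduct.map LinearMap.id φ x ⊗ₜ[K] TensorProduct.map LinearMap.id φ y) ⊗ₜ[K]
        TensorProduct.map LinearMap.id φ z) =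
      TensorProduct.map LinearMap.id φ (polyBilin σ (TensorProduct.curry c)
        (polyBilin σ (TensorProduct.mk K L L) x y) z) := by
  induction x using TensorProduct.induction_on with
  | zero => simp only [map_zero, LinearMap.zero_apply, TensorProduct.zero_tmul]
  | add x x' hx hx' => simp only [map_add, LinearMap.add_apply, TensorProduct.add_tmul, hx, hx']
  | tmul f r =>
    induction y using TensorProduct.induction_on with
    | zero => simp only [map_zero, LinearMap.zero_apply, TensorProduct.zero_tmul,
        TensorProduct.tmul_zero]
    | add x x' hx hx' => simp only [map_add, LinearMap.add_apply, TensorProduct.add_tmul,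
        TensorProduct.tmul_add, hx, hx']
    | tmul g s =>
      induction z using TensorProduct.induction_on with
      | zero => simp only [map_zero, TensorProduct.tmul_zero]
      | add x x' hx hx' => simp only [map_add, TensorProduct.tmul_add, hx, hx']
      | tmul k t => simp only [polyBilin_tmul, TensorProduct.map_tmul, LinearMap.id_apply, h,
          TensorProduct.curry_apply, TensorProduct.mk_apply]

end PolynomialExtension

/-! ### The brackets of `L ⊗ Ω_n` and the nonlinear term. -/

section FormBrackets

variable {K V₀ V₁ W₀ W₁ : Type*} [Field K] [CharZero K]
  [AddCommGroup V₀] [Module K V₀] [AddCommGroup V₁] [Module K V₁]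
  [AddCommGroup W₀] [Module K W₀] [AddCommGroup W₁] [Module K W₁]
  {n : ℕ} (B : TwoTermLeibniz K W₀ W₁)

variable (K V₀ V₁ W₀ W₁ n) in
/-- Polynomials with coefficients in `L(V, W)`, as forms of degree `0`. -/
abbrev coeffForm : Conv K V₀ V₁ W₀ W₁ ⊗[K] MvPolynomial (Fin n) K →ₗ[K] ConvForms K V₀ V₁ W₀ W₁ n :=
  TensorProduct.map LinearMap.id (fn K (Fin n))

theorem compForm_eq (a : Components K V₀ V₁ W₀ W₁ ⊗[K] MvPolynomial (Fin n) K) :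
    compForm K V₀ V₁ W₀ W₁ n a = coeffForm K V₀ V₁ W₀ W₁ n
      (LinearMap.rTensor _ (ofComponents K V₀ V₁ W₀ W₁) a) := by
  rw [LinearMap.rTensor, TensorProduct.map_map, LinearMap.id_comp, LinearMap.comp_id]; rfl

theorem mul'_fn_tmul_fn (r s : MvPolynomial (Fin n) K) :
    LinearMap.mul' K (Ω K n) (fn K _ r ⊗ₜ[K] fn K _ s) = fn K _ (r * s) := by
  rw [LinearMap.mul'_apply, fn_mul]

theorem mul'_tmul_fn (r : MvPolynomial (Fin n) K) (ω : Ω K n) :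
    LinearMap.mul' K (Ω K n) (ω ⊗ₜ[K] fn K _ r) = LinearMap.mul' K (Ω K n) (fn K _ r ⊗ₜ[K] ω) := by
  rw [LinearMap.mul'_apply, LinearMap.mul'_apply]
  exact (commute_function r ω).eq.symm

theorem bar₂_tmul_even_left (f g : Conv K V₀ V₁ W₀ W₁) {r : Ω K n} (s : Ω K n)
    (hr : formsParity K (Fin n) r = r) :
    bar₂ B n ((f ⊗ₜ[K] r) ⊗ₜ[K] (g ⊗ₜ[K] s)) = conv₂ B (f ⊗ₜ[K] g) ⊗ₜ[K]
      LinearMap.mul' K (Ω K n) (r ⊗ₜ[K] s) := by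
  rw [bar₂, LinearMap.comp_apply, middleBraid_even_left _ _ _ _ _ hr, TensorProduct.map_tmul]

theorem bar₂_tmul_even_right (f : Conv K V₀ V₁ W₀ W₁) {g : Conv K V₀ V₁ W₀ W₁} (r s : Ω K n)
    (hg : convParity K V₀ V₁ W₀ W₁ g = g) :
    bar₂ B n ((f ⊗ₜ[K] r) ⊗ₜ[K] (g ⊗ₜ[K] s)) = conv₂ B (f ⊗ₜ[K] g) ⊗ₜ[K]
      LinearMap.mul' K (Ω K n) (r ⊗ₜ[K] s) := by
  rw [bar₂, LinearMap.comp_apply, middleBraid_even_right _ _ _ _ _ hg, TensorProduct.map_tmul]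

theorem bar₂_tmul_odd_odd (f : Conv K V₀ V₁ W₀ W₁) {g : Conv K V₀ V₁ W₀ W₁} {r : Ω K n} (s : Ω K n)
    (hg : convParity K V₀ V₁ W₀ W₁ g = -g) (hr : formsParity K (Fin n) r = -r) :
    bar₂ B n ((f ⊗ₜ[K] r) ⊗ₜ[K] (g ⊗ₜ[K] s)) = (-conv₂ B (f ⊗ₜ[K] g)) ⊗ₜ[K]
      LinearMap.mul' K (Ω K n) (r ⊗ₜ[K] s) := by
  have hr' : formsParity K (Fin n) r = (-1 : K) • r := hr.trans (neg_one_smul K r).symm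
  rw [bar₂, LinearMap.comp_apply, middleBraid_odd_right _ _ _ _ _ hg, TensorProduct.map_tmul, hr',
    ← TensorProduct.smul_tmul', map_smul, ← neg_one_smul K (conv₂ B _), TensorProduct.smul_tmul]

theorem bar₃_tmul_even_even (f g h : Conv K V₀ V₁ W₀ W₁) {r s : Ω K n} (t : Ω K n)
    (hr : formsParity K (Fin n) r = r) (hs : formsParity K (Fin n) s = s) :
    bar₃ B n (((f ⊗ₜ[K] r) ⊗ₜ[K] (g ⊗ₜ[K] s)) ⊗ₜ[K] (h ⊗ₜ[K] t)) =
      conv₃ B ((f ⊗ₜ[K] g) ⊗ₜ[K] h) ⊗ₜ[K]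
        LinearMap.mul' K (Ω K n) (LinearMap.mul' K (Ω K n) (r ⊗ₜ[K] s) ⊗ₜ[K] t) := by
  rw [bar₃, LinearMap.comp_apply, LinearMap.comp_apply, LinearMap.rTensor_tmul,
    middleBraid_even_left _ _ _ _ _ hr, middleBraid_even_left, TensorProduct.map_tmul,
    LinearMap.comp_apply, LinearMap.rTensor_tmul]
  rw [TensorProduct.map_tmul, hr, hs]

theorem bar₂_coeffForm (x y : Conv K V₀ V₁ W₀ W₁ ⊗[K] MvPolynomial (Fin n) K) :
    bar₂ B n (coeffForm K V₀ V₁ W₀ W₁ n x ⊗ₜ[K] coeffForm K V₀ V₁ W₀ W₁ n y) =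
      coeffForm K V₀ V₁ W₀ W₁ n (polyBilin (Fin n) (TensorProduct.curry (conv₂ B)) x y) := by
  have h : ((TensorProduct.mk K _ _).compl₁₂ (coeffForm K V₀ V₁ W₀ W₁ n)
      (coeffForm K V₀ V₁ W₀ W₁ n)).compr₂ (bar₂ B n) =
      (polyBilin (Fin n) (TensorProduct.curry (conv₂ B))).compr₂ (coeffForm K V₀ V₁ W₀ W₁ n) :=
    tensor_bilin_ext fun f r g s => by
      rw [LinearMap.compr₂_apply, LinearMap.compr₂_apply, LinearMap.compl₁₂_apply,
        TensorProduct.mk_apply, polyBilin_tmul, TensorProduct.map_tmul, TensorProduct.map_tmul,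
        TensorProduct.map_tmul, ← mul'_fn_tmul_fn, bar₂_tmul_even_left B _ _ _ (formsParity_fn r),
        TensorProduct.curry_apply, LinearMap.id_apply, LinearMap.id_apply, LinearMap.id_apply]
  exact LinearMap.congr_fun₂ h x y

theorem bar₃_coeffForm (x y z : Conv K V₀ V₁ W₀ W₁ ⊗[K] MvPolynomial (Fin n) K) :
    bar₃ B n ((coeffForm K V₀ V₁ W₀ W₁ n x ⊗ₜ[K] coeffForm K V₀ V₁ W₀ W₁ n y) ⊗ₜ[K]
        coeffForm K V₀ V₁ W₀ W₁ n z) =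
      coeffForm K V₀ V₁ W₀ W₁ n (polyBilin (Fin n) (TensorProduct.curry (conv₃ B))
        (polyBilin (Fin n) (TensorProduct.mk K (Conv K V₀ V₁ W₀ W₁) (Conv K V₀ V₁ W₀ W₁)) x y) z) := by
  refine map_polyBilin_polyBilin_eq (bar₃ B n) (conv₃ B) (fn K (Fin n))
    (fun f g h r s t => ?_) x y z
  rw [← mul'_fn_tmul_fn, ← mul'_fn_tmul_fn,
    bar₃_tmul_even_even B _ _ _ _ (formsParity_fn r) (formsParity_fn s)]

variable (n) in
/-- The bilinear map `(p r, q s) ↦ [p, q] r ds`. -/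
def mixedForm : Components K V₀ V₁ W₀ W₁ ⊗[K] MvPolynomial (Fin n) K →ₗ[K]
    (V₀ →ₗ[K] W₁) ⊗[K] MvPolynomial (Fin n) K →ₗ[K] ConvForms K V₀ V₁ W₀ W₁ n :=
  TensorProduct.curry (TensorProduct.map
    (ofComponents K V₀ V₁ W₀ W₁ ∘ₗ TensorProduct.lift (mixedBracket B))
    (LinearMap.mul' K (Ω K n) ∘ₗ TensorProduct.map (fn K (Fin n)) (dfn K (Fin n))) ∘ₗ
    (TensorProduct.tensorTensorTensorComm K _ (MvPolynomial (Fin n) K) _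
      (MvPolynomial (Fin n) K)).toLinearMap)

theorem mixedForm_tmul (p : Components K V₀ V₁ W₀ W₁) (r : MvPolynomial (Fin n) K)
    (q : V₀ →ₗ[K] W₁) (s : MvPolynomial (Fin n) K) :
    mixedForm n B (p ⊗ₜ[K] r) (q ⊗ₜ[K] s) =
      ofComponents K V₀ V₁ W₀ W₁ (mixedBracket B p q) ⊗ₜ[K] 
        LinearMap.mul' K (Ω K n) (fn K _ r ⊗ₜ[K] dfn K _ s) := by
  simp [mixedForm]

theorem bar₂_compForm_homDiff (a : Components K V₀ V₁ W₀ W₁ ⊗[K] MvPolynomial (Fin n) K)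
    (b : (V₀ →ₗ[K] W₁) ⊗[K] MvPolynomial (Fin n) K) :
    bar₂ B n (compForm K V₀ V₁ W₀ W₁ n a ⊗ₜ[K] homDiff K V₀ V₁ W₀ W₁ n b) = mixedForm n B a b := by
  have h : ((TensorProduct.mk K _ _).compl₁₂ (compForm K V₀ V₁ W₀ W₁ n)
      (homDiff K V₀ V₁ W₀ W₁ n)).compr₂ (bar₂ B n) = mixedForm n B :=
    tensor_bilin_ext fun p r q s => by
      rw [mixedForm_tmul, ← conv₂_ofComponents_ofHom, LinearMap.compr₂_apply,
        LinearMap.compl₁₂_apply, TensorProduct.mk_apply, compForm, homDiff, TensorProduct.map_tmul,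
        TensorProduct.map_tmul, bar₂_tmul_even_left B _ _ _ (formsParity_fn r)]
  exact LinearMap.congr_fun₂ h a b

/-- Two signs cancel: the one-form passes the odd coefficient `p`, and `conv₂` is antisymmetric in
arguments of degrees `-1` and `0`. -/
theorem bar₂_homDiff_compForm (a : Components K V₀ V₁ W₀ W₁ ⊗[K] MvPolynomial (Fin n) K)
    (b : (V₀ →ₗ[K] W₁) ⊗[K] MvPolynomial (Fin n) K) :
    bar₂ B n (homDiff K V₀ V₁ W₀ W₁ n b ⊗ₜ[K] compForm K V₀ V₁ W₀ W₁ n a) = mixedForm n B a b := by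
  have h : ((TensorProduct.mk K _ _).compl₁₂ (homDiff K V₀ V₁ W₀ W₁ n)
      (compForm K V₀ V₁ W₀ W₁ n)).compr₂ (bar₂ B n) = (mixedForm n B).flip :=
    tensor_bilin_ext fun q s p r => by
      rw [LinearMap.flip_apply, mixedForm_tmul, ← conv₂_ofComponents_ofHom, LinearMap.compr₂_apply,
        LinearMap.compl₁₂_apply, TensorProduct.mk_apply, compForm, homDiff, TensorProduct.map_tmul,
        TensorProduct.map_tmul,
        bar₂_tmul_odd_odd B _ _ (convParity_ofComponents p) (formsParity_dfn s), conv₂_tmul_comm _ (convParity_ofComponents p) (convParity_ofHom q), neg_neg]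
      exact congrArg _ (mul'_tmul_fn r (dfn K (Fin n) s))
  exact LinearMap.congr_fun₂ h b a

theorem bar₂_homDiff_homDiff (b b' : (V₀ →ₗ[K] W₁) ⊗[K] MvPolynomial (Fin n) K) :
    bar₂ B n (homDiff K V₀ V₁ W₀ W₁ n b ⊗ₜ[K] homDiff K V₀ V₁ W₀ W₁ n b') = 0 := by
  have h : ((TensorProduct.mk K _ _).compl₁₂ (homDiff K V₀ V₁ W₀ W₁ n)
      (homDiff K V₀ V₁ W₀ W₁ n)).compr₂ (bar₂ B n) = 0 :=
    tensor_bilin_ext fun q s p r => by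
      rw [LinearMap.compr₂_apply, LinearMap.compl₁₂_apply, TensorProduct.mk_apply, homDiff,
        TensorProduct.map_tmul, TensorProduct.map_tmul,
        bar₂_tmul_even_right B _ _ _ (convParity_ofHom p), conv₂_ofHom_ofHom, TensorProduct.zero_tmul]
      rfl
  exact LinearMap.congr_fun₂ h b b'

theorem bar₃_truncate (t : (ConvForms K V₀ V₁ W₀ W₁ n ⊗[K] ConvForms K V₀ V₁ W₀ W₁ n) ⊗[K]
    ConvForms K V₀ V₁ W₀ W₁ n) :
    bar₃ B n (TensorProduct.map (TensorProduct.map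
      (TensorProduct.map (truncate K V₀ V₁ W₀ W₁) LinearMap.id)
      (TensorProduct.map (truncate K V₀ V₁ W₀ W₁) LinearMap.id))
      (TensorProduct.map (truncate K V₀ V₁ W₀ W₁) LinearMap.id) t) = bar₃ B n t := by
  refine (congrArg (TensorProduct.map (conv₃ B) _) (middleBraid_rTensor_map
    (formsParity K (Fin n)) convParity_comp_truncate t)).trans ?_
  rw [TensorProduct.map_map, LinearMap.comp_id]
  exact congrArg (fun c => TensorProduct.map c _ _) (LinearMap.ext (conv₃_truncate B))

theorem truncate_homDiff (b : (V₀ →ₗ[K] W₁) ⊗[K] MvPolynomial (Fin n) K) :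
    TensorProduct.map (truncate K V₀ V₁ W₀ W₁) LinearMap.id (homDiff K V₀ V₁ W₀ W₁ n b) = 0 := by
  induction b using TensorProduct.induction_on with
  | zero => simp only [map_zero]
  | add x y hx hy => simp only [map_add, hx, hy, add_zero]
  | tmul u v => rw [homDiff, TensorProduct.map_tmul, TensorProduct.map_tmul, truncate_ofHom,
      TensorProduct.zero_tmul]

/-- The one-form has coefficients with values in `W₁`, which truncation kills and `m₃` does not see.
-/
theorem bar₃_add_homDiff (x : ConvForms K V₀ V₁ W₀ W₁ n)
    (b : (V₀ →ₗ[K] W₁) ⊗[K] MvPolynomial (Fin n) K) :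
    bar₃ B n (((x + homDiff K V₀ V₁ W₀ W₁ n b) ⊗ₜ[K] (x + homDiff K V₀ V₁ W₀ W₁ n b)) ⊗ₜ[K]
      (x + homDiff K V₀ V₁ W₀ W₁ n b)) = bar₃ B n ((x ⊗ₜ[K] x) ⊗ₜ[K] x) := by
  rw [← bar₃_truncate, ← bar₃_truncate B ((x ⊗ₜ[K] x) ⊗ₜ[K] x)]
  simp only [TensorProduct.map_tmul, map_add, truncate_homDiff, add_zero]

/-- The nonlinear part of the Maurer-Cartan equation for polynomials with coefficients in
`L(V, W)`. -/
def polyNonlinear (x : Conv K V₀ V₁ W₀ W₁ ⊗[K] MvPolynomial (Fin n) K) :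
    Conv K V₀ V₁ W₀ W₁ ⊗[K] MvPolynomial (Fin n) K :=
  (-2⁻¹ : K) • polyBilin (Fin n) (TensorProduct.curry (conv₂ B)) x x +
    (-6⁻¹ : K) • polyBilin (Fin n) (TensorProduct.curry (conv₃ B))
        (polyBilin (Fin n) (TensorProduct.mk K (Conv K V₀ V₁ W₀ W₁) (Conv K V₀ V₁ W₀ W₁)) x x) x

theorem nonlinear_eq (α : ConvForms K V₀ V₁ W₀ W₁ n) :
    nonlinear B α = (-2⁻¹ : K) • bar₂ B n (α ⊗ₜ[K] α) +
      (-6⁻¹ : K) • bar₃ B n ((α ⊗ₜ[K] α) ⊗ₜ[K] α) := by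
  rw [nonlinear]
  module

/-- The one-form enters only linearly: its square vanishes, the cubic bracket ignores it, and the
two equal mixed terms absorb the factor `1/2`. -/
theorem nonlinear_compForm_add_homDiff
    (a : Components K V₀ V₁ W₀ W₁ ⊗[K] MvPolynomial (Fin n) K)
    (b : (V₀ →ₗ[K] W₁) ⊗[K] MvPolynomial (Fin n) K) :
    nonlinear B (compForm K V₀ V₁ W₀ W₁ n a + homDiff K V₀ V₁ W₀ W₁ n b) =
      coeffForm K V₀ V₁ W₀ W₁ n
        (polyNonlinear B (LinearMap.rTensor _ (ofComponents K V₀ V₁ W₀ W₁) a)) +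
      (-1 : K) • mixedForm n B a b := by
  rw [nonlinear_eq, bar₃_add_homDiff, polyNonlinear, map_add, map_smul, map_smul,
    ← bar₂_coeffForm, ← bar₃_coeffForm, ← compForm_eq]
  simp only [TensorProduct.add_tmul, TensorProduct.tmul_add, map_add, bar₂_compForm_homDiff,
    bar₂_homDiff_compForm, bar₂_homDiff_homDiff, add_zero]
  module

end FormBrackets

/-! ### Moving an infinity morphism along a polynomial family of maps. -/

section Transport

variable {K V₀ V₁ W₀ W₁ : Type*} [Field K]
  [AddCommGroup V₀] [Module K V₀] [AddCommGroup V₁] [Module K V₁]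
  [AddCommGroup W₀] [Module K W₀] [AddCommGroup W₁] [Module K W₁]
  {A : TwoTermLeibniz K V₀ V₁} {B : TwoTermLeibniz K W₀ W₁}

variable (V₀ V₁ B) in
/-- The bilinear map `(q, r) ↦ ((x, y) ↦ [q x, l₁ (r y)])`. -/
def crossBracket : (V₀ →ₗ[K] W₁) →ₗ[K] (V₀ →ₗ[K] W₁) →ₗ[K] Components K V₀ V₁ W₀ W₁ :=
  LinearMap.mk₂ K (fun q r => (0, 0, B.l10.compl₁₂ q (B.l1 ∘ₗ r)))
    (by intros; ext <;> simp) (by intros; ext <;> simp)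
    (by intros; ext <;> simp) (by intros; ext <;> simp)

variable (A B) in
-- By `l1_comm`, `[l₁ (q x), r y] = [q x, l₁ (r y)]`; this makes the expression symmetric in `q` and
-- `r`.
theorem mixedBracket_linearPart (q r : V₀ →ₗ[K] W₁) :
    mixedBracket B (linearPart A B q) r = crossBracket V₀ V₁ B q r + crossBracket V₀ V₁ B r q := by
  ext <;> simp [mixedBracket, linearPart, crossBracket, B.l1_comm]

/-- The components of an infinity morphism. -/
def InftyMorphism.components (f : InftyMorphism A B) : Components K V₀ V₁ W₀ W₁ :=
  (f.f0, f.f1, f.f2)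

theorem InftyMorphism.toConv_eq (f : InftyMorphism A B) :
    f.toConv = ofComponents K V₀ V₁ W₀ W₁ f.components := rfl

theorem InftyMorphism.components_translate (f : InftyMorphism A B) (θ : V₀ →ₗ[K] W₁) :
    (f.translate θ).components = f.components + linearPart A B θ - mixedBracket B f.components θ -
      crossBracket V₀ V₁ B θ θ := by
  ext
  · simp [components, translate, linearPart, mixedBracket, crossBracket]
  · simp [components, translate, linearPart, mixedBracket, crossBracket]
  · simp only [components, translate, linearPart, mixedBracket, crossBracket, LinearMap.mk₂_apply,
      LinearMap.coe_mk, AddHom.coe_mk, Prod.snd_sub, Prod.snd_add, LinearMap.sub_apply,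
      LinearMap.add_apply]
    abel

variable {n : ℕ}

/-- The components of the infinity morphisms obtained by moving `g` along the homotopies `b(t)`,
for `t` in the simplex. -/
def InftyMorphism.transport (g : InftyMorphism A B)
    (b : (V₀ →ₗ[K] W₁) ⊗[K] MvPolynomial (Fin n) K) :
    Components K V₀ V₁ W₀ W₁ ⊗[K] MvPolynomial (Fin n) K :=
  g.components ⊗ₜ[K] 1 + LinearMap.rTensor _ (linearPart A B) b -
    LinearMap.rTensor _ (mixedBracket B g.components) b -
    polyBilin (Fin n) (crossBracket V₀ V₁ B) b b

theorem InftyMorphism.evalAt_transport (g : InftyMorphism A B) (t : Fin n → K)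
    (b : (V₀ →ₗ[K] W₁) ⊗[K] MvPolynomial (Fin n) K) :
    evalAt (Components K V₀ V₁ W₀ W₁) t (g.transport b) =
      (g.translate (evalAt (V₀ →ₗ[K] W₁) t b)).components := by
  rw [g.components_translate, transport, map_sub, map_sub, map_add, evalAt_rTensor, evalAt_rTensor,
    evalAt_polyBilin, evalAt_tmul, map_one, one_smul]

end Transport

/-! ### Families of translates solve the Maurer-Cartan equation and are Kan limits. -/

section MaurerCartanForms

variable {K V₀ V₁ W₀ W₁ : Type*} [Field K] [CharZero K]
  [AddCommGroup V₀] [Module K V₀] [AddCommGroup V₁] [Module K V₁]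
  [AddCommGroup W₀] [Module K W₀] [AddCommGroup W₁] [Module K W₁]
  {A : TwoTermLeibniz K V₀ V₁} {B : TwoTermLeibniz K W₀ W₁} {n : ℕ}

theorem mul'_one_tmul_dfn (r : MvPolynomial (Fin n) K) :
    LinearMap.mul' K (Ω K n) (fn K _ 1 ⊗ₜ[K] dfn K _ r) = dfn K _ r := by
  rw [LinearMap.mul'_apply, fn_one, one_mul]

theorem dfn_mul_eq (r s : MvPolynomial (Fin n) K) :
    dfn K _ (r * s) = LinearMap.mul' K (Ω K n) (fn K _ r ⊗ₜ[K] dfn K _ s) +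
      LinearMap.mul' K (Ω K n) (fn K _ s ⊗ₜ[K] dfn K _ r) := by
  rw [LinearMap.mul'_apply, LinearMap.mul'_apply, dfn_mul]

theorem mixedForm_tmul_one (p : Components K V₀ V₁ W₀ W₁)
    (b : (V₀ →ₗ[K] W₁) ⊗[K] MvPolynomial (Fin n) K) :
    mixedForm n B (p ⊗ₜ[K] 1) b =
      compDiff K V₀ V₁ W₀ W₁ n (LinearMap.rTensor _ (mixedBracket B p) b) := by
  induction b using TensorProduct.induction_on with
  | zero => simp only [map_zero]
  | add x y hx hy => simp only [map_add, hx, hy]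
  | tmul q s => rw [mixedForm_tmul, LinearMap.rTensor_tmul, compDiff, TensorProduct.map_tmul,
      mul'_one_tmul_dfn]

variable (A B) in
-- The polarization of `mixedForm_linearPart`. Being bilinear it can be checked on pure tensors,
-- where it combines `mixedBracket_linearPart` with `d(rs) = r ds + s dr`.
theorem mixedForm_linearPart_add (b b' : (V₀ →ₗ[K] W₁) ⊗[K] MvPolynomial (Fin n) K) :
    mixedForm n B (LinearMap.rTensor _ (linearPart A B) b) b' +
        mixedForm n B (LinearMap.rTensor _ (linearPart A B) b') b =
      compDiff K V₀ V₁ W₀ W₁ n (polyBilin (Fin n) (crossBracket V₀ V₁ B) b b') +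
        compDiff K V₀ V₁ W₀ W₁ n (polyBilin (Fin n) (crossBracket V₀ V₁ B) b' b) := by
  have h : mixedForm n B ∘ₗ LinearMap.rTensor _ (linearPart A B) +
      (mixedForm n B ∘ₗ LinearMap.rTensor _ (linearPart A B)).flip =
      (polyBilin (Fin n) (crossBracket V₀ V₁ B)).compr₂ (compDiff K V₀ V₁ W₀ W₁ n) +
      ((polyBilin (Fin n) (crossBracket V₀ V₁ B)).compr₂ (compDiff K V₀ V₁ W₀ W₁ n)).flip :=
    tensor_bilin_ext fun q r q' s => by
      simp only [LinearMap.add_apply, LinearMap.flip_apply, LinearMap.comp_apply,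
        LinearMap.compr₂_apply, LinearMap.rTensor_tmul, mixedForm_tmul, polyBilin_tmul, compDiff,
        TensorProduct.map_tmul, mixedBracket_linearPart, dfn_mul_eq, map_add,
        TensorProduct.add_tmul, TensorProduct.tmul_add]
      abel
  exact LinearMap.congr_fun₂ h b b'

variable (A B) in
theorem mixedForm_linearPart (b : (V₀ →ₗ[K] W₁) ⊗[K] MvPolynomial (Fin n) K) :
    mixedForm n B (LinearMap.rTensor _ (linearPart A B) b) b =
      compDiff K V₀ V₁ W₀ W₁ n (polyBilin (Fin n) (crossBracket V₀ V₁ B) b b) := by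
  have h := mixedForm_linearPart_add A B b b
  rw [← two_smul K, ← two_smul K] at h
  exact smul_right_injective _ (two_ne_zero (α := K)) h

theorem mixedForm_congr {a a' : Components K V₀ V₁ W₀ W₁ ⊗[K] MvPolynomial (Fin n) K}
    (b : (V₀ →ₗ[K] W₁) ⊗[K] MvPolynomial (Fin n) K)
    (h : LinearMap.rTensor _ (LinearMap.fst K _ _) a =
      LinearMap.rTensor _ (LinearMap.fst K _ _) a') :
    mixedForm n B a b = mixedForm n B a' b := by
  have e : mixedForm (V₀ := V₀) (V₁ := V₁) n B = mixedForm n B ∘ₗ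
      LinearMap.rTensor _ (LinearMap.inl K _ _) ∘ₗ LinearMap.rTensor _ (LinearMap.fst K _ _) :=
    tensor_bilin_ext fun p r q s => by
      simp only [LinearMap.comp_apply, LinearMap.rTensor_tmul, mixedForm_tmul]
      rfl
  rw [e, LinearMap.comp_apply, LinearMap.comp_apply, LinearMap.comp_apply, LinearMap.comp_apply, h]

/-- Once the `V₀ → W₀` component is that of `g + l₁ b`, the mixed term is exact with an explicit
primitive, and `h` can be evaluated on it. -/
theorem mixedForm_of_fst_eq (g : InftyMorphism A B)
    {a : Components K V₀ V₁ W₀ W₁ ⊗[K] MvPolynomial (Fin n) K}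
    {b : (V₀ →ₗ[K] W₁) ⊗[K] MvPolynomial (Fin n) K}
    (h : LinearMap.rTensor _ (LinearMap.fst K _ _) a = LinearMap.rTensor _ (LinearMap.fst K _ _)
      (g.components ⊗ₜ[K] 1 + LinearMap.rTensor _ (linearPart A B) b)) :
    mixedForm n B a b = compDiff K V₀ V₁ W₀ W₁ n
      (LinearMap.rTensor _ (mixedBracket B g.components) b +
        polyBilin (Fin n) (crossBracket V₀ V₁ B) b b) := by
  rw [mixedForm_congr b h, map_add, LinearMap.add_apply, mixedForm_tmul_one, mixedForm_linearPart,
    map_add]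

/-- The two correction terms in `transport` affect only the component `V₀ × V₀ → W₁`. -/
theorem InftyMorphism.fst_transport (g : InftyMorphism A B)
    (b : (V₀ →ₗ[K] W₁) ⊗[K] MvPolynomial (Fin n) K) :
    LinearMap.rTensor _ (LinearMap.fst K _ _) (g.transport b) =
      LinearMap.rTensor _ (LinearMap.fst K _ _)
        (g.components ⊗ₜ[K] 1 + LinearMap.rTensor _ (linearPart A B) b) := by
  have h₁ : ∀ x, LinearMap.rTensor (MvPolynomial (Fin n) K) (LinearMap.fst K _ _)
      (LinearMap.rTensor (MvPolynomial (Fin n) K) (mixedBracket B g.components) x) = 0 := by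
    intro x
    induction x using TensorProduct.induction_on with
    | zero => simp only [map_zero]
    | add x y hx hy => simp only [map_add, hx, hy, add_zero]
    | tmul q s =>
      rw [LinearMap.rTensor_tmul, LinearMap.rTensor_tmul]
      exact TensorProduct.zero_tmul _ _
  have h₂ : (polyBilin (Fin n) (crossBracket V₀ V₁ B)).compr₂
      (LinearMap.rTensor (MvPolynomial (Fin n) K) (LinearMap.fst K _ _)) = 0 :=
    tensor_bilin_ext fun q r q' s => by
      rw [LinearMap.compr₂_apply, polyBilin_tmul, LinearMap.rTensor_tmul]
      exact TensorProduct.zero_tmul _ _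
  have h₃ := LinearMap.congr_fun₂ h₂ b b
  rw [LinearMap.compr₂_apply] at h₃
  rw [transport, map_sub, map_sub, h₁, h₃, sub_zero]
  exact sub_zero _

theorem evalAt_polyBilin_curry {K L σ : Type*} [CommSemiring K] [AddCommMonoid L] [Module K L]
    (c : L ⊗[K] L →ₗ[K] L) (x : L ⊗[K] MvPolynomial σ K) (t : σ → K) :
    evalAt L t (polyBilin σ (TensorProduct.curry c) x x) =
      c (evalAt L t x ⊗ₜ[K] evalAt L t x) := by
  rw [evalAt_polyBilin, TensorProduct.curry_apply]

theorem evalAt_polyBilin_curry_polyBilin {K L σ : Type*} [CommSemiring K] [AddCommMonoid L]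
    [Module K L] (c : (L ⊗[K] L) ⊗[K] L →ₗ[K] L) (x : L ⊗[K] MvPolynomial σ K) (t : σ → K) :
    evalAt L t (polyBilin σ (TensorProduct.curry c)
      (polyBilin σ (TensorProduct.mk K L L) x x) x) =
      c ((evalAt L t x ⊗ₜ[K] evalAt L t x) ⊗ₜ[K] evalAt L t x) := by
  rw [evalAt_polyBilin, evalAt_polyBilin, TensorProduct.curry_apply, TensorProduct.mk_apply]

variable (B) in
theorem evalAt_polyNonlinear (x : Conv K V₀ V₁ W₀ W₁ ⊗[K] MvPolynomial (Fin n) K) (t : Fin n → K) :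
    evalAt (Conv K V₀ V₁ W₀ W₁) t (polyNonlinear B x) =
      (-2⁻¹ : K) • conv₂ B (evalAt _ t x ⊗ₜ[K] evalAt _ t x) +
      (-6⁻¹ : K) • conv₃ B ((evalAt _ t x ⊗ₜ[K] evalAt _ t x) ⊗ₜ[K] evalAt _ t x) := by
  rw [polyNonlinear, map_add, map_smul, map_smul, evalAt_polyBilin_curry,
    evalAt_polyBilin_curry_polyBilin]

/-- At each point the value is a translate of `g`, hence an infinity morphism, and a polynomial that
vanishes at all points is zero. -/
theorem InftyMorphism.transport_maurerCartan (g : InftyMorphism A B)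
    (b : (V₀ →ₗ[K] W₁) ⊗[K] MvPolynomial (Fin n) K) :
    LinearMap.rTensor _ (conv₁ A B ∘ₗ ofComponents K V₀ V₁ W₀ W₁) (g.transport b) +
      polyNonlinear B (LinearMap.rTensor _ (ofComponents K V₀ V₁ W₀ W₁) (g.transport b)) = 0 := by
  refine eq_zero_of_forall_evalAt _ fun t => ?_
  have h := (g.translate (evalAt (V₀ →ₗ[K] W₁) t b)).toConv_maurerCartan
  rw [InftyMorphism.toConv_eq, ← evalAt_transport] at h
  rw [map_add, evalAt_polyNonlinear, evalAt_rTensor, evalAt_rTensor, ← h,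
    LinearMap.comp_apply]
  generalize ofComponents K V₀ V₁ W₀ W₁ (evalAt (Components K V₀ V₁ W₀ W₁) t (g.transport b)) = u
  generalize conv₁ A B u = x, conv₂ B (u ⊗ₜ[K] u) = y, conv₃ B ((u ⊗ₜ[K] u) ⊗ₜ[K] u) = z
  module

theorem InftyMorphism.transport_add (g : InftyMorphism A B)
    (b : (V₀ →ₗ[K] W₁) ⊗[K] MvPolynomial (Fin n) K) :
    g.transport b + (LinearMap.rTensor _ (mixedBracket B g.components) b +
        polyBilin (Fin n) (crossBracket V₀ V₁ B) b b) =
      g.components ⊗ₜ[K] 1 + LinearMap.rTensor _ (linearPart A B) b := by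
  rw [transport]
  abel

/-- The element of `L(V, W) ⊗ Ω_n` with the components `g.transport b` and `b`. -/
def InftyMorphism.family (g : InftyMorphism A B) (b : (V₀ →ₗ[K] W₁) ⊗[K] MvPolynomial (Fin n) K) :
    ConvForms K V₀ V₁ W₀ W₁ n :=
  compForm K V₀ V₁ W₀ W₁ n (g.transport b) + homDiff K V₀ V₁ W₀ W₁ n b

/-- The function part is `transport_maurerCartan`; the one-form part is `h`, the differential of
`transport_add`. -/
theorem InftyMorphism.family_maurerCartan (g : InftyMorphism A B)
    (b : (V₀ →ₗ[K] W₁) ⊗[K] MvPolynomial (Fin n) K) :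
    bar₁ A B n (g.family b) + nonlinear B (g.family b) = 0 := by
  have h : compDiff K V₀ V₁ W₀ W₁ n (g.transport b) +
      mixedForm n B (g.transport b) b =
      compDiff K V₀ V₁ W₀ W₁ n (LinearMap.rTensor _ (linearPart A B) b) := by
    rw [mixedForm_of_fst_eq g (g.fst_transport b), ← map_add, g.transport_add, map_add, compDiff_tmul_one, zero_add]
  have hz := congrArg (coeffForm K V₀ V₁ W₀ W₁ n) (g.transport_maurerCartan b)
  rw [map_add, map_zero] at hz
  rw [family, nonlinear_compForm_add_homDiff, map_add, bar₁_compForm, bar₁_homDiff, ← h]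
  refine Eq.trans ?_ hz
  module

variable (B) in
theorem kanIter_succ (i : Fin (n + 1)) (μ : Conv K V₀ V₁ W₀ W₁) (ν : ConvForms K V₀ V₁ W₀ W₁ n)
    (k : ℕ) : kanIter B i μ ν (k + 1) = μ ⊗ₜ[K] 1 + ν +
      (-1 : K) • hBar i (nonlinear B (kanIter B i μ ν k)) := by
  rw [kanIter]
  module

theorem InftyMorphism.toConv_tmul_one_add_bar₁ (g : InftyMorphism A B)
    (b : (V₀ →ₗ[K] W₁) ⊗[K] MvPolynomial (Fin n) K) :
    g.toConv ⊗ₜ[K] (1 : Ω K n) + bar₁ A B n (homForm K V₀ V₁ W₀ W₁ n b) =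
      compForm K V₀ V₁ W₀ W₁ n
        (g.components ⊗ₜ[K] 1 + LinearMap.rTensor _ (linearPart A B) b) +
        homDiff K V₀ V₁ W₀ W₁ n b := by
  rw [bar₁_homForm, ← add_assoc, map_add, compForm, TensorProduct.map_tmul, fn_one, g.toConv_eq]

/-- `h` kills the function part of the nonlinear term, and the mixed part depends only on the `V₀ →
W₀` component, which the iteration never changes. Hence one step already gives the limit; the start
value itself still lacks the correction terms. -/
theorem InftyMorphism.kanIter_homForm (g : InftyMorphism A B) (i : Fin (n + 1))
    {b : (V₀ →ₗ[K] W₁) ⊗[K] MvPolynomial (Fin n) K}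
    (hb : evalAt (V₀ →ₗ[K] W₁) (vertex K i) b = 0) (k : ℕ) :
    kanIter B i g.toConv (bar₁ A B n (homForm K V₀ V₁ W₀ W₁ n b)) (k + 1) = g.family b := by
  have step : ∀ {a : Components K V₀ V₁ W₀ W₁ ⊗[K] MvPolynomial (Fin n) K} {k : ℕ},
      LinearMap.rTensor _ (LinearMap.fst K _ _) a = LinearMap.rTensor _ (LinearMap.fst K _ _)
        (g.components ⊗ₜ[K] 1 + LinearMap.rTensor _ (linearPart A B) b) →
      kanIter B i g.toConv (bar₁ A B n (homForm K V₀ V₁ W₀ W₁ n b)) k =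
        compForm K V₀ V₁ W₀ W₁ n a + homDiff K V₀ V₁ W₀ W₁ n b →
      kanIter B i g.toConv (bar₁ A B n (homForm K V₀ V₁ W₀ W₁ n b)) (k + 1) = g.family b := by
    intro a k ha hk
    have e : ∀ x : Components K V₀ V₁ W₀ W₁ ⊗[K] MvPolynomial (Fin n) K, x - 0 = x :=
      fun x => by abel
    -- The primitive of the mixed term vanishes at the vertex together with `b`, so `h` returns it
    -- without a constant, and subtracting it from the start value gives `transport`.
    rw [kanIter_succ, hk, nonlinear_compForm_add_homDiff, mixedForm_of_fst_eq g ha,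
      map_add (hBar i), hBar_map_fn, map_smul (hBar i), hBar_compDiff, map_add (evalAt _ _),
      evalAt_rTensor, evalAt_polyBilin, hb, map_zero, map_zero, add_zero,
      TensorProduct.zero_tmul, e, toConv_tmul_one_add_bar₁, family,
      ← g.transport_add, map_add _ (g.transport b)]
    module
  induction k with
  | zero => exact step rfl (g.toConv_tmul_one_add_bar₁ b)
  | succ k ih => exact step (g.fst_transport b) ih

theorem InftyMorphism.isKanLimit_homForm (g : InftyMorphism A B) (i : Fin (n + 1))
    {b : (V₀ →ₗ[K] W₁) ⊗[K] MvPolynomial (Fin n) K}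
    (hb : evalAt (V₀ →ₗ[K] W₁) (vertex K i) b = 0) :
    IsKanLimit B i g.toConv (bar₁ A B n (homForm K V₀ V₁ W₀ W₁ n b)) (g.family b) := by
  refine ⟨1, fun k hk => ?_⟩
  obtain ⟨k, rfl⟩ := Nat.exists_eq_add_of_le' hk
  exact g.kanIter_homForm i hb k

end MaurerCartanForms

/-! ### The space `L` in degrees `≥ -1`. -/

section Degrees

variable {K V₀ V₁ W₀ W₁ : Type*} [Field K]
  [AddCommGroup V₀] [Module K V₀] [AddCommGroup V₁] [Module K V₁]
  [AddCommGroup W₀] [Module K W₀] [AddCommGroup W₁] [Module K W₁]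

variable (K) in
/-- The word with the given homogeneous letters. -/
abbrev listWord (l : List (V₀ ⊕ V₁)) : Words K V₀ V₁ :=
  (l.map fun u => TensorAlgebra.ι K (letter V₀ V₁ u)).prod

theorem listWord_cons (u : V₀ ⊕ V₁) (l : List (V₀ ⊕ V₁)) :
    listWord K (u :: l) = TensorAlgebra.ι K (letter V₀ V₁ u) * listWord K l := by
  simp [listWord]

theorem part₀_cons (x : V₀ × V₁) (w : Words K V₀ V₁) :
    part₀ (TensorAlgebra.ι K x * w) = coeff₀ w • x.1 :=
  congrArg Prod.fst (part₁_cons x w)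

theorem letter_add_letter (x : V₀ × V₁) :
    letter V₀ V₁ (Sum.inl x.1) + letter V₀ V₁ (Sum.inr x.2) = x := by
  simp [letter]

/-- Words in homogeneous letters span. The prefix `l` is carried along so that the letters of an
arbitrary word can be split into homogeneous parts one after another. -/
theorem conv_ext {f g : Conv K V₀ V₁ W₀ W₁}
    (h : ∀ l v, f (listWord K l ⊗ₜ[K] letter V₀ V₁ v) = g (listWord K l ⊗ₜ[K] letter V₀ V₁ v)) :
    f = g := by
  have key : ∀ (w : Words K V₀ V₁) l v, f ((listWord K l * w) ⊗ₜ[K] letter V₀ V₁ v) =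
      g ((listWord K l * w) ⊗ₜ[K] letter V₀ V₁ v) := by
    intro w
    induction w using word_induction_left with
    | one => intro l v; rw [mul_one, h]
    | add w w' hw hw' => intro l v; rw [mul_add, TensorProduct.add_tmul, map_add, map_add, hw, hw']
    | smul c w hw =>
      intro l v
      rw [mul_smul_comm, ← TensorProduct.smul_tmul', map_smul, map_smul, hw]
    | cons x w hw =>
      intro l v
      have e : ∀ u, listWord K l * (TensorAlgebra.ι K (letter V₀ V₁ u) * w) =
          listWord K (l ++ [u]) * w := fun u => by simp [listWord, mul_assoc]
      rw [← letter_add_letter x, map_add, add_mul, mul_add, e, e, TensorProduct.add_tmul, map_add,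
        map_add, hw, hw]
  refine TensorProduct.ext' fun w x => ?_
  have := key w []
  simp only [listWord, List.map_nil, List.prod_nil, one_mul] at this
  rw [← letter_add_letter x, TensorProduct.tmul_add, map_add, map_add, this, this]

theorem length_le_sum_letterDeg (l : List (V₀ ⊕ V₁)) :
    (l.length : ℤ) ≤ (l.map (letterDeg V₀ V₁)).sum := by
  induction l with
  | nil => simp
  | cons u l ih =>
    rw [List.map_cons, List.sum_cons, List.length_cons]
    rcases u with x | h <;> simp only [letterDeg, Sum.elim_inl, Sum.elim_inr] at ih ⊢ <;>
      push_cast <;> linarith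

theorem one_le_letterDeg (v : V₀ ⊕ V₁) : 1 ≤ letterDeg V₀ V₁ v := by
  rcases v with x | h <;> simp [letterDeg]

theorem eq_zero_of_mem_degPart {j : ℤ} (hj : 2 ≤ j) {w : W₀ × W₁} (h : w ∈ degPart K W₀ W₁ j) :
    w = 0 := Prod.ext (h.1 (by lia)) (h.2 (by lia))

theorem apply_eq_zero_of_mem_convDeg {k : ℤ} {f : Conv K V₀ V₁ W₀ W₁}
    (hf : f ∈ convDeg K V₀ V₁ W₀ W₁ k) {l : List (V₀ ⊕ V₁)} (hl : 1 ≤ l.length + k)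
    (v : V₀ ⊕ V₁) : f (listWord K l ⊗ₜ[K] letter V₀ V₁ v) = 0 := by
  have h₁ := length_le_sum_letterDeg l
  have h₂ := one_le_letterDeg v
  exact eq_zero_of_mem_degPart (by lia) (hf l v)

/-- A word has degree at least `1`, so its image would lie in degree at least `2`, where `W` is
zero. -/
theorem eq_zero_of_mem_convDeg {k : ℤ} (hk : 1 ≤ k) {f : Conv K V₀ V₁ W₀ W₁}
    (hf : f ∈ convDeg K V₀ V₁ W₀ W₁ k) : f = 0 :=
  conv_ext fun l v => by
    rw [apply_eq_zero_of_mem_convDeg hf (by lia)]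
    rfl

/-- Only a single letter of `sV₀` has degree small enough to have a nonzero image, and this image
lies in `W₁`. -/
theorem exists_ofHom_of_mem_convDeg {f : Conv K V₀ V₁ W₀ W₁}
    (hf : f ∈ convDeg K V₀ V₁ W₀ W₁ 0) : ∃ q, ofHom K V₀ V₁ W₀ W₁ q = f := by
  refine ⟨LinearMap.snd K W₀ W₁ ∘ₗ f ∘ₗ TensorProduct.mk K _ _ 1 ∘ₗ LinearMap.inl K V₀ V₁,
    conv_ext fun l v => ?_⟩
  rw [ofHom_tmul]
  rcases l with _ | ⟨u, l⟩
  · have h := hf [] v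
    rcases v with x | x
    · simp only [listWord, List.map_nil, List.prod_nil, coeff₀_one, one_smul]
      simp only [List.map_nil, List.prod_nil, List.sum_nil, letterDeg, Sum.elim_inl] at h
      exact Prod.ext (h.1 (by norm_num)).symm rfl
    · simp only [List.map_nil, List.prod_nil, List.sum_nil, letterDeg, Sum.elim_inr] at h
      have h' := eq_zero_of_mem_degPart (by norm_num) h
      simp only [listWord, List.map_nil, List.prod_nil, h']
      simp [letter, Prod.mk_zero_zero]
  · rw [apply_eq_zero_of_mem_convDeg hf (by simp), listWord_cons, coeff₀_cons, zero_smul]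
    rfl

/-- The words of degree at most `2` are one letter of `sV₀`, one letter of `sV₁`, or two letters of
`sV₀`; they give the three components. -/
theorem exists_ofComponents_of_mem_convDeg {f : Conv K V₀ V₁ W₀ W₁}
    (hf : f ∈ convDeg K V₀ V₁ W₀ W₁ (-1)) : ∃ p, ofComponents K V₀ V₁ W₀ W₁ p = f := by
  refine ⟨(LinearMap.fst K W₀ W₁ ∘ₗ f ∘ₗ TensorProduct.mk K _ _ 1 ∘ₗ LinearMap.inl K V₀ V₁,
    LinearMap.snd K W₀ W₁ ∘ₗ f ∘ₗ TensorProduct.mk K _ _ 1 ∘ₗ LinearMap.inr K V₀ V₁,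
    ((TensorProduct.mk K _ _).compl₁₂ (TensorAlgebra.ι K ∘ₗ LinearMap.inl K V₀ V₁)
      (LinearMap.inl K V₀ V₁)).compr₂ (LinearMap.snd K W₀ W₁ ∘ₗ f)), conv_ext fun l v => ?_⟩
  rw [ofComponents_tmul]
  rcases l with _ | ⟨u, _ | ⟨u', l⟩⟩
  · have h := hf [] v
    rcases v with x | x
    · simp only [List.map_nil, List.prod_nil, List.sum_nil, letterDeg, Sum.elim_inl] at h
      simp only [listWord, List.map_nil, List.prod_nil, coeff₀_one, one_smul, LinearMap.comp_apply,
        split_one, map_zero, LinearMap.zero_apply]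
      refine Prod.ext rfl (Eq.trans ?_ (h.2 (by norm_num)).symm)
      simp [letter, Prod.mk_zero_zero]
    · simp only [List.map_nil, List.prod_nil, List.sum_nil, letterDeg, Sum.elim_inr] at h
      simp only [listWord, List.map_nil, List.prod_nil, coeff₀_one, one_smul, LinearMap.comp_apply,
        split_one, map_zero, LinearMap.zero_apply]
      refine Prod.ext (Eq.trans ?_ (h.1 (by norm_num)).symm) ?_
      · simp [letter, Prod.mk_zero_zero]
      · simp [letter]
  · have h := hf [u] v
    have hu : listWord K [u] = TensorAlgebra.ι K (letter V₀ V₁ u) * 1 := by simp [listWord]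
    have hu' : listWord K [u] = TensorAlgebra.ι K (letter V₀ V₁ u) := by simp [listWord]
    rw [hu, coeff₀_cons, part₀_cons, coeff₀_one, one_smul, ← hu, zero_smul, zero_smul, zero_add]
    rcases u with x | x <;> rcases v with y | y
    · refine Prod.ext (h.1 (by simp [letterDeg])).symm ?_
      rw [hu']; rfl
    all_goals
      rw [eq_zero_of_mem_degPart (by simp [letterDeg]) h]
      simp [letter, Prod.mk_zero_zero]
  · rw [apply_eq_zero_of_mem_convDeg hf (by simp), listWord_cons, coeff₀_cons, part₀_cons,
      listWord_cons, coeff₀_cons]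
    simp

theorem ofHom_mem_convDeg (q : V₀ →ₗ[K] W₁) :
    ofHom K V₀ V₁ W₀ W₁ q ∈ convDeg K V₀ V₁ W₀ W₁ 0 := by
  intro l v
  rw [ofHom_tmul]
  rcases l with _ | ⟨u, l⟩
  · rcases v with x | x
    · exact ⟨fun _ => rfl, fun h => by simp [letterDeg] at h⟩
    · exact ⟨fun _ => rfl, fun _ => by simp [letter]⟩
  · have e : coeff₀ (listWord K (u :: l)) = 0 := by rw [listWord_cons, coeff₀_cons]
    rw [e, zero_smul]
    exact Submodule.zero_mem _

theorem ofComponents_mem_convDeg (p : Components K V₀ V₁ W₀ W₁) :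
    ofComponents K V₀ V₁ W₀ W₁ p ∈ convDeg K V₀ V₁ W₀ W₁ (-1) := by
  intro l v
  rw [ofComponents_tmul]
  rcases l with _ | ⟨u, _ | ⟨u', l⟩⟩
  · rcases v with x | x
    · exact ⟨fun h => by simp [letterDeg] at h, fun _ => by simp [letter, split_one]⟩
    · exact ⟨fun _ => by simp [letter], fun h => by simp [letterDeg] at h⟩
  · have hu : ([u].map fun u => TensorAlgebra.ι K (letter V₀ V₁ u)).prod =
      TensorAlgebra.ι K (letter V₀ V₁ u) * 1 := by simp
    rw [hu, coeff₀_cons, part₀_cons, coeff₀_one, one_smul, zero_smul, zero_smul, zero_add]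
    refine ⟨fun _ => rfl, fun h => ?_⟩
    rcases u with x | x <;> rcases v with y | y <;> simp [letterDeg, letter] at h ⊢
  · have e : coeff₀ (listWord K (u :: u' :: l)) = 0 := by rw [listWord_cons, coeff₀_cons]
    have e' : part₀ (listWord K (u :: u' :: l)) = 0 := by
      rw [listWord_cons, part₀_cons, listWord_cons, coeff₀_cons, zero_smul]
    rw [e, e', zero_smul, zero_smul, map_zero, LinearMap.zero_apply, add_zero]
    exact Submodule.zero_mem _

end Degrees

/-! ### Elements of degrees `0` and `-1` of `L ⊗ Ω_n`. -/

section FormDegrees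

variable {K V₀ V₁ W₀ W₁ : Type*} [Field K]
  [AddCommGroup V₀] [Module K V₀] [AddCommGroup V₁] [Module K V₁]
  [AddCommGroup W₀] [Module K W₀] [AddCommGroup W₁] [Module K W₁] {n : ℕ}

theorem tmul_mem_convFormsDeg {k m : ℤ} {j : ℕ} (h : m = k + j) {f : Conv K V₀ V₁ W₀ W₁}
    {ω : Ω K n} (hf : f ∈ convDeg K V₀ V₁ W₀ W₁ m) (hω : ω ∈ formsDeg K (Fin n) j) :
    f ⊗ₜ[K] ω ∈ convFormsDeg K V₀ V₁ W₀ W₁ n k := by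
  subst h
  exact Submodule.mem_iSup_of_mem j ⟨⟨f, hf⟩ ⊗ₜ[K] ⟨ω, hω⟩, rfl⟩

theorem convFormsDeg_le {k : ℤ} {S : Submodule K (ConvForms K V₀ V₁ W₀ W₁ n)}
    (h : ∀ (j : ℕ) (f : Conv K V₀ V₁ W₀ W₁) (ω : Ω K n), f ∈ convDeg K V₀ V₁ W₀ W₁ (k + j) →
      ω ∈ formsDeg K (Fin n) j → f ⊗ₜ[K] ω ∈ S) : convFormsDeg K V₀ V₁ W₀ W₁ n k ≤ S := by
  refine iSup_le fun j => ?_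
  rintro _ ⟨u, rfl⟩
  induction u using TensorProduct.induction_on with
  | zero => rw [map_zero]; exact S.zero_mem
  | add x y hx hy => rw [map_add]; exact S.add_mem hx hy
  | tmul f ω => exact h j f ω f.2 ω.2

theorem homForm_mem_convFormsDeg (b : (V₀ →ₗ[K] W₁) ⊗[K] MvPolynomial (Fin n) K) :
    homForm K V₀ V₁ W₀ W₁ n b ∈ convFormsDeg K V₀ V₁ W₀ W₁ n 0 := by
  induction b using TensorProduct.induction_on with
  | zero => rw [map_zero]; exact Submodule.zero_mem _
  | add x y hx hy => rw [map_add]; exact Submodule.add_mem _ hx hy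
  | tmul q p =>
    rw [homForm, TensorProduct.map_tmul]
    exact tmul_mem_convFormsDeg (by simp) (ofHom_mem_convDeg q) (fn_mem_formsDeg p)

theorem exists_homForm_of_mem_convFormsDeg {x : ConvForms K V₀ V₁ W₀ W₁ n}
    (hx : x ∈ convFormsDeg K V₀ V₁ W₀ W₁ n 0) : ∃ b, homForm K V₀ V₁ W₀ W₁ n b = x := by
  refine convFormsDeg_le (S := LinearMap.range (homForm K V₀ V₁ W₀ W₁ n)) (fun j f ω hf hω => ?_) hx
  rcases j with _ | j
  · obtain ⟨q, rfl⟩ := exists_ofHom_of_mem_convDeg hf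
    obtain ⟨p, rfl⟩ := exists_fn_of_mem_formsDeg hω
    exact ⟨q ⊗ₜ[K] p, rfl⟩
  · rw [eq_zero_of_mem_convDeg (by push_cast; lia) hf, TensorProduct.zero_tmul]
    exact Submodule.zero_mem _

theorem compForm_add_homDiff_mem_convFormsDeg
    (a : Components K V₀ V₁ W₀ W₁ ⊗[K] MvPolynomial (Fin n) K)
    (b : (V₀ →ₗ[K] W₁) ⊗[K] MvPolynomial (Fin n) K) :
    compForm K V₀ V₁ W₀ W₁ n a + homDiff K V₀ V₁ W₀ W₁ n b ∈
      convFormsDeg K V₀ V₁ W₀ W₁ n (-1) := by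
  refine Submodule.add_mem _ ?_ ?_
  · induction a using TensorProduct.induction_on with
    | zero => rw [map_zero]; exact Submodule.zero_mem _
    | add x y hx hy => rw [map_add]; exact Submodule.add_mem _ hx hy
    | tmul q p =>
      rw [compForm, TensorProduct.map_tmul]
      exact tmul_mem_convFormsDeg (by simp) (ofComponents_mem_convDeg q) (fn_mem_formsDeg p)
  · induction b using TensorProduct.induction_on with
    | zero => rw [map_zero]; exact Submodule.zero_mem _
    | add x y hx hy => rw [map_add]; exact Submodule.add_mem _ hx hy
    | tmul q p =>
      rw [homDiff, TensorProduct.map_tmul]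
      exact tmul_mem_convFormsDeg (by simp) (ofHom_mem_convDeg q) (dfn_mem_formsDeg p)

/-- A `j`-form has a coefficient of degree `j - 1`, so only functions and one-forms remain; the
restriction to the interval makes the one-forms exact. -/
theorem exists_compForm_add_homDiff_of_mem_convFormsDeg [CharZero K]
    {x : ConvForms K V₀ V₁ W₀ W₁ 1} (hx : x ∈ convFormsDeg K V₀ V₁ W₀ W₁ 1 (-1)) :
    ∃ a b, compForm K V₀ V₁ W₀ W₁ 1 a + homDiff K V₀ V₁ W₀ W₁ 1 b = x := by
  have h : x ∈ LinearMap.range (compForm K V₀ V₁ W₀ W₁ 1) ⊔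
      LinearMap.range (homDiff K V₀ V₁ W₀ W₁ 1) := by
    refine convFormsDeg_le (fun j f ω hf hω => ?_) hx
    rcases j with _ | _ | j
    · obtain ⟨q, rfl⟩ := exists_ofComponents_of_mem_convDeg hf
      obtain ⟨p, rfl⟩ := exists_fn_of_mem_formsDeg hω
      exact Submodule.mem_sup_left ⟨q ⊗ₜ[K] p, rfl⟩
    · obtain ⟨q, rfl⟩ := exists_ofHom_of_mem_convDeg hf
      obtain ⟨p, rfl⟩ := exists_dfn_of_mem_formsDeg hω
      exact Submodule.mem_sup_right ⟨q ⊗ₜ[K] p, rfl⟩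
    · rw [eq_zero_of_mem_convDeg (by push_cast; lia) hf, TensorProduct.zero_tmul]
      exact Submodule.zero_mem _
  obtain ⟨_, ⟨a, rfl⟩, _, ⟨b, rfl⟩, e⟩ := Submodule.mem_sup.1 h
  exact ⟨a, b, e⟩

end FormDegrees

/-! ### Components are determined by the forms they define. -/

section Injectivity

variable {K V₀ V₁ W₀ W₁ : Type*} [Field K]
  [AddCommGroup V₀] [Module K V₀] [AddCommGroup V₁] [Module K V₁]
  [AddCommGroup W₀] [Module K W₀] [AddCommGroup W₁] [Module K W₁] {n : ℕ}

theorem ofComponents_injective : Function.Injective (ofComponents K V₀ V₁ W₀ W₁) := by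
  refine (injective_iff_map_eq_zero _).2 fun p hp => ?_
  have h₁ : ∀ x : V₀ × V₁, ofComponents K V₀ V₁ W₀ W₁ p (1 ⊗ₜ[K] x) = 0 := fun x => by
    rw [hp]; rfl
  have h₂ : ∀ x y : V₀, ofComponents K V₀ V₁ W₀ W₁ p
      ((TensorAlgebra.ι K (x, (0 : V₁)) * 1) ⊗ₜ[K] (y, 0)) = 0 := fun x y => by
    rw [hp]; rfl
  simp only [ofComponents_tmul, coeff₀_one, one_smul, part₀_cons, coeff₀_cons, zero_smul,
    zero_add, Prod.mk_eq_zero] at h₁ h₂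
  have h₃ : part₀ (1 : Words K V₀ V₁) = 0 := congrArg Prod.fst part₁_one
  refine Prod.ext (LinearMap.ext fun x => (h₁ (x, 0)).1) (Prod.ext (LinearMap.ext fun x => ?_)
    (LinearMap.ext₂ fun x y => (h₂ x y).2))
  have h₄ := (h₁ (0, x)).2
  rwa [h₃, map_zero, add_zero] at h₄

theorem ofHom_injective : Function.Injective (ofHom K V₀ V₁ W₀ W₁) := by
  refine (injective_iff_map_eq_zero _).2 fun q hq => LinearMap.ext fun x => ?_
  have h : ofHom K V₀ V₁ W₀ W₁ q (1 ⊗ₜ[K] (x, 0)) = 0 := by rw [hq]; rfl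
  rw [ofHom_tmul, coeff₀_one, one_smul] at h
  exact congrArg Prod.snd h

theorem fn_injective : Function.Injective (fn K (Fin n)) := by
  have h : ∀ p, TensorProduct.rid K _ (LinearMap.lTensor _
      (ExteriorAlgebra.algebraMapInv (R := K) (M := Fin n → K)).toLinearMap (fn K (Fin n) p)) =
      p := fun p => by simp [fn_apply]
  intro p q hpq
  rw [← h p, hpq, h q]

/-- Over a field both factors have linear left inverses, whose tensor product is again a left
inverse. -/
theorem map_fn_injective {M L : Type*} [AddCommGroup M] [Module K M] [AddCommGroup L] [Module K L]
    {φ : M →ₗ[K] L} (hφ : Function.Injective φ) :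
    Function.Injective (TensorProduct.map φ (fn K (Fin n))) := by
  obtain ⟨ψ, hψ⟩ := LinearMap.exists_leftInverse_of_injective φ (LinearMap.ker_eq_bot.2 hφ)
  obtain ⟨χ, hχ⟩ := LinearMap.exists_leftInverse_of_injective (fn K (Fin n))
    (LinearMap.ker_eq_bot.2 fn_injective)
  refine Function.LeftInverse.injective (g := TensorProduct.map ψ χ) fun x => ?_
  rw [TensorProduct.map_map, hψ, hχ, TensorProduct.map_id]
  rfl

theorem compForm_injective : Function.Injective (compForm K V₀ V₁ W₀ W₁ n) :=
  map_fn_injective ofComponents_injective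

theorem homForm_injective : Function.Injective (homForm K V₀ V₁ W₀ W₁ n) :=
  map_fn_injective ofHom_injective

end Injectivity

/-! ### 2-term homotopies as translations, in both directions. -/

section Translation

variable {K V₀ V₁ W₀ W₁ : Type*} [Field K]
  [AddCommGroup V₀] [Module K V₀] [AddCommGroup V₁] [Module K V₁]
  [AddCommGroup W₀] [Module K W₀] [AddCommGroup W₁] [Module K W₁]
  {A : TwoTermLeibniz K V₀ V₁} {B : TwoTermLeibniz K W₀ W₁} {f g : InftyMorphism A B}
  {θ : V₀ →ₗ[K] W₁}

theorem IsTwoTermHomotopy.toConv_translate (h : IsTwoTermHomotopy f g θ) :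
    (f.translate θ).toConv = g.toConv := by
  rw [InftyMorphism.toConv_eq, InftyMorphism.toConv_eq]
  congr 1
  have h₀ : ∀ x, g.f0 x = f.f0 x + B.l1 (θ x) := fun x => by rw [← h.deg_zero]; abel
  have h₁ : ∀ x, g.f1 x = f.f1 x + θ (A.l1 x) := fun x => by rw [← h.deg_one]; abel
  have h₂ : ∀ x y, g.f2 x y = f.f2 x y + (θ (A.l00 x y) - B.l01 (f.f0 x) (θ y) -
      B.l10 (θ x) (g.f0 y)) := fun x y => by rw [← h.two]; abel
  refine Prod.ext (LinearMap.ext fun x => (h₀ x).symm) (Prod.ext (LinearMap.ext fun x => (h₁ x).symm)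
    (LinearMap.ext₂ fun x y => ?_))
  refine Eq.trans ?_ (h₂ x y).symm
  rw [h₀, map_add]
  simp only [InftyMorphism.components, InftyMorphism.translate, LinearMap.add_apply,
    LinearMap.sub_apply, LinearMap.compr₂_apply, LinearMap.compl₁₂_apply, LinearMap.comp_apply]
  abel

theorem IsTwoTermHomotopy.toConv_translate_neg (h : IsTwoTermHomotopy f g θ) :
    (g.translate (-θ)).toConv = f.toConv := by
  rw [InftyMorphism.toConv_eq, InftyMorphism.toConv_eq]
  congr 1
  have h₀ : ∀ x, f.f0 x = g.f0 x - B.l1 (θ x) := fun x => by rw [← h.deg_zero]; abel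
  have h₁ : ∀ x, f.f1 x = g.f1 x - θ (A.l1 x) := fun x => by rw [← h.deg_one]; abel
  have h₂ : ∀ x y, f.f2 x y = g.f2 x y - (θ (A.l00 x y) - B.l01 (f.f0 x) (θ y) -
      B.l10 (θ x) (g.f0 y)) := fun x y => by rw [← h.two]; abel
  refine Prod.ext (LinearMap.ext fun x => ?_) (Prod.ext (LinearMap.ext fun x => ?_)
    (LinearMap.ext₂ fun x y => ?_))
  · refine Eq.trans ?_ (h₀ x).symm
    simp [InftyMorphism.components, InftyMorphism.translate, sub_eq_add_neg]
  · refine Eq.trans ?_ (h₁ x).symm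
    simp [InftyMorphism.components, InftyMorphism.translate, sub_eq_add_neg]
  · refine Eq.trans ?_ (h₂ x y).symm
    -- Rewriting `f` in terms of `g` leaves the term `[l₁ θ x, θ y]`; `l1_comm` identifies it with
    -- the quadratic term of the translate.
    rw [h₀, map_sub, LinearMap.sub_apply, B.l1_comm]
    simp only [InftyMorphism.components, InftyMorphism.translate, LinearMap.add_apply,
      LinearMap.sub_apply, LinearMap.compr₂_apply, LinearMap.compl₁₂_apply, LinearMap.comp_apply,
      LinearMap.neg_apply, map_neg]
    abel

theorem InftyMorphism.toConv_translate_zero (g : InftyMorphism A B) :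
    (g.translate 0).toConv = g.toConv :=
  IsTwoTermHomotopy.toConv_translate ⟨by simp, by simp, by simp⟩

end Translation

/-! ### Restriction of vector-valued polynomials along simplicial maps. -/

section Restriction

variable {K M N P : Type*} [Field K] [AddCommGroup M] [Module K M] [AddCommGroup N] [Module K N]
  [AddCommGroup P] [Module K P] {l m n : ℕ}

theorem restrict_tmul (f : Fin (m + 1) → Fin (n + 1)) (x : M) (p : MvPolynomial (Fin n) K) :
    restrict M f (x ⊗ₜ[K] p) = x ⊗ₜ[K] MvPolynomial.aeval (affineMap K f) p := by
  simp [restrict]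

theorem restrict_rTensor (f : Fin (m + 1) → Fin (n + 1)) (φ : M →ₗ[K] N)
    (x : M ⊗[K] MvPolynomial (Fin n) K) :
    restrict N f (LinearMap.rTensor _ φ x) = LinearMap.rTensor _ φ (restrict M f x) := by
  induction x using TensorProduct.induction_on with
  | zero => simp only [map_zero]
  | add x y hx hy => simp only [map_add, hx, hy]
  | tmul x p => rw [LinearMap.rTensor_tmul, restrict_tmul, restrict_tmul, LinearMap.rTensor_tmul]

theorem restrict_polyBilin (f : Fin (m + 1) → Fin (n + 1)) (b : M →ₗ[K] N →ₗ[K] P)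
    (x : M ⊗[K] MvPolynomial (Fin n) K) (y : N ⊗[K] MvPolynomial (Fin n) K) :
    restrict P f (polyBilin (Fin n) b x y) =
      polyBilin (Fin m) b (restrict M f x) (restrict N f y) := by
  have h : (polyBilin (Fin n) b).compr₂ (restrict P f) =
      (polyBilin (Fin m) b).compl₁₂ (restrict M f) (restrict N f) :=
    tensor_bilin_ext fun x p y q => by
      simp only [LinearMap.compr₂_apply, LinearMap.compl₁₂_apply, polyBilin_tmul, restrict_tmul,
        map_mul]
  exact LinearMap.congr_fun₂ h x y

theorem restrict_restrict (f : Fin (l + 1) → Fin (m + 1)) (g : Fin (m + 1) → Fin (n + 1))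
    (x : M ⊗[K] MvPolynomial (Fin n) K) :
    restrict M f (restrict M g x) = restrict M (g ∘ f) x := by
  induction x using TensorProduct.induction_on with
  | zero => simp only [map_zero]
  | add x y hx hy => simp only [map_add, hx, hy]
  | tmul x p => rw [restrict_tmul, restrict_tmul, restrict_tmul, aeval_affineMap_aeval_affineMap]

theorem restrict_id (x : M ⊗[K] MvPolynomial (Fin n) K) : restrict M id x = x := by
  induction x using TensorProduct.induction_on with
  | zero => simp only [map_zero]
  | add x y hx hy => simp only [map_add, hx, hy]
  | tmul x p => rw [restrict_tmul, aeval_affineMap_id]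

theorem restrict_const (i : Fin (n + 1)) (x : M ⊗[K] MvPolynomial (Fin n) K) :
    restrict M (fun _ : Fin (m + 1) => i) x = evalAt M (vertex K i) x ⊗ₜ[K] 1 := by
  induction x using TensorProduct.induction_on with
  | zero => simp only [map_zero, TensorProduct.zero_tmul]
  | add x y hx hy => simp only [map_add, hx, hy, TensorProduct.add_tmul]
  | tmul x p => rw [restrict_tmul, aeval_affineMap_const, evalAt_tmul, TensorProduct.smul_tmul,
      MvPolynomial.smul_eq_C_mul, mul_one]

theorem evalAt_restrict (f : Fin (m + 1) → Fin (n + 1)) (i : Fin (m + 1))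
    (x : M ⊗[K] MvPolynomial (Fin n) K) :
    evalAt M (vertex K i) (restrict M f x) = evalAt M (vertex K (f i)) x := by
  induction x using TensorProduct.induction_on with
  | zero => simp only [map_zero]
  | add x y hx hy => simp only [map_add, hx, hy]
  | tmul x p => rw [restrict_tmul, evalAt_tmul, evalAt_tmul, aeval_vertex_aeval_affineMap]

end Restriction

/-! ### Faces, vertices and classification of Maurer-Cartan families. -/

section Families

variable {K V₀ V₁ W₀ W₁ : Type*} [Field K] [CharZero K]
  [AddCommGroup V₀] [Module K V₀] [AddCommGroup V₁] [Module K V₁]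
  [AddCommGroup W₀] [Module K W₀] [AddCommGroup W₁] [Module K W₁]
  {A : TwoTermLeibniz K V₀ V₁} {B : TwoTermLeibniz K W₀ W₁} {n : ℕ} (g : InftyMorphism A B)

theorem InftyMorphism.restrict_transport {m : ℕ} (f : Fin (m + 1) → Fin (n + 1))
    (b : (V₀ →ₗ[K] W₁) ⊗[K] MvPolynomial (Fin n) K) :
    restrict (Components K V₀ V₁ W₀ W₁) f (g.transport b) = g.transport (restrict _ f b) := by
  rw [transport, map_sub, map_sub, map_add, restrict_rTensor, restrict_rTensor, restrict_polyBilin,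
    restrict_tmul, map_one, transport]

theorem InftyMorphism.faceBar_family (i : Fin (n + 2))
    (b : (V₀ →ₗ[K] W₁) ⊗[K] MvPolynomial (Fin (n + 1)) K) :
    faceBar i (g.family b) = g.family (restrict _ i.succAbove b) := by
  rw [family, map_add, compForm, homDiff, faceBar_map_fn, faceBar_map_dfn, g.restrict_transport]
  rfl

theorem InftyMorphism.evalBar_family (i : Fin (n + 1))
    (b : (V₀ →ₗ[K] W₁) ⊗[K] MvPolynomial (Fin n) K) :
    evalBar i (g.family b) = (g.translate (evalAt (V₀ →ₗ[K] W₁) (vertex K i) b)).toConv := by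
  rw [family, map_add, compForm, homDiff, evalBar_map_fn, evalBar_map_dfn, g.evalAt_transport,
    add_zero, toConv_eq]

theorem InftyMorphism.hBar_family (i : Fin (n + 1))
    (b : (V₀ →ₗ[K] W₁) ⊗[K] MvPolynomial (Fin n) K) :
    hBar i (g.family b) =
      homForm K V₀ V₁ W₀ W₁ n (b - evalAt _ (vertex K i) b ⊗ₜ[K] 1) := by
  rw [family, map_add, hBar_compForm, hBar_homDiff, zero_add]

theorem InftyMorphism.family_mem_MC (b : (V₀ →ₗ[K] W₁) ⊗[K] MvPolynomial (Fin n) K) :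
    g.family b ∈ MC A B n :=
  ⟨compForm_add_homDiff_mem_convFormsDeg _ _, g.family_maurerCartan b⟩

/-- The constant that `h_1^i` subtracts cancels in the difference of the end values, so the result
does not depend on `i`. -/
theorem InftyMorphism.project_family (i : Fin 2)
    (b : (V₀ →ₗ[K] W₁) ⊗[K] MvPolynomial (Fin 1) K) :
    project i (g.family b) = evalAt (V₀ →ₗ[K] W₁) (vertex K 1) b - evalAt _ (vertex K 0) b := by
  rw [project, g.hBar_family, homForm, evalBar_map_fn, evalBar_map_fn, map_sub (evalAt _ _),
    map_sub (evalAt _ _), evalAt_tmul, evalAt_tmul, map_one, map_one]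
  refine LinearMap.ext fun x => ?_
  simp [ofHom_tmul]

theorem truncate_ofComponents (p : Components K V₀ V₁ W₀ W₁) :
    truncate K V₀ V₁ W₀ W₁ (ofComponents K V₀ V₁ W₀ W₁ p) =
      ofComponents K V₀ V₁ W₀ W₁ (LinearMap.inl K _ _ (LinearMap.fst K _ _ p)) := by
  refine TensorProduct.ext' fun w x => ?_
  simp [truncate, ofComponents_tmul]

theorem truncate_compForm (a : Components K V₀ V₁ W₀ W₁ ⊗[K] MvPolynomial (Fin n) K) :
    TensorProduct.map (truncate K V₀ V₁ W₀ W₁) LinearMap.id (compForm K V₀ V₁ W₀ W₁ n a) =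
      compForm K V₀ V₁ W₀ W₁ n (LinearMap.rTensor _ (LinearMap.inl K _ _)
        (LinearMap.rTensor _ (LinearMap.fst K _ _) a)) := by
  induction a using TensorProduct.induction_on with
  | zero => simp only [map_zero]
  | add x y hx hy => simp only [map_add, hx, hy]
  | tmul p r => rw [compForm, TensorProduct.map_tmul, TensorProduct.map_tmul, truncate_ofComponents,
      LinearMap.rTensor_tmul, LinearMap.rTensor_tmul, TensorProduct.map_tmul, LinearMap.id_apply]

variable (B) in
theorem truncate_mixedForm (a : Components K V₀ V₁ W₀ W₁ ⊗[K] MvPolynomial (Fin n) K)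
    (b : (V₀ →ₗ[K] W₁) ⊗[K] MvPolynomial (Fin n) K) :
    TensorProduct.map (truncate K V₀ V₁ W₀ W₁) LinearMap.id (mixedForm n B a b) = 0 := by
  have h : (mixedForm n B).compr₂
      (TensorProduct.map (truncate K V₀ V₁ W₀ W₁) LinearMap.id) = 0 :=
    tensor_bilin_ext fun p r q s => by
      rw [LinearMap.compr₂_apply, mixedForm_tmul, TensorProduct.map_tmul, truncate_ofComponents]
      have e : LinearMap.fst K _ _ (mixedBracket B p q) = 0 := rfl
      rw [e, map_zero, map_zero, TensorProduct.zero_tmul]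
      rfl
  exact LinearMap.congr_fun₂ h a b

theorem truncate_hBar (i : Fin (n + 1)) (x : ConvForms K V₀ V₁ W₀ W₁ n) :
    TensorProduct.map (truncate K V₀ V₁ W₀ W₁) LinearMap.id (hBar i x) =
      hBar i (TensorProduct.map (truncate K V₀ V₁ W₀ W₁) LinearMap.id x) := by
  rw [hBar, TensorProduct.map_map, TensorProduct.map_map, convParity_comp_truncate]
  rfl

variable (A B) in
/-- The consequence of the Maurer-Cartan equation under the operator `h`. -/
theorem hBar_compDiff_add_mixedForm {i : Fin (n + 1)}
    {a : Components K V₀ V₁ W₀ W₁ ⊗[K] MvPolynomial (Fin n) K}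
    {b : (V₀ →ₗ[K] W₁) ⊗[K] MvPolynomial (Fin n) K}
    (h : bar₁ A B n (compForm K V₀ V₁ W₀ W₁ n a + homDiff K V₀ V₁ W₀ W₁ n b) +
      nonlinear B (compForm K V₀ V₁ W₀ W₁ n a + homDiff K V₀ V₁ W₀ W₁ n b) = 0) :
    hBar i (mixedForm n B a b) =
      hBar i (compDiff K V₀ V₁ W₀ W₁ n (LinearMap.rTensor _ (linearPart A B) b - a)) := by
  have h' := congrArg (hBar i) h
  rw [nonlinear_compForm_add_homDiff, map_add (bar₁ A B n), bar₁_compForm, bar₁_homDiff,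
    map_zero, map_add, map_add, map_add, map_add, hBar_map_fn, hBar_map_fn, map_smul, map_smul] at h'
  rw [map_sub, map_sub]
  generalize hBar i (mixedForm n B a b) = x, hBar i (compDiff K V₀ V₁ W₀ W₁ n a) = y,
    hBar i (compDiff K V₀ V₁ W₀ W₁ n (LinearMap.rTensor _ (linearPart A B) b)) = z at h' ⊢
  rw [← add_zero x, ← h']
  module

/-- Applying `h` to the one-form part of the equation determines `a` in two rounds: the `V₀ → W₀`
component first, because the mixed term does not contribute to it; then everything, because the
mixed term has become explicit. -/
theorem InftyMorphism.exists_eq_family_of_mem_MC {i : Fin 2} {α : ConvForms K V₀ V₁ W₀ W₁ 1}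
    (hα : α ∈ MC A B 1) (hi : evalBar i α = g.toConv) :
    ∃ b : (V₀ →ₗ[K] W₁) ⊗[K] MvPolynomial (Fin 1) K,
      evalAt (V₀ →ₗ[K] W₁) (vertex K i) b = 0 ∧ α = g.family b := by
  obtain ⟨a, b₀, rfl⟩ := exists_compForm_add_homDiff_of_mem_convFormsDeg hα.1
  obtain ⟨b, hb, hb₀⟩ : ∃ b : (V₀ →ₗ[K] W₁) ⊗[K] MvPolynomial (Fin 1) K,
      evalAt (V₀ →ₗ[K] W₁) (vertex K i) b = 0 ∧
      homDiff K V₀ V₁ W₀ W₁ 1 b₀ = homDiff K V₀ V₁ W₀ W₁ 1 b := by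
    -- Only `db` matters, so `b` may be normalized to vanish at the vertex.
    refine ⟨b₀ - evalAt _ (vertex K i) b₀ ⊗ₜ[K] 1, ?_, ?_⟩
    · rw [map_sub, evalAt_tmul, map_one, one_smul, sub_self]
    · rw [map_sub, homDiff_tmul_one]
      abel
  rw [hb₀] at hα hi ⊢
  refine ⟨b, hb, ?_⟩
  have ha : evalAt (Components K V₀ V₁ W₀ W₁) (vertex K i) a = g.components := by
    rw [map_add, compForm, homDiff, evalBar_map_fn, evalBar_map_dfn, add_zero, toConv_eq] at hi
    exact ofComponents_injective hi
  have key := hBar_compDiff_add_mixedForm A B (i := i) hα.2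
  -- `D` is the polynomial `l₁ b - a`, normalized at the vertex; by `hDa` it measures how far `a` is
  -- from `g + l₁ b`.
  obtain ⟨D, hD⟩ : ∃ D, D = LinearMap.rTensor _ (linearPart A B) b - a -
    evalAt (Components K V₀ V₁ W₀ W₁) (vertex K i)
      (LinearMap.rTensor _ (linearPart A B) b - a) ⊗ₜ[K] 1 := ⟨_, rfl⟩
  rw [hBar_compDiff, ← hD] at key
  rw [map_sub, evalAt_rTensor, hb, map_zero, ha, zero_sub, TensorProduct.neg_tmul] at hD
  have hDa : D + a = g.components ⊗ₜ[K] 1 + LinearMap.rTensor _ (linearPart A B) b := by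
    rw [hD]; abel
  -- The mixed term takes values in `W₁`, so truncating the identity to `W₀` leaves `D` alone.
  have hfst : LinearMap.rTensor _ (LinearMap.fst K _ _) D = 0 := by
    have h := congrArg (TensorProduct.map (truncate K V₀ V₁ W₀ W₁) LinearMap.id) key
    rw [truncate_hBar, truncate_mixedForm, map_zero, map_smul, truncate_compForm] at h
    have h' := (smul_eq_zero.1 h.symm).resolve_left (neg_ne_zero.2 one_ne_zero)
    have h'' := compForm_injective (h'.trans (map_zero _).symm)
    have h₃ := congrArg (LinearMap.rTensor _ (LinearMap.fst K (V₀ →ₗ[K] W₀)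
      ((V₁ →ₗ[K] W₁) × (V₀ →ₗ[K] V₀ →ₗ[K] W₁)))) h''
    rwa [← LinearMap.comp_apply, ← LinearMap.rTensor_comp, LinearMap.fst_comp_inl,
      LinearMap.rTensor_id, LinearMap.id_apply, map_zero] at h₃
  have hfst' : LinearMap.rTensor _ (LinearMap.fst K _ _) a =
      LinearMap.rTensor _ (LinearMap.fst K _ _)
        (g.components ⊗ₜ[K] 1 + LinearMap.rTensor _ (linearPart A B) b) := by
    rw [← hDa, map_add, hfst, zero_add]
  -- `S` is the primitive of the mixed term and vanishes at the vertex, so `h` gives `S = D`, and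
  -- `a` is `g + l₁ b - S`.
  obtain ⟨S, hS⟩ : ∃ S, S = LinearMap.rTensor _ (mixedBracket B g.components) b +
    polyBilin (Fin 1) (crossBracket V₀ V₁ B) b b := ⟨_, rfl⟩
  have hS₀ : evalAt (Components K V₀ V₁ W₀ W₁) (vertex K i) S = 0 := by
    rw [hS, map_add, evalAt_rTensor, evalAt_polyBilin, hb, map_zero, map_zero, add_zero]
  have hST := g.transport_add b
  rw [mixedForm_of_fst_eq g hfst', ← hS, hBar_compDiff, hS₀, TensorProduct.zero_tmul] at key
  rw [← hS, ← hDa] at hST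
  have hSD := compForm_injective
    (smul_right_injective _ (neg_ne_zero.2 (one_ne_zero (α := K))) key)
  have haT : a = g.transport b := by
    have e : a = (D + a) - D := by abel
    rw [e, ← hST, ← hSD]
    abel
  rw [haT, family]

end Families

/-! ### Vertices of the interval, lifts, horns and the vertical composite. -/

theorem vertex_zero_apply {K : Type*} [Field K] (j : Fin 1) : vertex K (0 : Fin 2) j = 0 :=
  if_neg (Fin.succ_ne_zero j).symm

theorem vertex_one_apply {K : Type*} [Field K] (j : Fin 1) : vertex K (1 : Fin 2) j = 1 := by
  rw [Subsingleton.elim j 0]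
  exact if_pos rfl

section VerticalComposition

variable {K V₀ V₁ W₀ W₁ : Type*} [Field K] [CharZero K]
  [AddCommGroup V₀] [Module K V₀] [AddCommGroup V₁] [Module K V₁]
  [AddCommGroup W₀] [Module K W₀] [AddCommGroup W₁] [Module K W₁]
  {A : TwoTermLeibniz K V₀ V₁} {B : TwoTermLeibniz K W₀ W₁} {f g h : InftyMorphism A B}
  {θ τ : V₀ →ₗ[K] W₁}

/-- A family around `g` is an infinity homotopy as soon as its values at the two vertices are. -/
theorem InftyMorphism.family_mem_inftyHomotopies
    {b : (V₀ →ₗ[K] W₁) ⊗[K] MvPolynomial (Fin 1) K}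
    (h₀ : (g.translate (evalAt (V₀ →ₗ[K] W₁) (vertex K 0) b)).toConv = f.toConv)
    (h₁ : (g.translate (evalAt (V₀ →ₗ[K] W₁) (vertex K 1) b)).toConv = h.toConv) :
    g.family b ∈ inftyHomotopies f h :=
  ⟨g.family_mem_MC b, (g.evalBar_family 0 b).trans h₀, (g.evalBar_family 1 b).trans h₁⟩

/-- The straight path `(t - 1) θ` around the terminal morphism `g`: it starts at the translate by
`-θ`, which is `f`, and ends at `g`. -/
theorem IsTwoTermHomotopy.exists_isLift_one (hθ : IsTwoTermHomotopy f g θ) :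
    ∃ α, IsLift 1 f g θ α := by
  have h₀ : evalAt (V₀ →ₗ[K] W₁) (vertex K 0)
      (θ ⊗ₜ[K] (MvPolynomial.X 0 - 1 : MvPolynomial (Fin 1) K)) = -θ := by
    rw [evalAt_tmul, map_sub, map_one, MvPolynomial.aeval_X, vertex_zero_apply, zero_sub, neg_smul,
      one_smul]
  have h₁ : evalAt (V₀ →ₗ[K] W₁) (vertex K 1)
      (θ ⊗ₜ[K] (MvPolynomial.X 0 - 1 : MvPolynomial (Fin 1) K)) = 0 := by
    rw [evalAt_tmul, map_sub, map_one, MvPolynomial.aeval_X, vertex_one_apply, sub_self, zero_smul]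
  refine ⟨g.family (θ ⊗ₜ[K] (MvPolynomial.X 0 - 1)),
    InftyMorphism.family_mem_inftyHomotopies ?_ ?_, ?_⟩
  · rw [h₀, hθ.toConv_translate_neg]
  · rw [h₁, g.toConv_translate_zero]
  · rw [g.project_family, h₀, h₁, zero_sub, neg_neg]

/-- The straight path `t τ` around the initial morphism `g`. -/
theorem IsTwoTermHomotopy.exists_isLift_zero (hτ : IsTwoTermHomotopy g h τ) :
    ∃ α, IsLift 0 g h τ α := by
  have h₀ : evalAt (V₀ →ₗ[K] W₁) (vertex K 0)
      (τ ⊗ₜ[K] (MvPolynomial.X 0 : MvPolynomial (Fin 1) K)) = 0 := by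
    rw [evalAt_tmul, MvPolynomial.aeval_X, vertex_zero_apply, zero_smul]
  have h₁ : evalAt (V₀ →ₗ[K] W₁) (vertex K 1)
      (τ ⊗ₜ[K] (MvPolynomial.X 0 : MvPolynomial (Fin 1) K)) = τ := by
    rw [evalAt_tmul, MvPolynomial.aeval_X, vertex_one_apply, one_smul]
  refine ⟨g.family (τ ⊗ₜ[K] MvPolynomial.X 0),
    InftyMorphism.family_mem_inftyHomotopies ?_ ?_, ?_⟩
  · rw [h₀, g.toConv_translate_zero]
  · rw [h₁, hτ.toConv_translate]
  · rw [g.project_family, h₀, h₁, sub_zero]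

/-- A lift along `S_1^1` is a family of translates of the terminal morphism. -/
theorem IsLift.exists_family_one {α : ConvForms K V₀ V₁ W₀ W₁ 1} (hα : IsLift 1 f g θ α) :
    ∃ b : (V₀ →ₗ[K] W₁) ⊗[K] MvPolynomial (Fin 1) K, α = g.family b ∧
      hBar 1 α = homForm K V₀ V₁ W₀ W₁ 1 b ∧
      evalAt (V₀ →ₗ[K] W₁) (vertex K 0) b = -θ ∧ evalAt (V₀ →ₗ[K] W₁) (vertex K 1) b = 0 := by
  obtain ⟨⟨hMC, -, h₁⟩, hp⟩ := hα
  obtain ⟨b, hb, rfl⟩ := g.exists_eq_family_of_mem_MC hMC h₁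
  rw [g.project_family, hb, zero_sub] at hp
  refine ⟨b, rfl, ?_, ?_, hb⟩
  · rw [g.hBar_family, hb, TensorProduct.zero_tmul, sub_zero]
  · rw [← hp, neg_neg]

/-- A lift along `S_1^0` is a family of translates of the initial morphism. -/
theorem IsLift.exists_family_zero {α : ConvForms K V₀ V₁ W₀ W₁ 1} (hα : IsLift 0 g h τ α) :
    ∃ b : (V₀ →ₗ[K] W₁) ⊗[K] MvPolynomial (Fin 1) K, α = g.family b ∧
      hBar 0 α = homForm K V₀ V₁ W₀ W₁ 1 b ∧
      evalAt (V₀ →ₗ[K] W₁) (vertex K 0) b = 0 ∧ evalAt (V₀ →ₗ[K] W₁) (vertex K 1) b = τ := by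
  obtain ⟨⟨hMC, h₀, -⟩, hp⟩ := hα
  obtain ⟨b, hb, rfl⟩ := g.exists_eq_family_of_mem_MC hMC h₀
  rw [g.project_family, hb, sub_zero] at hp
  refine ⟨b, rfl, ?_, hb, hp⟩
  rw [g.hBar_family, hb, TensorProduct.zero_tmul, sub_zero]

theorem faceBar_homForm {n : ℕ} (i : Fin (n + 2))
    (b : (V₀ →ₗ[K] W₁) ⊗[K] MvPolynomial (Fin (n + 1)) K) :
    faceBar i (homForm K V₀ V₁ W₀ W₁ (n + 1) b) =
      homForm K V₀ V₁ W₀ W₁ n (restrict _ i.succAbove b) :=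
  faceBar_map_fn i _ b

theorem IsLift.exists_isHornExtension {α' α'' : ConvForms K V₀ V₁ W₀ W₁ 1}
    (hα' : IsLift 1 f g θ α') (hα'' : IsLift 0 g h τ α'') : ∃ β, IsHornExtension α' α'' β := by
  obtain ⟨b', -, hb', -, h₁⟩ := hα'.exists_family_one
  obtain ⟨b'', -, hb'', h₀, -⟩ := hα''.exists_family_zero
  have e₁ : (![0, 1, 1] : Fin 3 → Fin 2) ∘ (2 : Fin 3).succAbove = id := by decide
  have e₂ : (![0, 0, 1] : Fin 3 → Fin 2) ∘ (2 : Fin 3).succAbove = fun _ => 0 := by decide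
  have e₃ : (![0, 1, 1] : Fin 3 → Fin 2) ∘ (0 : Fin 3).succAbove = fun _ => 1 := by decide
  have e₄ : (![0, 0, 1] : Fin 3 → Fin 2) ∘ (0 : Fin 3).succAbove = id := by decide
  -- The sum of the pullbacks along the two degeneracies of the triangle onto the interval. On the
  -- face where one summand is prescribed, the other is constant, equal to its value at the common
  -- vertex `1` of the triangle, and this value is zero.
  refine ⟨homForm K V₀ V₁ W₀ W₁ 2 (restrict _ ![0, 1, 1] b' + restrict _ ![0, 0, 1] b''),
    homForm_mem_convFormsDeg _, ?_, ?_⟩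
  · rw [faceBar_homForm, map_add, restrict_restrict, restrict_restrict, e₁, e₂, restrict_id,
      restrict_const, h₀, TensorProduct.zero_tmul, add_zero, hb']
  · rw [faceBar_homForm, map_add, restrict_restrict, restrict_restrict, e₃, e₄, restrict_id,
      restrict_const, h₁, TensorProduct.zero_tmul, zero_add, hb'']

/-- For degree reasons `β` is a polynomial `b` on the triangle. Its values `-θ, 0, τ` at the
vertices are forced by the two prescribed faces, and they alone determine the ends and the
projection of the edge `02`. -/
theorem IsHornExtension.exists_isKanLimit {α' α'' : ConvForms K V₀ V₁ W₀ W₁ 1}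
    {β : ConvForms K V₀ V₁ W₀ W₁ 2} (hβ : IsHornExtension α' α'' β)
    (hθ : IsTwoTermHomotopy f g θ) (hτ : IsTwoTermHomotopy g h τ)
    (hα' : IsLift 1 f g θ α') (hα'' : IsLift 0 g h τ α'') :
    ∃ α, IsKanLimit B 1 g.toConv (bar₁ A B 2 β) α ∧ α ∈ MC A B 2 ∧
      faceBar 2 α = α' ∧ faceBar 0 α = α'' ∧
      faceBar 1 α ∈ inftyHomotopies f h ∧ project 0 (faceBar 1 α) = τ + θ := by
  obtain ⟨b', rfl, hb', h₀', h₁'⟩ := hα'.exists_family_one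
  obtain ⟨b'', rfl, hb'', h₀'', h₁''⟩ := hα''.exists_family_zero
  obtain ⟨hdeg, h₂, h₀⟩ := hβ
  obtain ⟨b, rfl⟩ := exists_homForm_of_mem_convFormsDeg hdeg
  rw [faceBar_homForm, hb'] at h₂
  rw [faceBar_homForm, hb''] at h₀
  have r₂ := homForm_injective h₂
  have r₀ := homForm_injective h₀
  -- The vanishing at the vertex `1`, read off from the face `01`, is the hypothesis under which the
  -- Kan iteration stabilizes.
  have v₁ : evalAt (V₀ →ₗ[K] W₁) (vertex K (1 : Fin 3)) b = 0 := by
    rw [← h₁', ← r₂, evalAt_restrict]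
    rfl
  have w₀ : evalAt (V₀ →ₗ[K] W₁) (vertex K 0) (restrict _ (1 : Fin 3).succAbove b) = -θ := by
    rw [← h₀', ← r₂, evalAt_restrict, evalAt_restrict]
    rfl
  have w₁ : evalAt (V₀ →ₗ[K] W₁) (vertex K 1) (restrict _ (1 : Fin 3).succAbove b) = τ := by
    rw [← h₁'', ← r₀, evalAt_restrict, evalAt_restrict]
    rfl
  refine ⟨g.family b, g.isKanLimit_homForm 1 v₁, g.family_mem_MC b, ?_, ?_, ?_, ?_⟩
  · rw [g.faceBar_family, r₂]
  · rw [g.faceBar_family, r₀]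
  · rw [g.faceBar_family]
    refine InftyMorphism.family_mem_inftyHomotopies ?_ ?_
    · rw [w₀, hθ.toConv_translate_neg]
    · rw [w₁, hτ.toConv_translate]
  · rw [g.faceBar_family, g.project_family, w₀, w₁, sub_neg_eq_add]

theorem IsKanLimit.unique {n : ℕ} {i : Fin (n + 1)} {μ : Conv K V₀ V₁ W₀ W₁}
    {ν α α' : ConvForms K V₀ V₁ W₀ W₁ n} (hα : IsKanLimit B i μ ν α)
    (hα' : IsKanLimit B i μ ν α') : α = α' := by
  obtain ⟨N, hN⟩ := hα
  obtain ⟨N', hN'⟩ := hα'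
  rw [← hN _ (le_max_left N N'), hN' _ (le_max_right N N')]

end VerticalComposition

end LeibnizHomotopy

end

open LeibnizHomotopy in
theorem mainTheorem2 {K V₀ V₁ W₀ W₁ : Type*} [Field K] [CharZero K]
    [AddCommGroup V₀] [Module K V₀] [AddCommGroup V₁] [Module K V₁]
    [AddCommGroup W₀] [Module K W₀] [AddCommGroup W₁] [Module K W₁]
    {A : TwoTermLeibniz K V₀ V₁} {B : TwoTermLeibniz K W₀ W₁}
    (f g h : InftyMorphism A B) (θ τ : V₀ →ₗ[K] W₁)
    (hθ : IsTwoTermHomotopy f g θ) (hτ : IsTwoTermHomotopy g h τ) :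
    (∃ α', IsLift 1 f g θ α') ∧ (∃ α'', IsLift 0 g h τ α'') ∧
    (∀ α' α'', IsLift 1 f g θ α' → IsLift 0 g h τ α'' →
      (∃ β, IsHornExtension α' α'' β) ∧
      ∀ β, IsHornExtension α' α'' β →
        ∃ α, IsKanLimit B 1 g.toConv (bar₁ A B 2 β) α ∧ α ∈ MC A B 2 ∧
          faceBar 2 α = α' ∧ faceBar 0 α = α'' ∧
          faceBar 1 α ∈ inftyHomotopies f h ∧ project 0 (faceBar 1 α) = τ + θ) ∧
    (∀ ρ, IsVerticalComposite f g h θ τ ρ ↔ ρ = τ + θ) ∧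
    IsTwoTermHomotopy f h (τ + θ) := by
  refine ⟨hθ.exists_isLift_one, hτ.exists_isLift_zero, fun α' α'' hα' hα'' =>
    ⟨hα'.exists_isHornExtension hα'', fun β hβ => hβ.exists_isKanLimit hθ hτ hα' hα''⟩,
    fun ρ => ⟨?_, ?_⟩, hθ.trans hτ⟩
  -- The given filler is the limit of the same iteration as the one constructed, so the two
  -- coincide.
  · rintro ⟨α', α'', α, hα', hα'', ⟨β, hβ, hα⟩, rfl⟩
    obtain ⟨γ, hγ, -, -, -, -, hp⟩ := hβ.exists_isKanLimit hθ hτ hα' hα''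
    rw [hα.unique hγ, hp]
  · rintro rfl
    obtain ⟨α', hα'⟩ := hθ.exists_isLift_one
    obtain ⟨α'', hα''⟩ := hτ.exists_isLift_zero
    obtain ⟨β, hβ⟩ := hα'.exists_isHornExtension hα''
    obtain ⟨α, hα, -, -, -, -, hp⟩ := hβ.exists_isKanLimit hθ hτ hα' hα''
    exact ⟨α', α'', α, hα', hα'', ⟨β, hβ, hα⟩, hp.symm⟩
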